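/- Let $\mathbb K\in\{\mathbb R,\mathbb C\}$, let $E$ be a Banach space over $\mathbb K$, let $1<p<\infty$ and let $1/p+1/p^*=1$. For a Banach space $G$ let $B_G$ be its closed unit ball, $G'$ its dual, and let $\ell_p^w(G)$ be the space of sequences in $G$ with $\|(x_n)\|_{w,p}=\sup_{f\in B_{G'}}\big(\sum_n|f(x_n)|^p\big)^{1/p}<\infty$. Let $\ell_p^{\rm mid}(E)$ be the space of sequences in $E$ with $$\|(x_j)\|_{p,\rm mid}=\sup_{(\varphi_n)\in B_{\ell_p^w(E')}}\Big(\sum_{n}\sum_{j}|\varphi_n(x_j)|^p\Big)^{1/p}<\infty ,$$ and let $(\ell_p^{\rm mid})^u(E)$ be the subspace of those $(x_j)\in\ell_p^{\rm mid}(E)$ with $\lim_n\|(x_n,x_{n+1},\dots)\|_{p,\rm mid}=0$, with the same norm. On $E\otimes\ell_p$ consider the norm $$\alpha'_{\ell_p}\Big(\sum_{j=1}^k x_j\otimes y_j\Big)=\sup\Big\{\Big|\sum_{j=1}^k\sum_{n=1}^\infty\varphi_n(x_j)\psi_n(y_j)\Big| : (\varphi_n)\in B_{\ell_p^w(E')},\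 (\psi_n)\in B_{\ell_{p^*}(\ell_p')}\Big\},$$ and let $E\widehat\otimes_{\alpha'_{\ell_p}}\ell_p$ be the completion. A bilinear form $B:E\times\ell_p\to\mathbb K$ is called $\ell_p$-integral if its linearization $B_L$ is $\alpha'_{\ell_p}$-continuous; $\mathcal B_{I,\ell_p}(E,\ell_p)$ is the space of these forms, with the norm $\|B\|_{\mathcal B_{I,\ell_p}}=\|B_L\|$. Then: 1. There is an isometric isomorphism $\Theta:\big((\ell_p^{\rm mid})^u(E)\big)'\to\big(E\widehat\otimes_{\alpha'_{\ell_p}}\ell_p\big)'$ with $\Theta(f)(x\otimes a)=f\big((a_kx)_k\big)$ for all $x\in E$ and $a=(a_k)\in\ell_p$ (in particular $(a_kx)_k\in(\ell_p^{\rm mid})^u(E)$). 2. There is an isometric isomorphism $\Psi:\big(E\widehat\otimes_{\alpha'_{\ell_p}}\ell_p\big)'\to\mathcal B_{I,\ell_p}(E,\ell_p)$ with $\Psi(g)(x,a)=g(x\otimes a)$ for all $x\in E$ and $a\in\ell_p$. 3. For every $B\in\mathcal B_{I,\ell_p}(E,\ell_p)$, the norm $\|B\|_{\mathcal B_{I,\ell_p}}$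 is the infimum of the total variations $\|\mu\|$ over all regular $\mathbb K$-valued Borel measures $\mu$ on $K=B_{X'}\times B_{Y'}$ such that $$B(x,a)=\int_K\sum_{n=1}^\infty\varphi(x\cdot e_n)\,\psi(a\cdot e_n)\,d\mu(\varphi,\psi)\qquad(x\in E,\ a\in\ell_p),$$ and such measures exist. Here $X=\ell_{p^*}\langle E\rangle$ is the space of sequences in $E$ with norm $\sup_{(\varphi_j)\in B_{\ell_p^w(E')}}\sum_j|\varphi_j(x_j)|<\infty$, $Y=\ell_p(\ell_p)$, the two dual balls carry their weak$^*$ topologies, and $z\cdot e_n$ is the sequence with $z$ in place $n$ and $0$ elsewhere. -/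

import Mathlib

open scoped ENNReal TensorProduct Topology
open Filter MeasureTheory

/-! ### Extended norms

The norms below are suprema of possibly divergent series, so they are first defined with values in
`[0, ∞]`; the corresponding space consists of the vectors of finite norm. -/

/-- `N` satisfies the axioms of a norm, except that it may take the value `∞`. -/
structure IsExtNorm (𝕜 : Type*) [RCLike 𝕜] {V : Type*} [AddCommGroup V] [Module 𝕜 V]
    (N : V → ℝ≥0∞) : Prop where
  add_le : ∀ x y, N (x + y) ≤ N x + N y
  smul_eq : ∀ (c : 𝕜) x, N (c • x) = ‖c‖ₑ * N x
  eq_zero : ∀ x, N x = 0 → x = 0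

protected theorem IsExtNorm.map_zero {𝕜 : Type*} [RCLike 𝕜] {V : Type*} [AddCommGroup V] [Module 𝕜 V]
    {N : V → ℝ≥0∞} (h : IsExtNorm 𝕜 N) : N 0 = 0 := by
  have h0 := h.smul_eq 0 0
  rwa [zero_smul, enorm_zero, zero_mul] at h0

/-- An extended norm that is finite on (the image of) `W` restricts to a norm on `W`. -/
theorem IsExtNorm.core {𝕜 : Type*} [RCLike 𝕜] {V : Type*} [AddCommGroup V] [Module 𝕜 V]
    {N : V → ℝ≥0∞} (h : IsExtNorm 𝕜 N) {W : Type*} [AddCommGroup W] [Module 𝕜 W] [Norm W]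
    (i : W →ₗ[𝕜] V) (hi : Function.Injective i) (hfin : ∀ w, N (i w) < ∞)
    (hn : ∀ w, ‖w‖ = (N (i w)).toReal) : NormedSpace.Core 𝕜 W where
  norm_nonneg w := by rw [hn]; exact ENNReal.toReal_nonneg
  norm_smul c w := by
    rw [hn, hn, map_smul, h.smul_eq, ENNReal.toReal_mul, toReal_enorm]
  norm_triangle x y := by
    rw [hn, hn, hn, map_add, ← ENNReal.toReal_add (hfin x).ne (hfin y).ne]
    exact ENNReal.toReal_mono (ENNReal.add_lt_top.2 ⟨hfin x, hfin y⟩).ne (h.add_le _ _)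
  norm_eq_zero_iff w := by
    rw [hn]
    constructor
    · intro h0
      have h1 : N (i w) = 0 := by
        rcases (ENNReal.toReal_eq_zero_iff _).1 h0 with h1 | h1
        · exact h1
        · exact absurd h1 (hfin w).ne
      exact hi ((h.eq_zero _ h1).trans (map_zero i).symm)
    · rintro rfl
      simp [h.map_zero]

/-- Minkowski's inequality for series with terms in `[0, ∞]`. -/
theorem ENNReal_Lp_add_le_tsum {ι : Type*} (f g : ι → ℝ≥0∞) {r : ℝ} (hr : 1 ≤ r) :
    (∑' i, (f i + g i) ^ r) ^ (1 / r) ≤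
      (∑' i, f i ^ r) ^ (1 / r) + (∑' i, g i ^ r) ^ (1 / r) := by
  let : MeasurableSpace ι := ⊤
  have := ENNReal.lintegral_Lp_add_le (μ := Measure.count) (f := f) (g := g)
    measurable_from_top.aemeasurable measurable_from_top.aemeasurable hr
  simpa [lintegral_count] using this

theorem one_le_toReal_of_fact (p : ℝ≥0∞) [hp : Fact (1 ≤ p)] (h : p ≠ ∞) : 1 ≤ p.toReal := by
  rw [← ENNReal.toReal_one]
  exact ENNReal.toReal_mono h hp.out

/-! ### Weakly `p`-summable, mid `p`-summable and Cohen strongly `p`-summable sequences -/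

section sequences

variable (𝕜 : Type*) [RCLike 𝕜] (p : ℝ≥0∞)

/-- `‖x‖_{w,p} = sup_{f ∈ B_{G'}} (∑ₙ |f(xₙ)|^p)^{1/p}`, with values in `[0, ∞]`. A sequence belongs
to `ℓ_p^w(G)` when this is finite, and to the closed unit ball of `ℓ_p^w(G)` when this is `≤ 1`. -/
noncomputable def weakENorm {G : Type*} [NormedAddCommGroup G] [NormedSpace 𝕜 G] (x : ℕ → G) :
    ℝ≥0∞ :=
  ⨆ (f : StrongDual 𝕜 G) (_ : ‖f‖ ≤ 1), (∑' n, ‖f (x n)‖ₑ ^ p.toReal) ^ (1 / p.toReal)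

variable {E : Type*} [NormedAddCommGroup E] [NormedSpace 𝕜 E]

/-- `‖x‖_{p,mid} = sup (∑ₙ ∑ⱼ |φₙ(xⱼ)|^p)^{1/p}`, the supremum being taken over the closed unit ball
of `ℓ_p^w(E')`. A sequence belongs to `ℓ_p^mid(E)` when this is finite. -/
noncomputable def midENorm (x : ℕ → E) : ℝ≥0∞ :=
  ⨆ (φ : ℕ → StrongDual 𝕜 E) (_ : weakENorm 𝕜 p φ ≤ 1),
    (∑' n, ∑' j, ‖φ n (x j)‖ₑ ^ p.toReal) ^ (1 / p.toReal)

/-- The norm `sup ∑ⱼ |φⱼ(xⱼ)|`, the supremum being taken over the closed unit ball of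
`ℓ_s^w(E')`. A sequence belongs to Cohen's space `ℓ_r⟨E⟩`, where `1/r + 1/s = 1`, when this is
finite. -/
noncomputable def cohenENorm (s : ℝ≥0∞) (x : ℕ → E) : ℝ≥0∞ :=
  ⨆ (φ : ℕ → StrongDual 𝕜 E) (_ : weakENorm 𝕜 s φ ≤ 1), ∑' j, ‖φ j (x j)‖ₑ

variable {𝕜 p}

theorem enorm_apply_le_of_norm_le_one {G : Type*} [NormedAddCommGroup G] [NormedSpace 𝕜 G]
    {f : StrongDual 𝕜 G} (hf : ‖f‖ ≤ 1) (x : G) : ‖f x‖ₑ ≤ ‖x‖ₑ := by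
  rw [← ofReal_norm, ← ofReal_norm]
  exact ENNReal.ofReal_le_ofReal ((f.le_opNorm x).trans
    (mul_le_of_le_one_left (norm_nonneg _) hf))

theorem tsum_rpow_single (hp : 0 < p.toReal) {G : Type*} [NormedAddCommGroup G]
    (n : ℕ) (y : G) :
    (∑' k, ‖(Pi.single n y : ℕ → G) k‖ₑ ^ p.toReal) ^ (1 / p.toReal) = ‖y‖ₑ := by
  rw [tsum_eq_single n]
  · rw [Pi.single_eq_same, ← ENNReal.rpow_mul, mul_one_div_cancel hp.ne', ENNReal.rpow_one]
  · intro k hk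
    rw [Pi.single_eq_of_ne hk, enorm_zero, ENNReal.zero_rpow_of_pos hp]

/-- A sequence with a single nonzero entry has weak norm at most the norm of that entry. -/
theorem weakENorm_single_le (hp : 0 < p.toReal) {G : Type*} [NormedAddCommGroup G]
    [NormedSpace 𝕜 G] (n : ℕ) (y : G) : weakENorm 𝕜 p (Pi.single n y) ≤ ‖y‖ₑ := by
  refine iSup₂_le fun f hf ↦ ?_
  have h : ∀ k, f ((Pi.single n y : ℕ → G) k) = (Pi.single n (f y) : ℕ → 𝕜) k := by
    intro k
    rcases eq_or_ne k n with rfl | hk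
    · simp
    · simp [Pi.single_eq_of_ne hk]
  simp_rw [h]
  rw [tsum_rpow_single hp]
  exact enorm_apply_le_of_norm_le_one hf y

/-- On the unit ball of `ℓ_p^w(E')`, the `ℓ_p` norm of `(φₙ(x))ₙ` is at most `‖x‖`. -/
theorem tsum_rpow_le_of_weakENorm_le_one (hp : 0 < p.toReal) {φ : ℕ → StrongDual 𝕜 E}
    (hφ : weakENorm 𝕜 p φ ≤ 1) (x : E) :
    (∑' n, ‖φ n x‖ₑ ^ p.toReal) ^ (1 / p.toReal) ≤ ‖x‖ₑ := by
  rcases eq_or_ne x 0 with rfl | hx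
  · simp [ENNReal.zero_rpow_of_pos hp, hp]
  have hx' : ‖x‖ ≠ 0 := norm_ne_zero_iff.2 hx
  set f : StrongDual 𝕜 (StrongDual 𝕜 E) :=
    ((‖x‖⁻¹ : ℝ) : 𝕜) • NormedSpace.inclusionInDoubleDual 𝕜 E x with hf
  have hf1 : ‖f‖ ≤ 1 := by
    refine (ContinuousLinearMap.opNorm_smul_le _ _).trans ?_
    rw [RCLike.norm_ofReal, abs_of_nonneg (inv_nonneg.2 (norm_nonneg _))]
    calc ‖x‖⁻¹ * ‖NormedSpace.inclusionInDoubleDual 𝕜 E x‖ ≤ ‖x‖⁻¹ * ‖x‖ := by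
          gcongr
          exact NormedSpace.double_dual_bound 𝕜 E x
      _ = 1 := inv_mul_cancel₀ hx'
  have h1 : (∑' n, ‖f (φ n)‖ₑ ^ p.toReal) ^ (1 / p.toReal) ≤ 1 :=
    (le_iSup₂ (f := fun (f : StrongDual 𝕜 (StrongDual 𝕜 E)) (_ : ‖f‖ ≤ 1) ↦
      (∑' n, ‖f (φ n)‖ₑ ^ p.toReal) ^ (1 / p.toReal)) f hf1).trans hφ
  have h2 : ∀ n, ‖φ n x‖ₑ ^ p.toReal = ‖x‖ₑ ^ p.toReal * ‖f (φ n)‖ₑ ^ p.toReal := by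
    intro n
    rw [← ENNReal.mul_rpow_of_nonneg _ _ hp.le]
    congr 1
    have : φ n x = ((‖x‖ : ℝ) : 𝕜) * f (φ n) := by
      have hx'' : ((‖x‖ : ℝ) : 𝕜) ≠ 0 := by exact_mod_cast hx'
      simp only [hf, _root_.smul_apply, NormedSpace.dual_def, smul_eq_mul,
        RCLike.ofReal_inv]
      field_simp
    rw [this, enorm_mul]
    congr 1
    rw [← ofReal_norm, ← ofReal_norm, RCLike.norm_ofReal, abs_norm]
  simp_rw [h2]
  rw [ENNReal.tsum_mul_left, ENNReal.mul_rpow_of_nonneg _ _ (by positivity), ← ENNReal.rpow_mul,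
    mul_one_div_cancel hp.ne', ENNReal.rpow_one]
  calc ‖x‖ₑ * (∑' n, ‖f (φ n)‖ₑ ^ p.toReal) ^ (1 / p.toReal) ≤ ‖x‖ₑ * 1 := by gcongr
    _ = ‖x‖ₑ := mul_one _

/-- On the unit ball of `ℓ_p^w(E')`, every entry has norm at most one (pointwise form). -/
theorem enorm_apply_le_of_weakENorm_le_one (hp : 0 < p.toReal) {φ : ℕ → StrongDual 𝕜 E}
    (hφ : weakENorm 𝕜 p φ ≤ 1) (n : ℕ) (x : E) : ‖φ n x‖ₑ ≤ ‖x‖ₑ := by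
  refine le_trans ?_ (tsum_rpow_le_of_weakENorm_le_one hp hφ x)
  calc ‖φ n x‖ₑ = (‖φ n x‖ₑ ^ p.toReal) ^ (1 / p.toReal) := by
        rw [← ENNReal.rpow_mul, mul_one_div_cancel hp.ne', ENNReal.rpow_one]
    _ ≤ _ := by
        gcongr
        exact ENNReal.le_tsum (f := fun n ↦ ‖φ n x‖ₑ ^ p.toReal) n

/-- Every vector is normed by a functional, placed as the `n`-th entry of a sequence in the unit
ball of `ℓ_p^w(E')`. -/
theorem exists_weakENorm_single_le_one (hp : 0 < p.toReal) (n : ℕ) (y : E) :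
    ∃ f : StrongDual 𝕜 E, weakENorm 𝕜 p (Pi.single n f) ≤ 1 ∧ ‖f y‖ₑ = ‖y‖ₑ := by
  obtain ⟨f, hf, hfy⟩ := exists_dual_vector'' 𝕜 y
  refine ⟨f, (weakENorm_single_le hp n f).trans ?_, ?_⟩
  · rw [← ofReal_norm]
    exact ENNReal.ofReal_le_one.2 hf
  · rw [hfy, ← ofReal_norm, ← ofReal_norm, RCLike.norm_ofReal, abs_norm]

theorem isExtNorm_midENorm (hp : 1 ≤ p.toReal) :
    IsExtNorm 𝕜 (midENorm 𝕜 p : (ℕ → E) → ℝ≥0∞) where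
  add_le x y := by
    refine iSup₂_le fun φ hφ ↦ ?_
    refine le_trans ?_ (add_le_add
      (le_iSup₂ (f := fun (φ : ℕ → StrongDual 𝕜 E) (_ : weakENorm 𝕜 p φ ≤ 1) ↦
        (∑' n, ∑' j, ‖φ n (x j)‖ₑ ^ p.toReal) ^ (1 / p.toReal)) φ hφ)
      (le_iSup₂ (f := fun (φ : ℕ → StrongDual 𝕜 E) (_ : weakENorm 𝕜 p φ ≤ 1) ↦
        (∑' n, ∑' j, ‖φ n (y j)‖ₑ ^ p.toReal) ^ (1 / p.toReal)) φ hφ))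
    simp_rw [← ENNReal.tsum_prod (f := fun n j ↦ ‖φ n (x j)‖ₑ ^ p.toReal),
      ← ENNReal.tsum_prod (f := fun n j ↦ ‖φ n (y j)‖ₑ ^ p.toReal),
      ← ENNReal.tsum_prod (f := fun n j ↦ ‖φ n ((x + y) j)‖ₑ ^ p.toReal)]
    refine le_trans ?_ (ENNReal_Lp_add_le_tsum (fun i : ℕ × ℕ ↦ ‖φ i.1 (x i.2)‖ₑ)
      (fun i : ℕ × ℕ ↦ ‖φ i.1 (y i.2)‖ₑ) hp)
    gcongr with i
    rw [Pi.add_apply, map_add]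
    exact enorm_add_le _ _
  smul_eq c x := by
    have hp0 : 0 < p.toReal := by linarith
    simp only [midENorm, ENNReal.mul_iSup]
    refine iSup_congr fun φ ↦ iSup_congr fun _ ↦ ?_
    have h : ∀ n j, ‖φ n ((c • x) j)‖ₑ ^ p.toReal =
        ‖c‖ₑ ^ p.toReal * ‖φ n (x j)‖ₑ ^ p.toReal := by
      intro n j
      rw [Pi.smul_apply, map_smul, smul_eq_mul, enorm_mul,
        ENNReal.mul_rpow_of_nonneg _ _ hp0.le]
    simp_rw [h, ENNReal.tsum_mul_left]
    rw [ENNReal.mul_rpow_of_nonneg _ _ (by positivity), ← ENNReal.rpow_mul,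
      mul_one_div_cancel hp0.ne', ENNReal.rpow_one]
  eq_zero x hx := by
    have hp0 : 0 < p.toReal := by linarith
    ext j
    obtain ⟨f, hf, hfx⟩ := exists_weakENorm_single_le_one (𝕜 := 𝕜) hp0 0 (x j)
    have h := (le_iSup₂ (f := fun (φ : ℕ → StrongDual 𝕜 E) (_ : weakENorm 𝕜 p φ ≤ 1) ↦
        (∑' n, ∑' j, ‖φ n (x j)‖ₑ ^ p.toReal) ^ (1 / p.toReal)) _ hf).trans hx.le
    have h0 := (ENNReal.rpow_eq_zero_iff_of_pos (by positivity)).1 (le_antisymm h bot_le)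
    rw [ENNReal.tsum_eq_zero] at h0
    have h1 := h0 0
    rw [ENNReal.tsum_eq_zero] at h1
    have h2 := (ENNReal.rpow_eq_zero_iff_of_pos hp0).1 (h1 j)
    rw [Pi.single_eq_same, hfx] at h2
    simpa using h2

theorem isExtNorm_cohenENorm (hp : 0 < p.toReal) :
    IsExtNorm 𝕜 (cohenENorm 𝕜 p : (ℕ → E) → ℝ≥0∞) where
  add_le x y := by
    refine iSup₂_le fun φ hφ ↦ ?_
    refine le_trans ?_ (add_le_add
      (le_iSup₂ (f := fun (φ : ℕ → StrongDual 𝕜 E) (_ : weakENorm 𝕜 p φ ≤ 1) ↦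
        ∑' j, ‖φ j (x j)‖ₑ) φ hφ)
      (le_iSup₂ (f := fun (φ : ℕ → StrongDual 𝕜 E) (_ : weakENorm 𝕜 p φ ≤ 1) ↦
        ∑' j, ‖φ j (y j)‖ₑ) φ hφ))
    rw [← ENNReal.tsum_add]
    gcongr with j
    rw [Pi.add_apply, map_add]
    exact enorm_add_le _ _
  smul_eq c x := by
    simp only [cohenENorm, ENNReal.mul_iSup]
    refine iSup_congr fun φ ↦ iSup_congr fun _ ↦ ?_
    have h : ∀ j, ‖φ j ((c • x) j)‖ₑ = ‖c‖ₑ * ‖φ j (x j)‖ₑ := by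
      intro j
      rw [Pi.smul_apply, map_smul, smul_eq_mul, enorm_mul]
    simp_rw [h, ENNReal.tsum_mul_left]
  eq_zero x hx := by
    ext j
    obtain ⟨f, hf, hfx⟩ := exists_weakENorm_single_le_one (𝕜 := 𝕜) hp j (x j)
    have h := (le_iSup₂ (f := fun (φ : ℕ → StrongDual 𝕜 E) (_ : weakENorm 𝕜 p φ ≤ 1) ↦
        ∑' j, ‖φ j (x j)‖ₑ) _ hf).trans hx.le
    have h0 := le_antisymm h bot_le
    have h1 := ENNReal.tsum_eq_zero.1 h0 j
    rw [Pi.single_eq_same, hfx] at h1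
    simpa using h1

/-- `‖x · eₙ‖_{ℓ_r⟨E⟩} ≤ ‖x‖`. -/
theorem cohenENorm_single_le (hp : 0 < p.toReal) (n : ℕ) (x : E) :
    cohenENorm 𝕜 p (Pi.single n x) ≤ ‖x‖ₑ := by
  refine iSup₂_le fun φ hφ ↦ ?_
  rw [tsum_eq_single n]
  · rw [Pi.single_eq_same]
    exact enorm_apply_le_of_weakENorm_le_one hp hφ n x
  · intro k hk
    rw [Pi.single_eq_of_ne hk, map_zero, enorm_zero]

end sequences

/-! ### Standing assumption on the exponents: `1 < p, q < ∞` and `1/p + 1/q = 1` -/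

instance fact_one_le_of_fact_one_lt (p : ℝ≥0∞) [h : Fact (1 < p)] : Fact (1 ≤ p) := ⟨h.out.le⟩

theorem ne_top_of_conj (p q : ℝ≥0∞) [h : Fact (1 < q)] [p.HolderConjugate q] : p ≠ ∞ :=
  ((ENNReal.HolderConjugate.lt_top_iff_one_lt p q).2 h.out).ne

theorem one_le_toReal_of_conj (p q : ℝ≥0∞) [Fact (1 < p)] [Fact (1 < q)] [p.HolderConjugate q] :
    1 ≤ p.toReal :=
  one_le_toReal_of_fact p (ne_top_of_conj p q)

theorem toReal_pos_of_conj (p q : ℝ≥0∞) [Fact (1 < p)] [Fact (1 < q)] [p.HolderConjugate q] :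
    0 < p.toReal :=
  one_pos.trans_le (one_le_toReal_of_conj p q)

theorem toReal_conj (p q : ℝ≥0∞) [Fact (1 < p)] [Fact (1 < q)] [p.HolderConjugate q] :
    p.toReal.HolderConjugate q.toReal :=
  ENNReal.HolderConjugate.toReal_of_ne_top (ne_top_of_conj p q) (ne_top_of_conj q p)

/-! ### The space `(ℓ_p^mid)^u(E)` -/

section midU

variable (𝕜 : Type*) [RCLike 𝕜] (p : ℝ≥0∞) [hp1 : Fact (1 ≤ p)] [hp2 : Fact (p < ∞)]
  (E : Type*) [NormedAddCommGroup E] [NormedSpace 𝕜 E]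

/-- The sequences in `ℓ_p^mid(E)` whose tails `(xₙ, xₙ₊₁, …)` tend to zero in the norm of
`ℓ_p^mid(E)`. -/
def midUSubmodule : Submodule 𝕜 (ℕ → E) where
  carrier := {x | midENorm 𝕜 p x < ∞ ∧
    Tendsto (fun n ↦ midENorm 𝕜 p (fun j ↦ x (n + j))) atTop (𝓝 0)}
  zero_mem' := by
    have h := (isExtNorm_midENorm (𝕜 := 𝕜) (E := E)
      (one_le_toReal_of_fact p hp2.out.ne)).map_zero
    refine ⟨by rw [h]; exact ENNReal.zero_lt_top, ?_⟩
    have h' : ∀ n : ℕ, midENorm 𝕜 p (fun j ↦ (0 : ℕ → E) (n + j)) = 0 := fun n ↦ h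
    simp_rw [h']
    exact tendsto_const_nhds
  add_mem' := by
    intro x y hx hy
    have h := isExtNorm_midENorm (𝕜 := 𝕜) (E := E) (one_le_toReal_of_fact p hp2.out.ne)
    refine ⟨(h.add_le x y).trans_lt (ENNReal.add_lt_top.2 ⟨hx.1, hy.1⟩), ?_⟩
    have h0 := hx.2.add hy.2
    rw [add_zero] at h0
    exact tendsto_of_tendsto_of_tendsto_of_le_of_le tendsto_const_nhds h0 (fun _ ↦ bot_le)
      (fun n ↦ h.add_le (fun j ↦ x (n + j)) (fun j ↦ y (n + j)))
  smul_mem' := by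
    intro c x hx
    have h := isExtNorm_midENorm (𝕜 := 𝕜) (E := E) (one_le_toReal_of_fact p hp2.out.ne)
    refine ⟨?_, ?_⟩
    · rw [h.smul_eq]
      exact ENNReal.mul_lt_top enorm_lt_top hx.1
    · have h' : ∀ n : ℕ, midENorm 𝕜 p (fun j ↦ (c • x) (n + j)) =
          ‖c‖ₑ * midENorm 𝕜 p (fun j ↦ x (n + j)) :=
        fun n ↦ h.smul_eq c (fun j ↦ x (n + j))
      simp_rw [h']
      have h0 := ENNReal.Tendsto.const_mul hx.2 (Or.inr (enorm_ne_top (x := c)))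
      rwa [mul_zero] at h0

/-- The normed space `(ℓ_p^mid)^u(E)`, with the norm of `ℓ_p^mid(E)`. -/
def MidU : Type _ := ↥(midUSubmodule 𝕜 p E)

namespace MidU

noncomputable instance : AddCommGroup (MidU 𝕜 p E) :=
  inferInstanceAs (AddCommGroup ↥(midUSubmodule 𝕜 p E))

noncomputable instance : Module 𝕜 (MidU 𝕜 p E) :=
  inferInstanceAs (Module 𝕜 ↥(midUSubmodule 𝕜 p E))

/-- The underlying sequence. -/
def seq : MidU 𝕜 p E →ₗ[𝕜] (ℕ → E) := (midUSubmodule 𝕜 p E).subtype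

noncomputable instance : Norm (MidU 𝕜 p E) := ⟨fun x ↦ (midENorm 𝕜 p (seq 𝕜 p E x)).toReal⟩

theorem core : NormedSpace.Core 𝕜 (MidU 𝕜 p E) :=
  (isExtNorm_midENorm (one_le_toReal_of_fact p hp2.out.ne)).core (seq 𝕜 p E)
    (midUSubmodule 𝕜 p E).injective_subtype (fun x ↦ x.2.1) (fun _ ↦ rfl)

noncomputable instance : NormedAddCommGroup (MidU 𝕜 p E) := .ofCore (core 𝕜 p E)

noncomputable instance : NormedSpace 𝕜 (MidU 𝕜 p E) := .ofCore (core 𝕜 p E)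

end MidU

end midU

/-! ### Cohen's space `ℓ_r⟨E⟩` -/

section cohen

variable (𝕜 : Type*) [RCLike 𝕜] (r s : ℝ≥0∞) [Fact (1 < r)] [Fact (1 < s)] [s.HolderConjugate r]
  (E : Type*) [NormedAddCommGroup E] [NormedSpace 𝕜 E]

/-- The Cohen strongly `r`-summable sequences; `s` is the conjugate exponent of `r`. -/
def cohenSubmodule : Submodule 𝕜 (ℕ → E) where
  carrier := {x | cohenENorm 𝕜 s x < ∞}
  zero_mem' := by
    have h := (isExtNorm_cohenENorm (𝕜 := 𝕜) (E := E) (toReal_pos_of_conj s r)).map_zero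
    change cohenENorm 𝕜 s (0 : ℕ → E) < ∞
    rw [h]
    exact ENNReal.zero_lt_top
  add_mem' := by
    intro x y hx hy
    have h := isExtNorm_cohenENorm (𝕜 := 𝕜) (E := E) (toReal_pos_of_conj s r)
    exact (h.add_le x y).trans_lt (ENNReal.add_lt_top.2 ⟨hx, hy⟩)
  smul_mem' := by
    intro c x hx
    have h := isExtNorm_cohenENorm (𝕜 := 𝕜) (E := E) (toReal_pos_of_conj s r)
    change cohenENorm 𝕜 s (c • x) < ∞
    rw [h.smul_eq]
    exact ENNReal.mul_lt_top enorm_lt_top hx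

/-- The normed space `ℓ_r⟨E⟩` of Cohen strongly `r`-summable sequences, where
`1/r + 1/s = 1`. -/
def CohenSeq : Type _ := ↥(cohenSubmodule 𝕜 r s E)

namespace CohenSeq

noncomputable instance : AddCommGroup (CohenSeq 𝕜 r s E) :=
  inferInstanceAs (AddCommGroup ↥(cohenSubmodule 𝕜 r s E))

noncomputable instance : Module 𝕜 (CohenSeq 𝕜 r s E) :=
  inferInstanceAs (Module 𝕜 ↥(cohenSubmodule 𝕜 r s E))

/-- The underlying sequence. -/
def seq : CohenSeq 𝕜 r s E →ₗ[𝕜] (ℕ → E) := (cohenSubmodule 𝕜 r s E).subtype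

noncomputable instance : Norm (CohenSeq 𝕜 r s E) :=
  ⟨fun x ↦ (cohenENorm 𝕜 s (seq 𝕜 r s E x)).toReal⟩

theorem core : NormedSpace.Core 𝕜 (CohenSeq 𝕜 r s E) :=
  (isExtNorm_cohenENorm (toReal_pos_of_conj s r)).core (seq 𝕜 r s E)
    (cohenSubmodule 𝕜 r s E).injective_subtype (fun x ↦ x.2) (fun _ ↦ rfl)

noncomputable instance : NormedAddCommGroup (CohenSeq 𝕜 r s E) := .ofCore (core 𝕜 r s E)

noncomputable instance : NormedSpace 𝕜 (CohenSeq 𝕜 r s E) := .ofCore (core 𝕜 r s E)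

/-- The sequence `x · eₙ = (0, …, 0, x, 0, …)`, with `x` in place `n`. -/
def single {E : Type*} [NormedAddCommGroup E] [NormedSpace 𝕜 E] (n : ℕ) (x : E) :
    CohenSeq 𝕜 r s E :=
  ⟨Pi.single n x, (cohenENorm_single_le (toReal_pos_of_conj s r) n x).trans_lt enorm_lt_top⟩

end CohenSeq

end cohen

/-! ### The norm `α` on `E ⊗ F` for `λ = ℓ_p`, `X' = ℓ_p^w` and `Y' = ℓ_q(·)`

Here `1/p + 1/q = 1`. The class `ℓ_p^w` is dual to `X = ℓ_q⟨·⟩` and `ℓ_q(·)` is dual to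
`Y = ℓ_p(·)`. -/

section alpha

variable (𝕜 : Type*) [RCLike 𝕜] (p q : ℝ≥0∞)
  (E F : Type*) [NormedAddCommGroup E] [NormedSpace 𝕜 E] [NormedAddCommGroup F] [NormedSpace 𝕜 F]

variable {𝕜 E F} in
/-- The value `∑ₙ (φₙ ⊗ ψₙ)(u)`, which is `∑ⱼ ∑ₙ φₙ(xⱼ) ψₙ(yⱼ)` for `u = ∑ⱼ xⱼ ⊗ yⱼ`
(see `alphaPairing_sum_tmul`). -/
noncomputable def alphaPairing (φ : ℕ → StrongDual 𝕜 E) (ψ : ℕ → StrongDual 𝕜 F)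
    (u : E ⊗[𝕜] F) : 𝕜 :=
  ∑' n, LinearMap.mul' 𝕜 𝕜
    (TensorProduct.map (φ n : E →ₗ[𝕜] 𝕜) (ψ n : F →ₗ[𝕜] 𝕜) u)

variable {E F} in
/-- The norm `α(u) = sup |∑ⱼ ∑ₙ φₙ(xⱼ) ψₙ(yⱼ)|` for `u = ∑ⱼ xⱼ ⊗ yⱼ`, the supremum being taken over
`(φₙ)` in the closed unit ball of `ℓ_p^w(E')` and `(ψₙ)` in the closed unit ball of `ℓ_q(F')`. -/
noncomputable def alphaENorm [Fact (1 ≤ q)] (u : E ⊗[𝕜] F) : ℝ≥0∞ :=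
  ⨆ (φ : ℕ → StrongDual 𝕜 E) (_ : weakENorm 𝕜 p φ ≤ 1)
    (ψ : lp (fun _ : ℕ ↦ StrongDual 𝕜 F) q) (_ : ‖ψ‖ ≤ 1), ‖alphaPairing φ ψ u‖ₑ

variable {𝕜 p q E F}

/-- Hölder's inequality for the series defining `α`. -/
theorem summable_and_tsum_le [Fact (1 < p)] [Fact (1 < q)] [p.HolderConjugate q]
    {φ : ℕ → StrongDual 𝕜 E} (hφ : weakENorm 𝕜 p φ ≤ 1)
    (ψ : lp (fun _ : ℕ ↦ StrongDual 𝕜 F) q) (x : E) (y : F) :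
    (Summable fun n ↦ ‖φ n x‖ * ‖ψ n y‖) ∧
      ∑' n, ‖φ n x‖ * ‖ψ n y‖ ≤ ‖x‖ * (‖ψ‖ * ‖y‖) := by
  have hp := toReal_pos_of_conj p q
  have hq := toReal_pos_of_conj q p
  have h1 := tsum_rpow_le_of_weakENorm_le_one hp hφ x
  have h1' : (∑' n, ‖φ n x‖ₑ ^ p.toReal) ≤ ‖x‖ₑ ^ p.toReal := by
    have := ENNReal.rpow_le_rpow h1 hp.le
    rwa [← ENNReal.rpow_mul, one_div_mul_cancel hp.ne', ENNReal.rpow_one] at this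
  have h2 : ∀ s : Finset ℕ, ∑ n ∈ s, ‖φ n x‖ ^ p.toReal ≤ ‖x‖ ^ p.toReal := by
    intro s
    have h3 := (ENNReal.sum_le_tsum s).trans h1'
    have h4 : ∀ z : ℝ, 0 ≤ z → ENNReal.ofReal (z ^ p.toReal) = ENNReal.ofReal z ^ p.toReal :=
      fun z hz ↦ (ENNReal.ofReal_rpow_of_nonneg hz hp.le).symm
    simp_rw [← ofReal_norm, ← h4 _ (norm_nonneg _)] at h3
    rw [← ENNReal.ofReal_sum_of_nonneg (fun i _ ↦ by positivity)] at h3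
    exact (ENNReal.ofReal_le_ofReal_iff (by positivity)).1 h3
  let a : lp (fun _ : ℕ ↦ 𝕜) p := ⟨fun n ↦ φ n x, memℓp_gen' h2⟩
  have ha : ‖a‖ ≤ ‖x‖ := lp.norm_le_of_forall_sum_le hp (norm_nonneg _) h2
  have h5 : ∀ s : Finset ℕ, ∑ n ∈ s, ‖ψ n y‖ ^ q.toReal ≤ (‖ψ‖ * ‖y‖) ^ q.toReal := by
    intro s
    calc ∑ n ∈ s, ‖ψ n y‖ ^ q.toReal
        ≤ ∑ n ∈ s, ‖ψ n‖ ^ q.toReal * ‖y‖ ^ q.toReal := by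
          gcongr with n
          rw [← Real.mul_rpow (norm_nonneg _) (norm_nonneg _)]
          gcongr
          exact (ψ n).le_opNorm y
      _ = (∑ n ∈ s, ‖ψ n‖ ^ q.toReal) * ‖y‖ ^ q.toReal := by rw [Finset.sum_mul]
      _ ≤ ‖ψ‖ ^ q.toReal * ‖y‖ ^ q.toReal := by
          gcongr
          exact lp.sum_rpow_le_norm_rpow hq ψ s
      _ = (‖ψ‖ * ‖y‖) ^ q.toReal := by
          rw [← Real.mul_rpow (norm_nonneg _) (norm_nonneg _)]
  let b : lp (fun _ : ℕ ↦ 𝕜) q := ⟨fun n ↦ ψ n y, memℓp_gen' h5⟩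
  have hb : ‖b‖ ≤ ‖ψ‖ * ‖y‖ := lp.norm_le_of_forall_sum_le hq (by positivity) h5
  have h6 := lp.tsum_mul_le_mul_norm (toReal_conj p q) a b
  exact ⟨h6.1, h6.2.trans (mul_le_mul ha hb (norm_nonneg _) (norm_nonneg _))⟩

theorem summable_alphaPairing [Fact (1 < p)] [Fact (1 < q)] [p.HolderConjugate q]
    {φ : ℕ → StrongDual 𝕜 E} (hφ : weakENorm 𝕜 p φ ≤ 1)
    (ψ : lp (fun _ : ℕ ↦ StrongDual 𝕜 F) q) (u : E ⊗[𝕜] F) :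
    Summable fun n ↦ LinearMap.mul' 𝕜 𝕜
      (TensorProduct.map (φ n : E →ₗ[𝕜] 𝕜) (ψ n : F →ₗ[𝕜] 𝕜) u) := by
  induction u with
  | zero => simp
  | tmul x y =>
    refine Summable.of_norm ?_
    simpa using (summable_and_tsum_le hφ ψ x y).1
  | add u v hu hv => simpa using hu.add hv

/-- For `u = ∑ⱼ xⱼ ⊗ yⱼ` the pairing is `∑ⱼ ∑ₙ φₙ(xⱼ) ψₙ(yⱼ)`. -/
theorem alphaPairing_sum_tmul [Fact (1 < p)] [Fact (1 < q)] [p.HolderConjugate q]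
    {φ : ℕ → StrongDual 𝕜 E} (hφ : weakENorm 𝕜 p φ ≤ 1)
    (ψ : lp (fun _ : ℕ ↦ StrongDual 𝕜 F) q) {k : ℕ} (x : Fin k → E) (y : Fin k → F) :
    alphaPairing φ ψ (∑ j, x j ⊗ₜ[𝕜] y j) = ∑ j, ∑' n, φ n (x j) * ψ n (y j) := by
  unfold alphaPairing
  simp_rw [map_sum]
  rw [Summable.tsum_finsetSum (fun j _ ↦ summable_alphaPairing hφ ψ _)]
  simp

theorem alphaENorm_lt_top [Fact (1 < p)] [Fact (1 < q)] [p.HolderConjugate q] (u : E ⊗[𝕜] F) :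
    alphaENorm 𝕜 p q u < ∞ := by
  have key : ∃ C : ℝ, ∀ (φ : ℕ → StrongDual 𝕜 E) (_ : weakENorm 𝕜 p φ ≤ 1)
      (ψ : lp (fun _ : ℕ ↦ StrongDual 𝕜 F) q) (_ : ‖ψ‖ ≤ 1), ‖alphaPairing φ ψ u‖ ≤ C := by
    induction u with
    | zero => exact ⟨0, fun φ _ ψ _ ↦ by simp [alphaPairing]⟩
    | tmul x y =>
      refine ⟨‖x‖ * (1 * ‖y‖), fun φ hφ ψ hψ ↦ ?_⟩
      obtain ⟨h1, h2⟩ := summable_and_tsum_le hφ ψ x y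
      have h3 : ‖alphaPairing φ ψ (x ⊗ₜ[𝕜] y)‖ ≤ ∑' n, ‖φ n x‖ * ‖ψ n y‖ := by
        have := norm_tsum_le_tsum_norm (f := fun n ↦ φ n x * ψ n y) (by simpa using h1)
        simpa [alphaPairing] using this
      refine h3.trans (h2.trans ?_)
      gcongr
    | add u v hu hv =>
      obtain ⟨C, hC⟩ := hu
      obtain ⟨D, hD⟩ := hv
      refine ⟨C + D, fun φ hφ ψ hψ ↦ ?_⟩
      have : alphaPairing φ ψ (u + v) = alphaPairing φ ψ u + alphaPairing φ ψ v := by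
        unfold alphaPairing
        rw [← (summable_alphaPairing hφ ψ u).tsum_add (summable_alphaPairing hφ ψ v)]
        simp
      rw [this]
      exact (norm_add_le _ _).trans (add_le_add (hC φ hφ ψ hψ) (hD φ hφ ψ hψ))
  obtain ⟨C, hC⟩ := key
  refine lt_of_le_of_lt (b := ENNReal.ofReal C) ?_ ENNReal.ofReal_lt_top
  refine iSup₂_le fun φ hφ ↦ iSup₂_le fun ψ hψ ↦ ?_
  rw [← ofReal_norm]
  exact ENNReal.ofReal_le_ofReal (hC φ hφ ψ hψ)

/-- A tensor on which all `f ⊗ g`, with `f` and `g` bounded functionals, vanish is zero. -/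
theorem tensor_eq_zero_of_forall_dual (u : E ⊗[𝕜] F)
    (h : ∀ (f : StrongDual 𝕜 E) (g : StrongDual 𝕜 F), LinearMap.mul' 𝕜 𝕜
      (TensorProduct.map (f : E →ₗ[𝕜] 𝕜) (g : F →ₗ[𝕜] 𝕜) u) = 0) : u = 0 := by
  classical
  let b := Module.Basis.ofVectorSpace 𝕜 F
  set c := TensorProduct.equivFinsuppOfBasisRight (M := E) b u with hc
  have hu : u = c.sum fun i m ↦ m ⊗ₜ[𝕜] b i := by
    rw [← TensorProduct.equivFinsuppOfBasisRight_symm_apply, hc, LinearEquiv.symm_apply_apply]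
  have hc0 : c = 0 := by
    ext i
    refine SeparatingDual.eq_zero_of_forall_dual_eq_zero (R := 𝕜) fun f ↦ ?_
    have h1 : (c.sum fun i m ↦ f m • b i) = 0 := by
      refine SeparatingDual.eq_zero_of_forall_dual_eq_zero (R := 𝕜) fun g ↦ ?_
      have h2 := h f g
      rw [hu] at h2
      simpa [Finsupp.sum, map_sum] using h2
    have h3 := (linearIndependent_iff'.1 b.linearIndependent) c.support (fun i ↦ f (c i)) h1
    by_cases hi : i ∈ c.support
    · exact h3 i hi
    · rw [Finsupp.notMem_support_iff.1 hi, map_zero]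
  rw [hu, hc0, Finsupp.sum_zero_index]

theorem isExtNorm_alphaENorm [Fact (1 < p)] [Fact (1 < q)] [p.HolderConjugate q] :
    IsExtNorm 𝕜 (alphaENorm 𝕜 p q : E ⊗[𝕜] F → ℝ≥0∞) where
  add_le u v := by
    refine iSup₂_le fun φ hφ ↦ iSup₂_le fun ψ hψ ↦ ?_
    have : alphaPairing φ ψ (u + v) = alphaPairing φ ψ u + alphaPairing φ ψ v := by
      unfold alphaPairing
      rw [← (summable_alphaPairing hφ ψ u).tsum_add (summable_alphaPairing hφ ψ v)]
      simp
    rw [this]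
    refine (enorm_add_le _ _).trans (add_le_add ?_ ?_)
    · exact le_iSup₂_of_le φ hφ (le_iSup₂_of_le ψ hψ le_rfl)
    · exact le_iSup₂_of_le φ hφ (le_iSup₂_of_le ψ hψ le_rfl)
  smul_eq c u := by
    simp only [alphaENorm, ENNReal.mul_iSup]
    refine iSup_congr fun φ ↦ iSup_congr fun _ ↦ iSup_congr fun ψ ↦ iSup_congr fun _ ↦ ?_
    have : alphaPairing φ ψ (c • u) = c * alphaPairing φ ψ u := by
      unfold alphaPairing
      rw [← tsum_mul_left]
      simp
    rw [this, enorm_mul]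
  eq_zero u hu := by
    have hp := toReal_pos_of_conj p q
    have hq := toReal_pos_of_conj q p
    have unit : ∀ (f : StrongDual 𝕜 E) (g : StrongDual 𝕜 F), ‖f‖ ≤ 1 → ‖g‖ ≤ 1 →
        LinearMap.mul' 𝕜 𝕜 (TensorProduct.map (f : E →ₗ[𝕜] 𝕜) (g : F →ₗ[𝕜] 𝕜) u) = 0 := by
      intro f g hf hg
      have hφ : weakENorm 𝕜 p (Pi.single 0 f) ≤ 1 := by
        refine (weakENorm_single_le hp 0 f).trans ?_
        rw [← ofReal_norm]
        exact ENNReal.ofReal_le_one.2 hf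
      have hψ : ‖lp.single (E := fun _ : ℕ ↦ StrongDual 𝕜 F) q 0 g‖ ≤ 1 := by
        rw [lp.norm_single (zero_lt_one.trans (Fact.out : 1 < q))]
        exact hg
      have h1 : ‖alphaPairing (Pi.single 0 f)
          (lp.single (E := fun _ : ℕ ↦ StrongDual 𝕜 F) q 0 g) u‖ₑ ≤ alphaENorm 𝕜 p q u :=
        le_iSup₂_of_le (f := fun (φ : ℕ → StrongDual 𝕜 E) (_ : weakENorm 𝕜 p φ ≤ 1) ↦
          ⨆ (ψ : lp (fun _ : ℕ ↦ StrongDual 𝕜 F) q) (_ : ‖ψ‖ ≤ 1), ‖alphaPairing φ ψ u‖ₑ)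
          (Pi.single 0 f) hφ (le_iSup₂_of_le
            (f := fun (ψ : lp (fun _ : ℕ ↦ StrongDual 𝕜 F) q) (_ : ‖ψ‖ ≤ 1) ↦
              ‖alphaPairing (Pi.single 0 f) ψ u‖ₑ)
            (lp.single (E := fun _ : ℕ ↦ StrongDual 𝕜 F) q 0 g) hψ le_rfl)
      rw [hu] at h1
      have h2 : alphaPairing (Pi.single 0 f)
          (lp.single (E := fun _ : ℕ ↦ StrongDual 𝕜 F) q 0 g) u = 0 := by
        simpa using h1
      unfold alphaPairing at h2
      rw [tsum_eq_single 0] at h2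
      · simpa using h2
      · intro n hn
        rw [Pi.single_eq_of_ne hn]
        simp
    refine tensor_eq_zero_of_forall_dual u fun f g ↦ ?_
    have hf : ‖(((‖f‖ + 1)⁻¹ : ℝ) : 𝕜) • f‖ ≤ 1 := by
      rw [norm_smul, RCLike.norm_ofReal, abs_of_nonneg (by positivity), inv_mul_le_iff₀
        (by positivity)]
      linarith
    have hg : ‖(((‖g‖ + 1)⁻¹ : ℝ) : 𝕜) • g‖ ≤ 1 := by
      rw [norm_smul, RCLike.norm_ofReal, abs_of_nonneg (by positivity), inv_mul_le_iff₀
        (by positivity)]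
      linarith
    have h3 := unit _ _ hf hg
    have hf0 : (((‖f‖ + 1)⁻¹ : ℝ) : 𝕜) ≠ 0 := by
      exact_mod_cast (by positivity : (‖f‖ + 1)⁻¹ ≠ 0)
    have hg0 : (((‖g‖ + 1)⁻¹ : ℝ) : 𝕜) ≠ 0 := by
      exact_mod_cast (by positivity : (‖g‖ + 1)⁻¹ ≠ 0)
    rw [ContinuousLinearMap.toLinearMap_smul, ContinuousLinearMap.toLinearMap_smul,
      TensorProduct.map_smul_left, TensorProduct.map_smul_right] at h3
    simpa only [LinearMap.smul_apply, map_smul, smul_eq_zero, hf0, hg0, false_or] using h3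

variable (𝕜 p q E F)

/-- The tensor product `E ⊗ F` endowed with the norm `α`. -/
def AlphaTensor (𝕜 : Type*) [RCLike 𝕜] (_p _q : ℝ≥0∞)
    (E F : Type*) [NormedAddCommGroup E] [NormedSpace 𝕜 E] [NormedAddCommGroup F]
    [NormedSpace 𝕜 F] : Type _ :=
  E ⊗[𝕜] F

namespace AlphaTensor

noncomputable instance : AddCommGroup (AlphaTensor 𝕜 p q E F) :=
  inferInstanceAs (AddCommGroup (E ⊗[𝕜] F))

noncomputable instance : Module 𝕜 (AlphaTensor 𝕜 p q E F) :=
  inferInstanceAs (Module 𝕜 (E ⊗[𝕜] F))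

/-- The identity, as a linear isomorphism onto the algebraic tensor product. -/
noncomputable def toTensor : AlphaTensor 𝕜 p q E F ≃ₗ[𝕜] E ⊗[𝕜] F := LinearEquiv.refl 𝕜 (E ⊗[𝕜] F)

variable {E F} in
/-- The elementary tensor `x ⊗ y`. -/
noncomputable def tmul (x : E) (y : F) : AlphaTensor 𝕜 p q E F := (toTensor 𝕜 p q E F).symm (x ⊗ₜ[𝕜] y)

noncomputable instance [Fact (1 ≤ q)] : Norm (AlphaTensor 𝕜 p q E F) :=
  ⟨fun u ↦ (alphaENorm 𝕜 p q (toTensor 𝕜 p q E F u)).toReal⟩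

variable [Fact (1 < p)] [Fact (1 < q)] [p.HolderConjugate q]

theorem core : NormedSpace.Core 𝕜 (AlphaTensor 𝕜 p q E F) :=
  isExtNorm_alphaENorm.core (toTensor 𝕜 p q E F).toLinearMap (toTensor 𝕜 p q E F).injective
    (fun _ ↦ alphaENorm_lt_top _) (fun _ ↦ rfl)

noncomputable instance : NormedAddCommGroup (AlphaTensor 𝕜 p q E F) := .ofCore (core 𝕜 p q E F)

noncomputable instance : NormedSpace 𝕜 (AlphaTensor 𝕜 p q E F) := .ofCore (core 𝕜 p q E F)

end AlphaTensor

/-- The completion `E ⊗̂_α F`. -/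
abbrev AlphaCompletion [Fact (1 < p)] [Fact (1 < q)] [p.HolderConjugate q] : Type _ :=
  UniformSpace.Completion (AlphaTensor 𝕜 p q E F)

variable {E F} in
/-- The elementary tensor `x ⊗ y` in `E ⊗̂_α F`. -/
noncomputable def AlphaCompletion.tmul [Fact (1 < p)] [Fact (1 < q)] [p.HolderConjugate q]
    (x : E) (y : F) : AlphaCompletion 𝕜 p q E F :=
  ((AlphaTensor.tmul 𝕜 p q x y : AlphaTensor 𝕜 p q E F) : AlphaCompletion 𝕜 p q E F)

end alpha

/-! ### `ℓ_p`-integral bilinear forms -/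

section integral

variable (𝕜 : Type*) [RCLike 𝕜] (p q : ℝ≥0∞)
  (E F : Type*) [NormedAddCommGroup E] [NormedSpace 𝕜 E] [NormedAddCommGroup F] [NormedSpace 𝕜 F]

variable {E F} in
/-- The linearization `B_L` of a bilinear form `B`, on `E ⊗_α F`. -/
noncomputable def linearization (B : E →ₗ[𝕜] F →ₗ[𝕜] 𝕜) : AlphaTensor 𝕜 p q E F →ₗ[𝕜] 𝕜 :=
  TensorProduct.lift B ∘ₗ (AlphaTensor.toTensor 𝕜 p q E F).toLinearMap

theorem linearization_add (B C : E →ₗ[𝕜] F →ₗ[𝕜] 𝕜) :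
    linearization 𝕜 p q (B + C) = linearization 𝕜 p q B + linearization 𝕜 p q C := by
  unfold linearization
  rw [← LinearMap.add_comp]
  congr 1
  exact (TensorProduct.lift.equiv (RingHom.id 𝕜) E F 𝕜).map_add B C

theorem linearization_smul (c : 𝕜) (B : E →ₗ[𝕜] F →ₗ[𝕜] 𝕜) :
    linearization 𝕜 p q (c • B) = c • linearization 𝕜 p q B := by
  unfold linearization
  rw [← LinearMap.smul_comp]
  congr 1
  exact (TensorProduct.lift.equiv (RingHom.id 𝕜) E F 𝕜).map_smul c B

variable [Fact (1 < p)] [Fact (1 < q)] [p.HolderConjugate q]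

/-- The `ℓ_p`-integral bilinear forms on `E × F`: those whose linearization is continuous for the
norm `α` (equivalently, extends to a bounded functional on the completion). -/
noncomputable def integralSubmodule : Submodule 𝕜 (E →ₗ[𝕜] F →ₗ[𝕜] 𝕜) where
  carrier := {B | Continuous (linearization 𝕜 p q B)}
  zero_mem' := by
    have h : linearization 𝕜 p q (0 : E →ₗ[𝕜] F →ₗ[𝕜] 𝕜) = 0 := by
      have := linearization_smul 𝕜 p q E F 0 0
      rwa [zero_smul, zero_smul] at this
    change Continuous (linearization 𝕜 p q (0 : E →ₗ[𝕜] F →ₗ[𝕜] 𝕜))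
    rw [h]
    exact continuous_zero
  add_mem' := by
    intro B C hB hC
    change Continuous (linearization 𝕜 p q (B + C))
    rw [linearization_add]
    exact Continuous.add hB hC
  smul_mem' := by
    intro c B hB
    change Continuous (linearization 𝕜 p q (c • B))
    rw [linearization_smul]
    exact Continuous.const_smul hB c

/-- The space of `ℓ_p`-integral bilinear forms on `E × F`. -/
def IntegralForm : Type _ := ↥(integralSubmodule 𝕜 p q E F)

namespace IntegralForm

noncomputable instance : AddCommGroup (IntegralForm 𝕜 p q E F) :=
  Module.addCommMonoidToAddCommGroup 𝕜 (M := ↥(integralSubmodule 𝕜 p q E F))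

noncomputable instance : Module 𝕜 (IntegralForm 𝕜 p q E F) :=
  inferInstanceAs (Module 𝕜 ↥(integralSubmodule 𝕜 p q E F))

/-- The underlying bilinear form. -/
noncomputable def form : IntegralForm 𝕜 p q E F →ₗ[𝕜] E →ₗ[𝕜] F →ₗ[𝕜] 𝕜 :=
  (integralSubmodule 𝕜 p q E F).subtype

/-- `B ↦ B_L`, as a linear map into the dual of `E ⊗_α F`. -/
noncomputable def toDual :
    IntegralForm 𝕜 p q E F →ₗ[𝕜] StrongDual 𝕜 (AlphaTensor 𝕜 p q E F) where
  toFun B := ⟨linearization 𝕜 p q (form 𝕜 p q E F B), B.2⟩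
  map_add' B C := by
    ext u
    exact DFunLike.congr_fun (linearization_add 𝕜 p q E F _ _) u
  map_smul' c B := by
    ext u
    exact DFunLike.congr_fun (linearization_smul 𝕜 p q E F c _) u

theorem toDual_injective : Function.Injective (toDual 𝕜 p q E F) := by
  intro B C h
  refine (integralSubmodule 𝕜 p q E F).injective_subtype ?_
  ext x y
  have := DFunLike.congr_fun h (AlphaTensor.tmul 𝕜 p q x y)
  exact this

/-- The norm of an `ℓ_p`-integral form `B` is `‖B_L‖`. -/
noncomputable instance : NormedAddCommGroup (IntegralForm 𝕜 p q E F) :=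
  .induced _ _ (toDual 𝕜 p q E F) (toDual_injective 𝕜 p q E F)

noncomputable instance : NormedSpace 𝕜 (IntegralForm 𝕜 p q E F) :=
  .induced 𝕜 _ _ (toDual 𝕜 p q E F)

end IntegralForm

/-- The closed unit ball of the dual of `G`, with the weak* topology. -/
abbrev DualBall (G : Type*) [NormedAddCommGroup G] [NormedSpace 𝕜 G] : Type _ :=
  {f : WeakDual 𝕜 G // ‖WeakDual.toStrongDual f‖ ≤ 1}

/-- The compact space `B_{X(E)'} × B_{Y(F)'}` for `X = ℓ_q⟨·⟩` and `Y = ℓ_p(·)`, with the product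
of the weak* topologies. -/
def BallProd : Type _ :=
  DualBall 𝕜 (CohenSeq 𝕜 q p E) × DualBall 𝕜 (lp (fun _ : ℕ ↦ F) p)

namespace BallProd

noncomputable instance : TopologicalSpace (BallProd 𝕜 p q E F) :=
  inferInstanceAs (TopologicalSpace
    (DualBall 𝕜 (CohenSeq 𝕜 q p E) × DualBall 𝕜 (lp (fun _ : ℕ ↦ F) p)))

/-- The Borel σ-algebra. -/
noncomputable instance : MeasurableSpace (BallProd 𝕜 p q E F) := borel _

instance : BorelSpace (BallProd 𝕜 p q E F) := ⟨rfl⟩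

variable {𝕜 p q E F}

/-- The function `(φ, ψ) ↦ ∑ₙ φₙ(x) ψₙ(y)`, where `φₙ(x) = φ(x · eₙ)` and `ψₙ(y) = ψ(y · eₙ)`. -/
noncomputable def kernel (x : E) (y : F) (ω : BallProd 𝕜 p q E F) : 𝕜 :=
  ∑' n, ω.1.1 (CohenSeq.single 𝕜 q p n x) *
    ω.2.1 (lp.single (E := fun _ : ℕ ↦ F) p n y)

end BallProd

variable {𝕜 p q E F} in
/-- The bilinear form `B` is represented by the regular `𝕜`-valued Borel measure `μ` on
`B_{X(E)'} × B_{Y(F)'}`, that is, `B(x, y) = ∫ ∑ₙ φₙ(x) ψₙ(y) dμ(φ, ψ)` for all `x` and `y`. -/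
def IsRepresentedBy (B : E →ₗ[𝕜] F →ₗ[𝕜] 𝕜) (μ : VectorMeasure (BallProd 𝕜 p q E F) 𝕜) : Prop :=
  μ.variation.Regular ∧ ∀ (x : E) (y : F),
    μ.Integrable (BallProd.kernel x y) ∧
      B x y = μ.integral (BallProd.kernel x y) (ContinuousLinearMap.mul ℝ 𝕜)

variable {𝕜 p q E F} in
/-- The total variation norm `‖μ‖ = |μ|(B_{X(E)'} × B_{Y(F)'})`. -/
noncomputable def totalVariationNorm (μ : VectorMeasure (BallProd 𝕜 p q E F) 𝕜) : ℝ :=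
  (μ.variation Set.univ).toReal

end integral

/-! ### Finite `ℓ_p`–`ℓ_q` duality -/

section duality

variable {𝕜 : Type*} [RCLike 𝕜] {ι : Type*} {P Q : ℝ}

/-! Write α for the tensor norm and q for p*. Fix (φₙ) in the ball of ℓ_p^w(E'). The supremum over
(ψₙ) that defines α(u) is the ℓ_p norm of the sequence of norms ‖(φₙ ⊗ id)u‖. When the second factor
is ℓ_p, the entries of (φₙ ⊗ id)u are φₙ(xₖ), where (xₖ) is the image of u under x ⊗ a ↦ (aₖx)ₖ. So
α is exactly the mid norm of this image (`AlphaTensor.norm_lift_smulSeq`). The image is dense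
because truncations converge in (ℓ_p^mid)^u(E). A dense isometric subspace has the same dual, which
gives 1; 2 is the universal property of the tensor product together with extension to the
completion.

In 3, the lower bound holds because each point of K yields a pair from the two unit balls, so the
integrand belonging to a tensor u is bounded by α(u). For the upper bound no measure on C(K) has to
be constructed: every functional of norm less than r is r times the evaluation at a single point of
K, so r times a point mass represents it. This rests on `MidU.isPairing_of_norm_lt_one`: each
functional of norm less than 1 on (ℓ_p^mid)^u(E) has the form ∑ₙ φₙ(x)ψₙ(a) on the sequences (aₖx)ₖ,
with both sequences in their unit balls.

If the functional sees only N entries, fix finitely many vectors vᵢ in the ball of ℓ_q^N that norm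
ℓ_p^N up to a factor θ < 1. The functionals ∑ᵢ cᵢ φᵢ(∑ⱼ vᵢⱼ xⱼ) then form a weak* compact,
absolutely convex set: the vᵢ are fixed, so convex combinations need no further indices. By the
bipolar theorem it is enough to dominate the functional at one vector at a time, and there the φₙ
sharing the same norming vᵢ can be merged into one (`exists_merge`).

In general, disjoint supports satisfy ‖x + y‖^p ≤ ‖x‖^p + ‖y‖^p, and since p > 1 this forces the
tails of a functional to tend to 0 in norm. The functional is therefore a series of finitely
supported pieces whose norms are dominated by weights of sum at most 1. Countable subconvex
combinations of pairings are pairings, by splitting each weight as c = c^{1/p} c^{1/q} and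
concatenating the sequences. -/

theorem RCLike.exists_mul_eq_norm (z : 𝕜) : ∃ c : 𝕜, ‖c‖ ≤ 1 ∧ c * z = (‖z‖ : 𝕜) := by
  rcases eq_or_ne z 0 with rfl | hz
  · exact ⟨0, by simp, by simp⟩
  · have hz' : (‖z‖ : 𝕜) ≠ 0 := by exact_mod_cast norm_ne_zero_iff.2 hz
    refine ⟨(starRingEnd 𝕜) z / ‖z‖, ?_, ?_⟩
    · rw [norm_div, RCLike.norm_conj, RCLike.norm_ofReal, abs_norm,
        div_self (norm_ne_zero_iff.2 hz)]
    · rw [div_mul_eq_mul_div, RCLike.conj_mul, sq, mul_div_assoc, div_self hz', mul_one]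

/-- Equality is attained in Hölder's inequality on a finite set. Keeping the coefficients real and
nonnegative allows the phases to be put into the functionals instead. -/
theorem exists_nonneg_sum_mul_eq_Lp (h : P.HolderConjugate Q) (s : Finset ι) (z : ι → ℝ)
    (hz : ∀ i, 0 ≤ z i) :
    ∃ c : ι → ℝ, (∀ i, 0 ≤ c i) ∧ ∑ i ∈ s, c i ^ Q ≤ 1 ∧
      ∑ i ∈ s, c i * z i = (∑ i ∈ s, z i ^ P) ^ (1 / P) := by
  obtain ⟨g, hg, hgz⟩ := (NNReal.isGreatest_Lp s (fun i ↦ (⟨z i, hz i⟩ : NNReal)) h).1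
  refine ⟨fun i ↦ g i, fun i ↦ (g i).2, ?_, ?_⟩
  · have h1 : ∑ i ∈ s, g i ^ Q ≤ 1 := hg
    have h2 := (NNReal.coe_le_coe).2 h1
    simpa only [NNReal.coe_sum, NNReal.coe_rpow, NNReal.coe_one] using h2
  · have h1 := congrArg ((↑) : NNReal → ℝ) hgz
    simp only [NNReal.coe_sum, NNReal.coe_rpow] at h1
    simp_rw [mul_comm (g _ : ℝ)]
    exact h1

theorem exists_sum_mul_eq_Lp (h : P.HolderConjugate Q) (s : Finset ι) (z : ι → 𝕜) :
    ∃ c : ι → 𝕜, ∑ i ∈ s, ‖c i‖ ^ Q ≤ 1 ∧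
      ∑ i ∈ s, c i * z i = (((∑ i ∈ s, ‖z i‖ ^ P) ^ (1 / P) : ℝ) : 𝕜) := by
  obtain ⟨c, hc0, hc, hcz⟩ :=
    exists_nonneg_sum_mul_eq_Lp h s (fun i ↦ ‖z i‖) (fun i ↦ norm_nonneg _)
  choose u hu huz using fun i ↦ RCLike.exists_mul_eq_norm (z i)
  refine ⟨fun i ↦ (c i : 𝕜) * u i, ?_, ?_⟩
  · refine le_trans (Finset.sum_le_sum fun i _ ↦ ?_) hc
    refine Real.rpow_le_rpow (norm_nonneg _) ?_ h.symm.nonneg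
    rw [norm_mul, RCLike.norm_ofReal, abs_of_nonneg (hc0 i)]
    exact mul_le_of_le_one_right (hc0 i) (hu i)
  · rw [← hcz]
    push_cast
    refine Finset.sum_congr rfl fun i _ ↦ ?_
    rw [mul_assoc, huz]

/-- The `ℓ_p` norm of a finite family is determined by its pairings with the unit ball of `ℓ_q`. -/
theorem sum_rpow_le_of_forall_dual (h : P.HolderConjugate Q) (s : Finset ι) (z : ι → 𝕜) {C : ℝ}
    (H : ∀ c : ι → 𝕜, ∑ i ∈ s, ‖c i‖ ^ Q ≤ 1 → ‖∑ i ∈ s, c i * z i‖ ≤ C) :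
    ∑ i ∈ s, ‖z i‖ ^ P ≤ C ^ P := by
  obtain ⟨c, hc, hcz⟩ := exists_sum_mul_eq_Lp h s z
  have h0 : 0 ≤ ∑ i ∈ s, ‖z i‖ ^ P := Finset.sum_nonneg fun i _ ↦ by positivity
  have h1 := H c hc
  rw [hcz, RCLike.norm_ofReal, abs_of_nonneg (by positivity)] at h1
  have := Real.rpow_le_rpow (by positivity) h1 h.nonneg
  rwa [← Real.rpow_mul h0, one_div_mul_cancel h.ne_zero, Real.rpow_one] at this

theorem sum_mul_le_of_sum_rpow_le_one (h : P.HolderConjugate Q) (s : Finset ι) {c z : ι → ℝ}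
    (hc0 : ∀ i, 0 ≤ c i) (hz0 : ∀ i, 0 ≤ z i) (hc : ∑ i ∈ s, c i ^ Q ≤ 1) {C : ℝ} (hC : 0 ≤ C)
    (hz : ∑ i ∈ s, z i ^ P ≤ C ^ P) :
    ∑ i ∈ s, c i * z i ≤ C := by
  have h0 : 0 ≤ ∑ i ∈ s, c i ^ Q := Finset.sum_nonneg fun i _ ↦ Real.rpow_nonneg (hc0 i) _
  have h0' : 0 ≤ ∑ i ∈ s, z i ^ P := Finset.sum_nonneg fun i _ ↦ Real.rpow_nonneg (hz0 i) _
  calc ∑ i ∈ s, c i * z i ≤ (∑ i ∈ s, c i ^ Q) ^ (1 / Q) * (∑ i ∈ s, z i ^ P) ^ (1 / P) :=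
        Real.inner_le_Lp_mul_Lq_of_nonneg s h.symm (fun i _ ↦ hc0 i) (fun i _ ↦ hz0 i)
    _ ≤ 1 * C := by
        refine mul_le_mul (Real.rpow_le_one h0 hc h.symm.one_div_nonneg) ?_ (by positivity)
          zero_le_one
        calc (∑ i ∈ s, z i ^ P) ^ (1 / P) ≤ (C ^ P) ^ (1 / P) :=
              Real.rpow_le_rpow h0' hz h.one_div_nonneg
          _ = C := by rw [← Real.rpow_mul hC, mul_one_div_cancel h.ne_zero, Real.rpow_one]
    _ = C := one_mul C

/-- An `ℓ_p` norm in `[0, ∞]` is bounded as soon as its finite partial sums are. -/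
theorem tsum_enorm_rpow_le_iff {G : Type*} [NormedAddCommGroup G] (hP : 0 < P) (z : ι → G) {C : ℝ}
    (hC : 0 ≤ C) :
    (∑' i, ‖z i‖ₑ ^ P) ^ (1 / P) ≤ ENNReal.ofReal C ↔
      ∀ s : Finset ι, ∑ i ∈ s, ‖z i‖ ^ P ≤ C ^ P := by
  have h1 : ∀ s : Finset ι, ∑ i ∈ s, ‖z i‖ₑ ^ P = ENNReal.ofReal (∑ i ∈ s, ‖z i‖ ^ P) := by
    intro s
    rw [ENNReal.ofReal_sum_of_nonneg fun i _ ↦ by positivity]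
    refine Finset.sum_congr rfl fun i _ ↦ ?_
    rw [← ofReal_norm, ENNReal.ofReal_rpow_of_nonneg (norm_nonneg _) hP.le]
  rw [one_div, ENNReal.rpow_inv_le_iff hP, ENNReal.ofReal_rpow_of_nonneg hC hP.le,
    ENNReal.tsum_eq_iSup_sum, iSup_le_iff]
  refine forall_congr' fun s ↦ ?_
  rw [h1, ENNReal.ofReal_le_ofReal_iff (by positivity)]

end duality

/-! ### The unit balls of `ℓ_p^w(E')`, of `ℓ_q⟨E⟩'` and of `ℓ_p(F)'` -/

section balls

variable {𝕜 : Type*} [RCLike 𝕜] {p q : ℝ≥0∞}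
  {E F : Type*} [NormedAddCommGroup E] [NormedSpace 𝕜 E] [NormedAddCommGroup F] [NormedSpace 𝕜 F]

theorem sum_rpow_le_of_weakENorm_le_one (hp : 0 < p.toReal) {φ : ℕ → StrongDual 𝕜 E}
    (h : weakENorm 𝕜 p φ ≤ 1) (x : E) (s : Finset ℕ) :
    ∑ n ∈ s, ‖φ n x‖ ^ p.toReal ≤ ‖x‖ ^ p.toReal := by
  have := tsum_rpow_le_of_weakENorm_le_one hp h x
  rw [← ofReal_norm] at this
  exact (tsum_enorm_rpow_le_iff hp _ (norm_nonneg _)).1 this s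

/-- Testing on E suffices although the weak norm of a sequence in E' ranges over the bidual: by
Hölder, ∑ cₙφₙ has norm at most 1 whenever c is in the ball of ℓ_q, and a bidual functional is then
applied to this sum. -/
theorem weakENorm_le_one (hpq : p.toReal.HolderConjugate q.toReal) {φ : ℕ → StrongDual 𝕜 E}
    (H : ∀ (x : E) (s : Finset ℕ), ∑ n ∈ s, ‖φ n x‖ ^ p.toReal ≤ ‖x‖ ^ p.toReal) :
    weakENorm 𝕜 p φ ≤ 1 := by
  refine iSup₂_le fun f hf ↦ ?_
  rw [← ENNReal.ofReal_one, tsum_enorm_rpow_le_iff hpq.pos _ zero_le_one]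
  intro s
  refine sum_rpow_le_of_forall_dual hpq s _ fun c hc ↦ ?_
  have h1 : ‖∑ n ∈ s, c n • φ n‖ ≤ 1 := by
    refine ContinuousLinearMap.opNorm_le_bound _ zero_le_one fun x ↦ ?_
    rw [one_mul, _root_.sum_apply]
    refine (norm_sum_le _ _).trans ?_
    simp_rw [_root_.smul_apply, norm_smul]
    exact sum_mul_le_of_sum_rpow_le_one hpq s (fun _ ↦ norm_nonneg _) (fun _ ↦ norm_nonneg _) hc
      (norm_nonneg _) (H x s)
  have h2 : ∑ n ∈ s, c n * f (φ n) = f (∑ n ∈ s, c n • φ n) := by simp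
  rw [h2]
  exact (f.le_opNorm _).trans (mul_le_one₀ hf (norm_nonneg _) h1)

variable [Fact (1 < p)] [Fact (1 < q)] [p.HolderConjugate q]

/-- The entries of a functional in the unit ball of `ℓ_q⟨E⟩'`. -/
noncomputable def CohenSeq.entries (f : StrongDual 𝕜 (CohenSeq 𝕜 q p E)) (hf : ‖f‖ ≤ 1) (n : ℕ) :
    StrongDual 𝕜 E :=
  LinearMap.mkContinuous
    { toFun x := f (CohenSeq.single 𝕜 q p n x)
      map_add' x y := by
        rw [← map_add]
        exact congrArg f (Subtype.ext (Pi.single_add (f := fun _ : ℕ ↦ E) n x y))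
      map_smul' c x := by
        rw [RingHom.id_apply, ← map_smul]
        exact congrArg f (Subtype.ext (Pi.single_smul (f := fun _ : ℕ ↦ E) n c x)) } 1 fun x ↦ by
    refine (f.le_opNorm _).trans (mul_le_mul hf ?_ (norm_nonneg _) zero_le_one)
    refine ENNReal.toReal_le_of_le_ofReal (norm_nonneg _) ?_
    rw [ofReal_norm]
    exact cohenENorm_single_le (toReal_pos_of_conj p q) n x

@[simp]
theorem CohenSeq.entries_apply (f : StrongDual 𝕜 (CohenSeq 𝕜 q p E)) (hf : ‖f‖ ≤ 1) (n : ℕ)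
    (x : E) : CohenSeq.entries f hf n x = f (CohenSeq.single 𝕜 q p n x) := rfl

/-- Pairing the numbers f(x · eₙ) with a finite c gives f at the sequence (cₙx), whose Cohen norm is
at most ‖x‖ by Hölder. Thus K consists of pairs admissible in the definition of α. -/
theorem CohenSeq.weakENorm_entries_le_one (f : StrongDual 𝕜 (CohenSeq 𝕜 q p E)) (hf : ‖f‖ ≤ 1) :
    weakENorm 𝕜 p (CohenSeq.entries f hf) ≤ 1 := by
  have hpq := toReal_conj p q
  refine weakENorm_le_one hpq fun x s ↦ ?_
  refine sum_rpow_le_of_forall_dual hpq s _ fun c hc ↦ ?_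
  have h1 : ∑ n ∈ s, c n * CohenSeq.entries f hf n x =
      f (∑ n ∈ s, c n • CohenSeq.single 𝕜 q p n x) := by simp
  rw [h1]
  refine (f.le_opNorm _).trans ((mul_le_of_le_one_left (norm_nonneg _) hf).trans ?_)
  refine ENNReal.toReal_le_of_le_ofReal (norm_nonneg _) ?_
  refine iSup₂_le fun φ hφ ↦ ?_
  have h2 : ∀ j, CohenSeq.seq 𝕜 q p E (∑ n ∈ s, c n • CohenSeq.single 𝕜 q p n x) j =
      if j ∈ s then c j • x else 0 := by
    intro j
    rw [map_sum, Finset.sum_apply]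
    simp_rw [map_smul, Pi.smul_apply]
    have h3 : ∀ n, c n • CohenSeq.seq 𝕜 q p E (CohenSeq.single 𝕜 q p n x) j =
        if j = n then c n • x else 0 := by
      intro n
      change c n • (Pi.single n x : ℕ → E) j = _
      rw [Pi.single_apply, smul_ite, smul_zero]
    simp_rw [h3]
    rw [Finset.sum_ite_eq]
  rw [tsum_eq_sum (s := s) (fun j hj ↦ by rw [h2, if_neg hj, map_zero, enorm_zero])]
  have h4 : ∀ j ∈ s, ‖φ j (CohenSeq.seq 𝕜 q p E (∑ n ∈ s, c n • CohenSeq.single 𝕜 q p n x) j)‖ₑ =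
      ENNReal.ofReal (‖c j‖ * ‖φ j x‖) := by
    intro j hj
    rw [h2, if_pos hj, map_smul, ← ofReal_norm, norm_smul]
  rw [Finset.sum_congr rfl h4, ← ENNReal.ofReal_sum_of_nonneg (fun i _ ↦ by positivity)]
  exact ENNReal.ofReal_le_ofReal (sum_mul_le_of_sum_rpow_le_one hpq s (fun _ ↦ norm_nonneg _)
    (fun _ ↦ norm_nonneg _) hc (norm_nonneg _) (sum_rpow_le_of_weakENorm_le_one hpq.pos hφ x s))

/-- A sequence in the unit ball of `ℓ_p^w(E')` is the sequence of entries of a functional in the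
unit ball of `ℓ_q⟨E⟩'`. -/
theorem CohenSeq.exists_dual_of_weakENorm_le_one {φ : ℕ → StrongDual 𝕜 E}
    (hφ : weakENorm 𝕜 p φ ≤ 1) :
    ∃ f : StrongDual 𝕜 (CohenSeq 𝕜 q p E), ‖f‖ ≤ 1 ∧
      ∀ n x, f (CohenSeq.single 𝕜 q p n x) = φ n x := by
  have hle : ∀ x : CohenSeq 𝕜 q p E,
      ∑' j, ‖φ j (CohenSeq.seq 𝕜 q p E x j)‖ₑ ≤ cohenENorm 𝕜 p (CohenSeq.seq 𝕜 q p E x) :=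
    fun x ↦ le_iSup₂ (f := fun (φ : ℕ → StrongDual 𝕜 E) (_ : weakENorm 𝕜 p φ ≤ 1) ↦
      ∑' j, ‖φ j (CohenSeq.seq 𝕜 q p E x j)‖ₑ) φ hφ
  have hsum : ∀ x : CohenSeq 𝕜 q p E, Summable fun j ↦ ‖φ j (CohenSeq.seq 𝕜 q p E x j)‖ := by
    intro x
    have h := ENNReal.summable_toReal ((hle x).trans_lt x.2).ne
    simpa using h
  let f : CohenSeq 𝕜 q p E →ₗ[𝕜] 𝕜 :=
    { toFun x := ∑' j, φ j (CohenSeq.seq 𝕜 q p E x j)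
      map_add' x y := by
        rw [← (hsum x).of_norm.tsum_add (hsum y).of_norm]
        simp
      map_smul' c x := by
        rw [RingHom.id_apply, smul_eq_mul, ← tsum_mul_left]
        simp }
  have hf : ∀ x, ‖f x‖ ≤ 1 * ‖x‖ := by
    intro x
    refine (norm_tsum_le_tsum_norm (hsum x)).trans ?_
    rw [one_mul]
    have h := ENNReal.toReal_mono x.2.ne (hle x)
    rw [ENNReal.tsum_toReal_eq (fun _ ↦ enorm_ne_top)] at h
    simp only [toReal_enorm] at h
    exact h
  refine ⟨f.mkContinuous 1 hf, f.mkContinuous_norm_le zero_le_one hf, fun n x ↦ ?_⟩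
  change ∑' j, φ j ((Pi.single n x : ℕ → E) j) = φ n x
  rw [tsum_eq_single n (fun j hj ↦ by rw [Pi.single_eq_of_ne hj, map_zero]), Pi.single_eq_same]

/-- The entries of a functional on `ℓ_p(F)`. -/
noncomputable def lpEntry (f : StrongDual 𝕜 (lp (fun _ : ℕ ↦ F) p)) (n : ℕ) : StrongDual 𝕜 F :=
  f ∘L lp.singleContinuousLinearMap 𝕜 (fun _ : ℕ ↦ F) p n

@[simp]
theorem lpEntry_apply (f : StrongDual 𝕜 (lp (fun _ : ℕ ↦ F) p)) (n : ℕ) (y : F) :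
    lpEntry f n y = f (lp.single (E := fun _ : ℕ ↦ F) p n y) := rfl

/-- For fixed unit vectors yₙ this is ℓ_p–ℓ_q duality, tested on the sequences (cₙyₙ). Norms of the
entries need not be attained, so nearly norming yₙ are used up to an error ε, which then tends to 0.
-/
theorem sum_rpow_lpEntry_le (f : StrongDual 𝕜 (lp (fun _ : ℕ ↦ F) p)) (s : Finset ℕ) :
    ∑ n ∈ s, ‖lpEntry f n‖ ^ q.toReal ≤ ‖f‖ ^ q.toReal := by
  have hpq := toReal_conj p q
  have key : ∀ y : ℕ → F, (∀ n, ‖y n‖ ≤ 1) →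
      ∑ n ∈ s, ‖lpEntry f n (y n)‖ ^ q.toReal ≤ ‖f‖ ^ q.toReal := by
    intro y hy
    refine sum_rpow_le_of_forall_dual hpq.symm s _ fun c hc ↦ ?_
    have h1 : ∑ n ∈ s, c n * lpEntry f n (y n) =
        f (∑ n ∈ s, lp.single (E := fun _ : ℕ ↦ F) p n (c n • y n)) := by
      rw [map_sum]
      refine Finset.sum_congr rfl fun n _ ↦ ?_
      rw [lp.single_smul, map_smul, lpEntry_apply, smul_eq_mul]
    rw [h1]
    refine (f.le_opNorm _).trans (mul_le_of_le_one_right (norm_nonneg _) ?_)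
    have h2 := lp.norm_sum_single (E := fun _ : ℕ ↦ F) hpq.pos (fun n ↦ c n • y n) s
    rw [← Real.rpow_le_rpow_iff (norm_nonneg _) zero_le_one hpq.pos, Real.one_rpow, h2]
    refine le_trans (Finset.sum_le_sum fun n _ ↦ ?_) hc
    refine Real.rpow_le_rpow (norm_nonneg _) ?_ hpq.nonneg
    rw [norm_smul]
    exact mul_le_of_le_one_right (norm_nonneg _) (hy n)
  -- The maximum with 0 keeps the base of the real power nonnegative when ε exceeds the norm of an
  -- entry.
  have key2 : ∀ ε : ℝ, 0 < ε →
      ∑ n ∈ s, max (‖lpEntry f n‖ - ε) 0 ^ q.toReal ≤ ‖f‖ ^ q.toReal := by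
    intro ε hε
    have h1 : ∀ n, ∃ y : F, ‖y‖ ≤ 1 ∧ ‖lpEntry f n‖ - ε ≤ ‖lpEntry f n y‖ := by
      intro n
      rcases lt_or_ge (‖lpEntry f n‖ - ε) 0 with h | h
      · exact ⟨0, by simp, by simpa using h.le⟩
      · obtain ⟨y, hy, hy'⟩ := (lpEntry f n).exists_lt_apply_of_lt_opNorm (sub_lt_self _ hε)
        exact ⟨y, hy.le, hy'.le⟩
    choose y hy hy' using h1
    refine le_trans (Finset.sum_le_sum fun n _ ↦ ?_) (key y hy)
    exact Real.rpow_le_rpow (le_max_right _ _) (max_le (hy' n) (norm_nonneg _)) hpq.symm.nonneg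
  have hlim : Tendsto (fun ε : ℝ ↦ ∑ n ∈ s, max (‖lpEntry f n‖ - ε) 0 ^ q.toReal) (𝓝[>] 0)
      (𝓝 (∑ n ∈ s, max (‖lpEntry f n‖ - 0) 0 ^ q.toReal)) := by
    refine Tendsto.mono_left ?_ nhdsWithin_le_nhds
    refine Continuous.tendsto (continuous_finsetSum s fun n _ ↦ ?_) 0
    exact Continuous.rpow_const (by fun_prop) fun _ ↦ Or.inr hpq.symm.nonneg
  simp_rw [sub_zero, max_eq_left (norm_nonneg _)] at hlim
  exact le_of_tendsto hlim (eventually_nhdsWithin_of_forall fun ε hε ↦ key2 ε hε)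

/-- The entries of a functional on `ℓ_p(F)`, as an element of `ℓ_q(F')`. -/
noncomputable def lpEntries (f : StrongDual 𝕜 (lp (fun _ : ℕ ↦ F) p)) :
    lp (fun _ : ℕ ↦ StrongDual 𝕜 F) q :=
  ⟨lpEntry f, memℓp_gen' (sum_rpow_lpEntry_le f)⟩

theorem norm_lpEntries_le (f : StrongDual 𝕜 (lp (fun _ : ℕ ↦ F) p)) :
    ‖(lpEntries f : lp (fun _ : ℕ ↦ StrongDual 𝕜 F) q)‖ ≤ ‖f‖ :=
  lp.norm_le_of_forall_sum_le (toReal_pos_of_conj q p) (norm_nonneg _) (sum_rpow_lpEntry_le f)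

/-- A sequence in `ℓ_q(F')` is the sequence of entries of a functional on `ℓ_p(F)`. -/
theorem exists_dual_of_lp (ψ : lp (fun _ : ℕ ↦ StrongDual 𝕜 F) q) :
    ∃ f : StrongDual 𝕜 (lp (fun _ : ℕ ↦ F) p), ‖f‖ ≤ ‖ψ‖ ∧
      ∀ n y, f (lp.single (E := fun _ : ℕ ↦ F) p n y) = ψ n y := by
  have hB : ∀ _ : ℕ, ‖ContinuousLinearMap.id 𝕜 (StrongDual 𝕜 F)‖ ≤ ((1 : NNReal) : ℝ) :=
    fun _ ↦ ContinuousLinearMap.norm_id_le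
  let D := lp.dualPairing q p (fun _ : ℕ ↦ ContinuousLinearMap.id 𝕜 (StrongDual 𝕜 F)) hB
  refine ⟨D ψ, ?_, fun n y ↦ ?_⟩
  · refine (D.le_opNorm ψ).trans (mul_le_of_le_one_left (norm_nonneg _) ?_)
    exact lp.norm_dualPairing _ hB
  · rw [lp.dualPairing_apply]
    rw [tsum_eq_single n]
    · simp
    · intro j hj
      simp [Pi.single_eq_of_ne hj]

end balls

/-! ### The kernel on the product of the dual balls -/

section kernel

variable {𝕜 : Type*} [RCLike 𝕜] {p q : ℝ≥0∞} [Fact (1 < p)] [Fact (1 < q)] [p.HolderConjugate q]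
  {E F : Type*} [NormedAddCommGroup E] [NormedSpace 𝕜 E] [NormedAddCommGroup F] [NormedSpace 𝕜 F]

theorem AlphaTensor.norm_alphaPairing_le {φ : ℕ → StrongDual 𝕜 E} (hφ : weakENorm 𝕜 p φ ≤ 1)
    {ψ : lp (fun _ : ℕ ↦ StrongDual 𝕜 F) q} (hψ : ‖ψ‖ ≤ 1) (u : AlphaTensor 𝕜 p q E F) :
    ‖alphaPairing φ ψ (AlphaTensor.toTensor 𝕜 p q E F u)‖ ≤ ‖u‖ := by
  have h : ‖alphaPairing φ ψ (AlphaTensor.toTensor 𝕜 p q E F u)‖ₑ ≤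
      alphaENorm 𝕜 p q (AlphaTensor.toTensor 𝕜 p q E F u) :=
    le_iSup₂_of_le (f := fun (φ : ℕ → StrongDual 𝕜 E) (_ : weakENorm 𝕜 p φ ≤ 1) ↦
      ⨆ (ψ : lp (fun _ : ℕ ↦ StrongDual 𝕜 F) q) (_ : ‖ψ‖ ≤ 1),
        ‖alphaPairing φ ψ (AlphaTensor.toTensor 𝕜 p q E F u)‖ₑ) φ hφ
      (le_iSup₂_of_le (f := fun (ψ : lp (fun _ : ℕ ↦ StrongDual 𝕜 F) q) (_ : ‖ψ‖ ≤ 1) ↦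
        ‖alphaPairing φ ψ (AlphaTensor.toTensor 𝕜 p q E F u)‖ₑ) ψ hψ le_rfl)
  have h2 := ENNReal.toReal_mono (alphaENorm_lt_top _).ne h
  rwa [toReal_enorm] at h2

theorem alphaPairing_add {φ : ℕ → StrongDual 𝕜 E} (hφ : weakENorm 𝕜 p φ ≤ 1)
    (ψ : lp (fun _ : ℕ ↦ StrongDual 𝕜 F) q) (u v : E ⊗[𝕜] F) :
    alphaPairing φ ψ (u + v) = alphaPairing φ ψ u + alphaPairing φ ψ v := by
  unfold alphaPairing
  rw [← (summable_alphaPairing hφ ψ u).tsum_add (summable_alphaPairing hφ ψ v)]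
  simp

theorem alphaPairing_tmul (φ : ℕ → StrongDual 𝕜 E) (ψ : ℕ → StrongDual 𝕜 F) (x : E) (y : F) :
    alphaPairing φ ψ (x ⊗ₜ[𝕜] y) = ∑' n, φ n x * ψ n y := by
  simp [alphaPairing]

theorem compactSpace_dualBall {G : Type*} [NormedAddCommGroup G] [NormedSpace 𝕜 G] :
    CompactSpace (DualBall 𝕜 G) := by
  have h : IsCompact {f : WeakDual 𝕜 G | ‖WeakDual.toStrongDual f‖ ≤ 1} := by
    convert WeakDual.isCompact_closedBall (𝕜 := 𝕜) (E := G) 0 1 using 1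
    ext f
    simp
  exact isCompact_iff_compactSpace.1 h

namespace BallProd

/-- The sequence in the unit ball of `ℓ_p^w(E')` given by a point of the product of balls. -/
noncomputable def fst (ω : BallProd 𝕜 p q E F) : ℕ → StrongDual 𝕜 E :=
  CohenSeq.entries (WeakDual.toStrongDual ω.1.1) ω.1.2

/-- The sequence in the unit ball of `ℓ_q(F')` given by a point of the product of balls. -/
noncomputable def snd (ω : BallProd 𝕜 p q E F) : lp (fun _ : ℕ ↦ StrongDual 𝕜 F) q :=
  lpEntries (WeakDual.toStrongDual ω.2.1)

theorem weakENorm_fst_le_one (ω : BallProd 𝕜 p q E F) : weakENorm 𝕜 p ω.fst ≤ 1 :=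
  CohenSeq.weakENorm_entries_le_one _ ω.1.2

theorem norm_snd_le_one (ω : BallProd 𝕜 p q E F) : ‖ω.snd‖ ≤ 1 :=
  (norm_lpEntries_le _).trans ω.2.2

theorem kernel_eq_alphaPairing (x : E) (y : F) (ω : BallProd 𝕜 p q E F) :
    kernel x y ω = alphaPairing ω.fst ω.snd (x ⊗ₜ[𝕜] y) := by
  rw [alphaPairing_tmul]
  rfl

/-- Every pair admissible for α comes from a point of K, because both sequences extend to
functionals in the dual balls. This is what makes a single point mass sufficient as a representing
measure. -/
theorem exists_kernel_eq {φ : ℕ → StrongDual 𝕜 E} (hφ : weakENorm 𝕜 p φ ≤ 1)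
    {ψ : lp (fun _ : ℕ ↦ StrongDual 𝕜 F) q} (hψ : ‖ψ‖ ≤ 1) :
    ∃ ω : BallProd 𝕜 p q E F, ∀ x y, kernel x y ω = ∑' n, φ n x * ψ n y := by
  obtain ⟨f, hf, hfφ⟩ := CohenSeq.exists_dual_of_weakENorm_le_one (q := q) hφ
  obtain ⟨g, hg, hgψ⟩ := exists_dual_of_lp (p := p) ψ
  refine ⟨(⟨StrongDual.toWeakDual f, hf⟩, ⟨StrongDual.toWeakDual g, hg.trans hψ⟩),
    fun x y ↦ tsum_congr fun n ↦ ?_⟩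
  rw [← hfφ, ← hgψ]
  rfl

instance : CompactSpace (BallProd 𝕜 p q E F) := by
  have h1 : CompactSpace (DualBall 𝕜 (CohenSeq 𝕜 q p E)) := compactSpace_dualBall
  have h2 : CompactSpace (DualBall 𝕜 (lp (fun _ : ℕ ↦ F) p)) := compactSpace_dualBall
  exact inferInstanceAs (CompactSpace
    (DualBall 𝕜 (CohenSeq 𝕜 q p E) × DualBall 𝕜 (lp (fun _ : ℕ ↦ F) p)))

instance : T2Space (BallProd 𝕜 p q E F) :=
  inferInstanceAs (T2Space
    (DualBall 𝕜 (CohenSeq 𝕜 q p E) × DualBall 𝕜 (lp (fun _ : ℕ ↦ F) p)))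

end BallProd

/-- The lower bound for the total variation of a representing measure. -/
theorem norm_le_totalVariationNorm (B : IntegralForm 𝕜 p q E F)
    {μ : VectorMeasure (BallProd 𝕜 p q E F) 𝕜}
    (h : IsRepresentedBy (IntegralForm.form 𝕜 p q E F B) μ) : ‖B‖ ≤ totalVariationNorm μ := by
  have := h.1
  have hfin : IsFiniteMeasure μ.variation := inferInstance
  refine ContinuousLinearMap.opNorm_le_bound _ ENNReal.toReal_nonneg fun u ↦ ?_
  -- The representation is assumed on elementary tensors only; additivity of the integral carries
  -- it, with integrability, to all of E ⊗ F, where ‖B_L‖ is computed.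
  have key : ∀ u : E ⊗[𝕜] F,
      μ.Integrable (fun ω ↦ alphaPairing ω.fst ω.snd u) ∧
        TensorProduct.lift (IntegralForm.form 𝕜 p q E F B) u =
          μ.integral (fun ω ↦ alphaPairing ω.fst ω.snd u) (ContinuousLinearMap.mul ℝ 𝕜) := by
    intro u
    induction u with
    | zero =>
      have h0 : (fun ω : BallProd 𝕜 p q E F ↦ alphaPairing ω.fst ω.snd (0 : E ⊗[𝕜] F)) = 0 := by
        ext ω
        simp [alphaPairing]
      rw [h0]
      exact ⟨integrable_zero _ _ _, by rw [map_zero]; exact VectorMeasure.integral_zero.symm⟩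
    | tmul x y =>
      simp_rw [← BallProd.kernel_eq_alphaPairing, TensorProduct.lift.tmul]
      exact h.2 x y
    | add u v hu hv =>
      have h0 : (fun ω : BallProd 𝕜 p q E F ↦ alphaPairing ω.fst ω.snd (u + v)) =
          (fun ω ↦ alphaPairing ω.fst ω.snd u) + fun ω ↦ alphaPairing ω.fst ω.snd v := by
        ext ω
        exact alphaPairing_add ω.weakENorm_fst_le_one ω.snd u v
      rw [h0]
      refine ⟨hu.1.add hv.1, ?_⟩
      rw [map_add, hu.2, hv.2, VectorMeasure.integral_add hu.1 hv.1]
  change ‖TensorProduct.lift (IntegralForm.form 𝕜 p q E F B)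
    (AlphaTensor.toTensor 𝕜 p q E F u)‖ ≤ _
  rw [(key _).2]
  -- At each point of K the integrand is one of the pairings in the supremum defining α(u).
  refine (VectorMeasure.norm_integral_le_of_norm_le_const (C := ‖u‖)
    (Eventually.of_forall fun ω ↦
      AlphaTensor.norm_alphaPairing_le ω.weakENorm_fst_le_one ω.norm_snd_le_one u)).trans ?_
  rw [mul_comm (totalVariationNorm μ)]
  refine mul_le_mul_of_nonneg_right ?_ ENNReal.toReal_nonneg
  exact mul_le_of_le_one_right (norm_nonneg _) (ContinuousLinearMap.opNorm_mul_le ℝ 𝕜)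

/-- A multiple of a point mass represents the form given by the kernel at that point. -/
theorem isRepresentedBy_dirac (B : E →ₗ[𝕜] F →ₗ[𝕜] 𝕜) (ω : BallProd 𝕜 p q E F) {r : ℝ}
    (hr : 0 ≤ r) (h : ∀ x y, B x y = r * BallProd.kernel x y ω) :
    IsRepresentedBy B (VectorMeasure.dirac ω (r : 𝕜)) ∧
      totalVariationNorm (VectorMeasure.dirac ω (r : 𝕜)) = r := by
  refine ⟨⟨?_, fun x y ↦ ⟨?_, ?_⟩⟩, ?_⟩
  · rw [VectorMeasure.variation_dirac]
    -- The compact set {ω} already carries the whole mass.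
    have hreg : (Measure.dirac ω).InnerRegular := by
      refine ⟨fun U hU c hc ↦ ?_⟩
      by_cases hω : ω ∈ U
      · refine ⟨{ω}, Set.singleton_subset_iff.2 hω, isCompact_singleton, ?_⟩
        rw [Measure.dirac_apply_of_mem hω] at hc
        rwa [Measure.dirac_apply_of_mem (Set.mem_singleton ω)]
      · rw [Measure.dirac_apply' _ hU, Set.indicator_of_notMem hω] at hc
        exact absurd hc not_lt_zero
    exact Measure.Regular.smul enorm_ne_top
  · rw [VectorMeasure.Integrable, VectorMeasure.variation_dirac]
    exact (integrable_dirac (by simp)).smul_measure enorm_ne_top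
  · rw [VectorMeasure.integral_dirac, h]
    simp [mul_comm]
  · simp [totalVariationNorm, hr]

end kernel

/-! ### Duals of dense subspaces -/

section dense

variable {𝕜 : Type*} [RCLike 𝕜] {V W : Type*} [NormedAddCommGroup V] [NormedSpace 𝕜 V]
  [NormedAddCommGroup W] [NormedSpace 𝕜 W]

/-- Restriction to a dense subspace is an isometric isomorphism of the duals. -/
noncomputable def LinearIsometry.dualEquiv (i : V →ₗᵢ[𝕜] W) (hi : DenseRange i) :
    StrongDual 𝕜 W ≃ₗᵢ[𝕜] StrongDual 𝕜 V :=
  .ofSurjective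
    { toFun f := f ∘L i.toContinuousLinearMap
      map_add' _ _ := rfl
      map_smul' _ _ := rfl
      norm_map' f := by
        refine le_antisymm ?_ ?_
        · refine ContinuousLinearMap.opNorm_le_bound _ (norm_nonneg _) fun v ↦ ?_
          exact (f.le_opNorm _).trans_eq (by simp)
        · refine ContinuousLinearMap.opNorm_le_bound _ (norm_nonneg _) fun w ↦ ?_
          refine hi.induction_on w (isClosed_le (by fun_prop) (by fun_prop)) fun v ↦ ?_
          have := (f ∘L i.toContinuousLinearMap).le_opNorm v
          rw [i.norm_map]
          exact this }
    fun g ↦ ⟨g.extend i.toContinuousLinearMap, by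
      ext v
      exact g.extend_eq hi i.isometry.isUniformInducing v⟩

@[simp]
theorem LinearIsometry.dualEquiv_apply (i : V →ₗᵢ[𝕜] W) (hi : DenseRange i) (f : StrongDual 𝕜 W)
    (v : V) : i.dualEquiv hi f v = f (i v) := rfl

theorem LinearIsometry.dualEquiv_symm_apply (i : V →ₗᵢ[𝕜] W) (hi : DenseRange i)
    (g : StrongDual 𝕜 V) (v : V) : (i.dualEquiv hi).symm g (i v) = g v := by
  rw [← i.dualEquiv_apply hi, LinearIsometryEquiv.apply_symm_apply]

end dense

/-! ### The norm of `(ℓ_p^mid)^u(E)` -/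

section mid

variable {𝕜 : Type*} [RCLike 𝕜] {p : ℝ≥0∞} {E : Type*} [NormedAddCommGroup E] [NormedSpace 𝕜 E]

theorem midENorm_le_iff (hp : 0 < p.toReal) (x : ℕ → E) {C : ℝ} (hC : 0 ≤ C) :
    midENorm 𝕜 p x ≤ ENNReal.ofReal C ↔ ∀ φ : ℕ → StrongDual 𝕜 E, weakENorm 𝕜 p φ ≤ 1 →
      ∀ s : Finset (ℕ × ℕ), ∑ i ∈ s, ‖φ i.1 (x i.2)‖ ^ p.toReal ≤ C ^ p.toReal := by
  rw [midENorm, iSup₂_le_iff]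
  refine forall₂_congr fun φ _ ↦ ?_
  rw [← ENNReal.tsum_prod (f := fun n j ↦ ‖φ n (x j)‖ₑ ^ p.toReal)]
  exact tsum_enorm_rpow_le_iff hp (fun i : ℕ × ℕ ↦ φ i.1 (x i.2)) hC

theorem midENorm_mono (hp : 0 < p.toReal) {x y : ℕ → E} (h : ∀ j, y j = x j ∨ y j = 0) :
    midENorm 𝕜 p y ≤ midENorm 𝕜 p x := by
  refine iSup₂_mono fun φ _ ↦ ?_
  gcongr with n j
  rcases h j with h | h <;> simp [h]

/-- The mid norm ignores zero entries. The tails in the definition of (ℓ_p^mid)^u(E) are shifted to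
the origin, whereas projections leave them in place; this reconciles the two. -/
theorem midENorm_indicator_Ici (hp : 0 < p.toReal) (x : ℕ → E) (N : ℕ) :
    midENorm 𝕜 p ((Set.Ici N).indicator x) = midENorm 𝕜 p fun j ↦ x (N + j) := by
  refine iSup_congr fun φ ↦ iSup_congr fun _ ↦ ?_
  congr 1
  refine tsum_congr fun n ↦ ?_
  rw [← (add_right_injective N).tsum_eq
    (f := fun j ↦ ‖φ n ((Set.Ici N).indicator x j)‖ₑ ^ p.toReal)]
  · simp
  · intro j hj
    have hj' : N ≤ j := by
      by_contra h
      simp [Set.indicator_of_notMem (show j ∉ Set.Ici N from h), hp] at hj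
    exact ⟨j - N, by simp [hj']⟩

/-- For fixed φ the double series factors as ∑ₖ|aₖ|^p · ∑ₙ|φₙ(x)|^p. Applied to tails of a, it also
shows that (aₖx)ₖ lies in (ℓ_p^mid)^u(E). -/
theorem midENorm_smul_le (hp : 0 < p.toReal) (a : ℕ → 𝕜) (x : E) :
    midENorm 𝕜 p (fun k ↦ a k • x) ≤ (∑' k, ‖a k‖ₑ ^ p.toReal) ^ (1 / p.toReal) * ‖x‖ₑ := by
  refine iSup₂_le fun φ hφ ↦ ?_
  have h : ∀ n j, ‖φ n (a j • x)‖ₑ ^ p.toReal = ‖a j‖ₑ ^ p.toReal * ‖φ n x‖ₑ ^ p.toReal := by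
    intro n j
    rw [map_smul, smul_eq_mul, enorm_mul, ENNReal.mul_rpow_of_nonneg _ _ hp.le]
  simp_rw [h, ENNReal.tsum_mul_right, ENNReal.tsum_mul_left]
  rw [ENNReal.mul_rpow_of_nonneg _ _ (by positivity)]
  gcongr
  exact tsum_rpow_le_of_weakENorm_le_one hp hφ x

theorem lp.tsum_enorm_rpow_ne_top (hp : 0 < p.toReal) (a : lp (fun _ : ℕ ↦ E) p) :
    ∑' k, ‖a k‖ₑ ^ p.toReal ≠ ∞ := by
  have h := (lp.memℓp a).summable hp
  have h2 : ∀ k, ‖a k‖ₑ ^ p.toReal = ENNReal.ofReal (‖a k‖ ^ p.toReal) := fun k ↦ by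
    rw [← ofReal_norm, ENNReal.ofReal_rpow_of_nonneg (norm_nonneg _) hp.le]
  simp_rw [h2]
  exact h.tsum_ofReal_ne_top

namespace MidU

variable [hp1 : Fact (1 ≤ p)] [hp2 : Fact (p < ∞)]

theorem toReal_exponent_pos : 0 < p.toReal :=
  one_pos.trans_le (one_le_toReal_of_fact p hp2.out.ne)

theorem norm_le_iff (x : MidU 𝕜 p E) {C : ℝ} (hC : 0 ≤ C) :
    ‖x‖ ≤ C ↔ ∀ φ : ℕ → StrongDual 𝕜 E, weakENorm 𝕜 p φ ≤ 1 →
      ∀ s : Finset (ℕ × ℕ), ∑ i ∈ s, ‖φ i.1 (seq 𝕜 p E x i.2)‖ ^ p.toReal ≤ C ^ p.toReal := by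
  have h : midENorm 𝕜 p (seq 𝕜 p E x) ≠ ∞ := x.2.1.ne
  rw [← midENorm_le_iff toReal_exponent_pos _ hC, ENNReal.le_ofReal_iff_toReal_le h hC]
  rfl

theorem sum_rpow_le (x : MidU 𝕜 p E) {φ : ℕ → StrongDual 𝕜 E} (hφ : weakENorm 𝕜 p φ ≤ 1)
    (s : Finset (ℕ × ℕ)) :
    ∑ i ∈ s, ‖φ i.1 (seq 𝕜 p E x i.2)‖ ^ p.toReal ≤ ‖x‖ ^ p.toReal :=
  (norm_le_iff x (norm_nonneg x)).1 le_rfl φ hφ s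

theorem seq_injective : Function.Injective (seq 𝕜 p E) :=
  (midUSubmodule 𝕜 p E).injective_subtype

/-- Every coordinate is a contraction onto `E`. -/
noncomputable def coord (j : ℕ) : MidU 𝕜 p E →L[𝕜] E :=
  LinearMap.mkContinuous (LinearMap.proj j ∘ₗ seq 𝕜 p E) 1 fun x ↦ by
    have hp := toReal_exponent_pos (p := p)
    obtain ⟨f, hf, hfx⟩ := exists_weakENorm_single_le_one (𝕜 := 𝕜) hp 0 (seq 𝕜 p E x j)
    have h := sum_rpow_le x hf {(0, j)}
    rw [Finset.sum_singleton, Pi.single_eq_same] at h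
    have h2 : ‖f (seq 𝕜 p E x j)‖ = ‖seq 𝕜 p E x j‖ := by
      have := congrArg ENNReal.toReal hfx
      simpa using this
    rw [h2, Real.rpow_le_rpow_iff (norm_nonneg _) (norm_nonneg _) hp] at h
    rwa [one_mul]

@[simp]
theorem coord_apply (j : ℕ) (x : MidU 𝕜 p E) : coord j x = seq 𝕜 p E x j := rfl

/-- The projection onto the sequences supported in `A`. -/
noncomputable def proj (A : Set ℕ) : MidU 𝕜 p E →L[𝕜] MidU 𝕜 p E :=
  LinearMap.mkContinuous
    { toFun x := ⟨A.indicator (seq 𝕜 p E x), by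
        classical
        have hp := toReal_exponent_pos (p := p)
        refine ⟨(midENorm_mono hp fun j ↦ ?_).trans_lt x.2.1,
          tendsto_of_tendsto_of_tendsto_of_le_of_le tendsto_const_nhds x.2.2 (fun _ ↦ bot_le)
          fun n ↦ midENorm_mono hp fun j ↦ ?_⟩ <;>
        · rw [Set.indicator_apply]
          split_ifs
          exacts [Or.inl rfl, Or.inr rfl]⟩
      map_add' x y := Subtype.ext (Set.indicator_add A (seq 𝕜 p E x) (seq 𝕜 p E y))
      map_smul' c x := Subtype.ext (Set.indicator_const_smul A c (seq 𝕜 p E x)) } 1 fun x ↦ by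
    classical
    rw [one_mul]
    refine ENNReal.toReal_mono x.2.1.ne (midENorm_mono toReal_exponent_pos fun j ↦ ?_)
    change A.indicator (seq 𝕜 p E x) j = _ ∨ A.indicator (seq 𝕜 p E x) j = 0
    rw [Set.indicator_apply]
    split_ifs
    exacts [Or.inl rfl, Or.inr rfl]

@[simp]
theorem seq_proj (A : Set ℕ) (x : MidU 𝕜 p E) :
    seq 𝕜 p E (proj A x) = A.indicator (seq 𝕜 p E x) := rfl

theorem norm_proj_le (A : Set ℕ) (x : MidU 𝕜 p E) : ‖proj A x‖ ≤ ‖x‖ := by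
  refine ((proj (𝕜 := 𝕜) (p := p) (E := E) A).le_opNorm x).trans
    (mul_le_of_le_one_left (norm_nonneg _) ?_)
  exact LinearMap.mkContinuous_norm_le _ zero_le_one _

theorem proj_add_proj_compl (A : Set ℕ) (x : MidU 𝕜 p E) : proj A x + proj Aᶜ x = x :=
  seq_injective (Set.indicator_self_add_compl A (seq 𝕜 p E x))

/-- This is the condition that singles out (ℓ_p^mid)^u(E) inside ℓ_p^mid(E). It underlies the
density of E ⊗ ℓ_p and the decay of the tails of functionals. -/
theorem tendsto_proj_Ici (x : MidU 𝕜 p E) :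
    Tendsto (fun N ↦ proj (Set.Ici N) x) atTop (𝓝 0) := by
  rw [tendsto_zero_iff_norm_tendsto_zero]
  have h := (ENNReal.tendsto_toReal ENNReal.zero_ne_top).comp x.2.2
  rw [ENNReal.toReal_zero] at h
  refine h.congr fun N ↦ ?_
  exact congrArg ENNReal.toReal (midENorm_indicator_Ici toReal_exponent_pos _ N).symm

theorem tendsto_proj_Iio (x : MidU 𝕜 p E) :
    Tendsto (fun N ↦ proj (Set.Iio N) x) atTop (𝓝 x) := by
  have h := (tendsto_const_nhds (x := x)).sub (tendsto_proj_Ici x)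
  rw [sub_zero] at h
  refine h.congr fun N ↦ ?_
  rw [sub_eq_iff_eq_add, ← Set.compl_Iio, proj_add_proj_compl]

/-- The sequence `(aₖ x)ₖ`. -/
noncomputable def smulSeq : E →ₗ[𝕜] lp (fun _ : ℕ ↦ 𝕜) p →ₗ[𝕜] MidU 𝕜 p E :=
  LinearMap.mk₂ 𝕜 (fun x a ↦ ⟨fun k ↦ a k • x, by
      have hp := toReal_exponent_pos (p := p)
      have ha := lp.tsum_enorm_rpow_ne_top hp a
      refine ⟨(midENorm_smul_le hp a x).trans_lt (ENNReal.mul_lt_top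
        (ENNReal.rpow_lt_top_of_nonneg (by positivity) ha) enorm_lt_top), ?_⟩
      have h := ENNReal.tendsto_sum_nat_add _ ha
      have h2 := ENNReal.Tendsto.mul_const (b := ‖x‖ₑ) ((ENNReal.continuous_rpow_const
        (y := 1 / p.toReal)).tendsto 0 |>.comp h) (Or.inr enorm_ne_top)
      rw [ENNReal.zero_rpow_of_pos (by positivity), zero_mul] at h2
      refine tendsto_of_tendsto_of_tendsto_of_le_of_le tendsto_const_nhds h2 (fun _ ↦ bot_le)
        fun n ↦ ?_
      simp_rw [add_comm n]
      exact midENorm_smul_le hp (fun k ↦ a (k + n)) x⟩)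
    (fun x y a ↦ Subtype.ext (funext fun k ↦ smul_add (a k) x y))
    (fun c x a ↦ Subtype.ext (funext fun k ↦ smul_comm (a k) c x))
    (fun x a b ↦ Subtype.ext (funext fun k ↦ add_smul (a k) (b k) x))
    (fun c x a ↦ Subtype.ext (funext fun k ↦ smul_assoc c (a k) x))

@[simp]
theorem seq_smulSeq (x : E) (a : lp (fun _ : ℕ ↦ 𝕜) p) (k : ℕ) :
    seq 𝕜 p E (smulSeq x a) k = a k • x := rfl

/-- Truncations lie in the image of E ⊗ ℓ_p, as images of ∑ xⱼ ⊗ eⱼ. -/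
theorem proj_Iio_eq_sum (x : MidU 𝕜 p E) (N : ℕ) : proj (Set.Iio N) x =
    ∑ j ∈ Finset.range N, smulSeq (seq 𝕜 p E x j) (lp.single (E := fun _ : ℕ ↦ 𝕜) p j 1) := by
  classical
  refine seq_injective (funext fun k ↦ ?_)
  rw [map_sum, Finset.sum_apply, seq_proj, Set.indicator_apply]
  simp only [seq_smulSeq, lp.single_apply, Pi.single_apply, ite_smul, one_smul, zero_smul]
  rw [Finset.sum_ite_eq]
  simp

end MidU

end mid

/-! ### `E ⊗_α ℓ_p` as a dense subspace of `(ℓ_p^mid)^u(E)` -/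

section embedding

variable {𝕜 : Type*} [RCLike 𝕜] {p q : ℝ≥0∞} [Fact (1 < p)] [hp2 : Fact (p < ∞)] [Fact (1 < q)]
  [p.HolderConjugate q] {E F : Type*} [NormedAddCommGroup E] [NormedSpace 𝕜 E]
  [NormedAddCommGroup F] [NormedSpace 𝕜 F]

/-- The contraction `x ⊗ y ↦ φ(x) y`. -/
noncomputable def tensorContractLeft (φ : StrongDual 𝕜 E) : E ⊗[𝕜] F →ₗ[𝕜] F :=
  TensorProduct.lift ((LinearMap.lsmul 𝕜 F).comp (φ : E →ₗ[𝕜] 𝕜))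

/-- With φ applied first, the supremum over (ψₙ) becomes the duality between ℓ_q(F') and the vectors
(φₙ ⊗ id)u of F. -/
theorem mul_map_eq_tensorContractLeft (φ : StrongDual 𝕜 E) (ψ : StrongDual 𝕜 F) (u : E ⊗[𝕜] F) :
    LinearMap.mul' 𝕜 𝕜 (TensorProduct.map (φ : E →ₗ[𝕜] 𝕜) (ψ : F →ₗ[𝕜] 𝕜) u) =
      ψ (tensorContractLeft φ u) := by
  induction u with
  | zero => simp
  | tmul x y => simp [tensorContractLeft]
  | add u v hu hv => simp only [map_add, hu, hv]

/-- The link between α and the mid norm: ℓ_p norms of contractions of u are sums of |φ(xⱼ)|^p over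
the entries of its image. -/
theorem tensorContractLeft_apply_eq (φ : StrongDual 𝕜 E) (u : E ⊗[𝕜] lp (fun _ : ℕ ↦ 𝕜) p) (j : ℕ) :
    tensorContractLeft φ u j = φ (MidU.seq 𝕜 p E (TensorProduct.lift MidU.smulSeq u) j) := by
  induction u with
  | zero => simp
  | tmul x y => simp [tensorContractLeft, mul_comm]
  | add u v hu hv => simp only [map_add, lp.coeFn_add, Pi.add_apply, hu, hv]

theorem sum_norm_tensorContractLeft_rpow_le {φ : ℕ → StrongDual 𝕜 E} (hφ : weakENorm 𝕜 p φ ≤ 1)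
    (u : E ⊗[𝕜] lp (fun _ : ℕ ↦ 𝕜) p) (s : Finset ℕ) :
    ∑ n ∈ s, ‖tensorContractLeft (φ n) u‖ ^ p.toReal ≤
      ‖TensorProduct.lift (MidU.smulSeq (𝕜 := 𝕜) (p := p) (E := E)) u‖ ^ p.toReal := by
  have hp := MidU.toReal_exponent_pos (p := p)
  have h1 : HasSum (fun j ↦ ∑ n ∈ s, ‖tensorContractLeft (φ n) u j‖ ^ p.toReal)
      (∑ n ∈ s, ‖tensorContractLeft (φ n) u‖ ^ p.toReal) := hasSum_sum fun n _ ↦ lp.hasSum_norm hp _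
  -- Finitely many contractions and finitely many coordinates give a finite rectangle, over which
  -- the mid norm controls the sum.
  refine hasSum_le_of_sum_le h1 fun t ↦ ?_
  rw [Finset.sum_comm,
    ← Finset.sum_product' (f := fun n j ↦ ‖tensorContractLeft (φ n) u j‖ ^ p.toReal)]
  simp_rw [tensorContractLeft_apply_eq]
  exact MidU.sum_rpow_le _ hφ _

theorem norm_alphaPairing_le_norm_lift {φ : ℕ → StrongDual 𝕜 E} (hφ : weakENorm 𝕜 p φ ≤ 1)
    {ψ : lp (fun _ : ℕ ↦ StrongDual 𝕜 (lp (fun _ : ℕ ↦ 𝕜) p)) q} (hψ : ‖ψ‖ ≤ 1)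
    (u : E ⊗[𝕜] lp (fun _ : ℕ ↦ 𝕜) p) :
    ‖alphaPairing φ ψ u‖ ≤ ‖TensorProduct.lift (MidU.smulSeq (𝕜 := 𝕜) (p := p) (E := E)) u‖ := by
  have hpq := toReal_conj p q
  refine le_of_tendsto (summable_alphaPairing hφ ψ u).hasSum.norm (Eventually.of_forall fun s ↦ ?_)
  simp_rw [mul_map_eq_tensorContractLeft]
  refine (norm_sum_le_of_le s fun n _ ↦ (ψ n).le_opNorm _).trans ?_
  refine sum_mul_le_of_sum_rpow_le_one hpq s (fun _ ↦ norm_nonneg _) (fun _ ↦ norm_nonneg _) ?_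
    (norm_nonneg _) (sum_norm_tensorContractLeft_rpow_le hφ u s)
  exact (lp.sum_rpow_le_norm_rpow hpq.symm.pos ψ s).trans
    (Real.rpow_le_one (norm_nonneg _) hψ hpq.symm.nonneg)

omit hp2 in
/-- The vectors `(φₙ ⊗ id)(u)` are normed by an element of the unit ball of `ℓ_q(F')`. -/
theorem AlphaTensor.sum_norm_tensorContractLeft_rpow_le {φ : ℕ → StrongDual 𝕜 E}
    (hφ : weakENorm 𝕜 p φ ≤ 1) (u : AlphaTensor 𝕜 p q E F) (s : Finset ℕ) :
    ∑ n ∈ s, ‖tensorContractLeft (φ n) (AlphaTensor.toTensor 𝕜 p q E F u)‖ ^ p.toReal ≤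
      ‖u‖ ^ p.toReal := by
  classical
  have hpq := toReal_conj p q
  set w : ℕ → F := fun n ↦ tensorContractLeft (φ n) (AlphaTensor.toTensor 𝕜 p q E F u) with hw
  -- The norming element is ψₙ = cₙgₙ on s and 0 elsewhere, with gₙ norming (φₙ ⊗ id)u and c the
  -- Hölder-extremal vector for these norms.
  obtain ⟨c, hc0, hc, hcw⟩ :=
    exists_nonneg_sum_mul_eq_Lp hpq s (fun n ↦ ‖w n‖) (fun n ↦ norm_nonneg _)
  choose g hg hgw using fun n ↦ exists_dual_vector'' 𝕜 (w n)
  have hsum : ∀ t : Finset ℕ, ∑ n ∈ t, ‖(if n ∈ s then (c n : 𝕜) • g n else 0)‖ ^ q.toReal ≤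
      1 ^ q.toReal := by
    intro t
    rw [Real.one_rpow]
    refine le_trans (Finset.sum_le_sum (g := fun n ↦ if n ∈ s then c n ^ q.toReal else 0)
      fun n _ ↦ ?_) (le_trans ?_ hc)
    · split_ifs
      · refine Real.rpow_le_rpow (norm_nonneg _) ?_ hpq.symm.nonneg
        rw [norm_smul, RCLike.norm_ofReal, abs_of_nonneg (hc0 n)]
        exact mul_le_of_le_one_right (hc0 n) (hg n)
      · rw [norm_zero, Real.zero_rpow hpq.symm.ne_zero]
    · rw [← Finset.sum_filter]
      refine Finset.sum_le_sum_of_subset_of_nonneg (fun n hn ↦ (Finset.mem_filter.1 hn).2)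
        fun n _ _ ↦ Real.rpow_nonneg (hc0 n) _
  let ψ : lp (fun _ : ℕ ↦ StrongDual 𝕜 F) q := ⟨_, memℓp_gen' hsum⟩
  have hψ : ‖ψ‖ ≤ 1 := lp.norm_le_of_forall_sum_le hpq.symm.pos zero_le_one hsum
  have h1 : alphaPairing φ ψ (AlphaTensor.toTensor 𝕜 p q E F u) =
      (((∑ n ∈ s, ‖w n‖ ^ p.toReal) ^ (1 / p.toReal) : ℝ) : 𝕜) := by
    unfold alphaPairing
    simp_rw [mul_map_eq_tensorContractLeft]
    rw [tsum_eq_sum (s := s), ← hcw]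
    · push_cast
      refine Finset.sum_congr rfl fun n hn ↦ ?_
      change (if n ∈ s then (c n : 𝕜) • g n else 0) (w n) = _
      rw [if_pos hn, _root_.smul_apply, hgw, smul_eq_mul]
    · intro n hn
      change (if n ∈ s then (c n : 𝕜) • g n else 0) (w n) = _
      rw [if_neg hn, _root_.zero_apply]
  have h0 : 0 ≤ ∑ n ∈ s, ‖w n‖ ^ p.toReal := Finset.sum_nonneg fun n _ ↦ by positivity
  have h2 := AlphaTensor.norm_alphaPairing_le hφ hψ u
  rw [h1, RCLike.norm_ofReal, abs_of_nonneg (by positivity)] at h2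
  have h3 := Real.rpow_le_rpow (by positivity) h2 hpq.nonneg
  rwa [← Real.rpow_mul h0, one_div_mul_cancel hpq.ne_zero, Real.rpow_one] at h3

/-- For each fixed φ both norms lead to the norm of ((φₙ ⊗ id)u)ₙ in ℓ_p(ℓ_p): α by duality in ψ,
the mid norm by reading off coordinates. -/
theorem AlphaTensor.norm_lift_smulSeq (u : AlphaTensor 𝕜 p q E (lp (fun _ : ℕ ↦ 𝕜) p)) :
    ‖TensorProduct.lift (MidU.smulSeq (𝕜 := 𝕜) (p := p) (E := E))
      (AlphaTensor.toTensor 𝕜 p q E (lp (fun _ : ℕ ↦ 𝕜) p) u)‖ = ‖u‖ := by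
  classical
  have hp := toReal_pos_of_conj p q
  refine le_antisymm ?_ ?_
  · refine (MidU.norm_le_iff _ (norm_nonneg _)).2 fun φ hφ s ↦ ?_
    refine le_trans ?_ (AlphaTensor.sum_norm_tensorContractLeft_rpow_le hφ u (s.image Prod.fst))
    set w : ℕ → lp (fun _ : ℕ ↦ 𝕜) p := fun n ↦ tensorContractLeft (φ n)
      (AlphaTensor.toTensor 𝕜 p q E (lp (fun _ : ℕ ↦ 𝕜) p) u) with hw
    have h1 : ∑ i ∈ s, ‖φ i.1 (MidU.seq 𝕜 p E (TensorProduct.lift MidU.smulSeq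
        (AlphaTensor.toTensor 𝕜 p q E (lp (fun _ : ℕ ↦ 𝕜) p) u)) i.2)‖ ^ p.toReal =
        ∑ i ∈ s, ‖w i.1 i.2‖ ^ p.toReal :=
      Finset.sum_congr rfl fun i _ ↦ by rw [hw, tensorContractLeft_apply_eq]
    rw [h1]
    -- Enlarging s to a rectangle lets the inner sums be bounded by the norms of the contractions.
    calc _ ≤ ∑ i ∈ s.image Prod.fst ×ˢ s.image Prod.snd, ‖w i.1 i.2‖ ^ p.toReal :=
          Finset.sum_le_sum_of_subset_of_nonneg Finset.subset_product
            fun i _ _ ↦ Real.rpow_nonneg (norm_nonneg _) _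
      _ ≤ _ := by
          rw [Finset.sum_product]
          exact Finset.sum_le_sum fun n _ ↦ lp.sum_rpow_le_norm_rpow hp (w n) (s.image Prod.snd)
  · refine ENNReal.toReal_le_of_le_ofReal (norm_nonneg _) ?_
    refine iSup₂_le fun φ hφ ↦ iSup₂_le fun ψ hψ ↦ ?_
    rw [← ofReal_norm]
    exact ENNReal.ofReal_le_ofReal (norm_alphaPairing_le_norm_lift hφ hψ _)

variable (𝕜 p q E)

/-- The isometric embedding `∑ xⱼ ⊗ yⱼ ↦ (∑ⱼ yⱼ(k) xⱼ)ₖ` of `E ⊗_α ℓ_p` into `(ℓ_p^mid)^u(E)`. -/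
noncomputable def AlphaTensor.toMidU :
    AlphaTensor 𝕜 p q E (lp (fun _ : ℕ ↦ 𝕜) p) →ₗᵢ[𝕜] MidU 𝕜 p E where
  toLinearMap := TensorProduct.lift MidU.smulSeq ∘ₗ
    (AlphaTensor.toTensor 𝕜 p q E (lp (fun _ : ℕ ↦ 𝕜) p)).toLinearMap
  norm_map' := AlphaTensor.norm_lift_smulSeq

variable {𝕜 p q E}

@[simp]
theorem AlphaTensor.toMidU_tmul (x : E) (a : lp (fun _ : ℕ ↦ 𝕜) p) :
    AlphaTensor.toMidU 𝕜 p q E (AlphaTensor.tmul 𝕜 p q x a) = MidU.smulSeq x a := rfl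

theorem AlphaTensor.denseRange_toMidU : DenseRange (AlphaTensor.toMidU 𝕜 p q E) := by
  intro x
  refine mem_closure_of_tendsto (MidU.tendsto_proj_Iio x) (Eventually.of_forall fun N ↦ ?_)
  rw [MidU.proj_Iio_eq_sum]
  exact ⟨∑ j ∈ Finset.range N, AlphaTensor.tmul 𝕜 p q (MidU.seq 𝕜 p E x j)
    (lp.single (E := fun _ : ℕ ↦ 𝕜) p j 1), by rw [map_sum]; rfl⟩

variable (𝕜 p q E)

/-- The dual of `(ℓ_p^mid)^u(E)` is the dual of the completion of `E ⊗_α ℓ_p`. -/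
noncomputable def MidU.dualEquivCompletion : StrongDual 𝕜 (MidU 𝕜 p E) ≃ₗᵢ[𝕜]
    StrongDual 𝕜 (AlphaCompletion 𝕜 p q E (lp (fun _ : ℕ ↦ 𝕜) p)) :=
  ((AlphaTensor.toMidU 𝕜 p q E).dualEquiv AlphaTensor.denseRange_toMidU).trans
    ((UniformSpace.Completion.toComplₗᵢ (𝕜 := 𝕜)).dualEquiv
      UniformSpace.Completion.denseRange_coe).symm

theorem MidU.dualEquivCompletion_tmul (f : StrongDual 𝕜 (MidU 𝕜 p E)) (x : E)
    (a : lp (fun _ : ℕ ↦ 𝕜) p) :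
    MidU.dualEquivCompletion 𝕜 p q E f (AlphaCompletion.tmul 𝕜 p q x a) =
      f (MidU.smulSeq x a) :=
  LinearIsometry.dualEquiv_symm_apply _ UniformSpace.Completion.denseRange_coe _
    (AlphaTensor.tmul 𝕜 p q x a)

end embedding

/-! ### Integral forms as the dual of E ⊗_α F -/

section integralDual

variable (𝕜 : Type*) [RCLike 𝕜] (p q : ℝ≥0∞) [Fact (1 < p)] [Fact (1 < q)] [p.HolderConjugate q]
  (E F : Type*) [NormedAddCommGroup E] [NormedSpace 𝕜 E] [NormedAddCommGroup F] [NormedSpace 𝕜 F]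

/-- The space of integral forms is the dual of `E ⊗_α F`. -/
noncomputable def IntegralForm.dualEquiv :
    IntegralForm 𝕜 p q E F ≃ₗᵢ[𝕜] StrongDual 𝕜 (AlphaTensor 𝕜 p q E F) :=
  .ofSurjective ⟨IntegralForm.toDual 𝕜 p q E F, fun _ ↦ rfl⟩ fun g ↦ by
    have h : linearization 𝕜 p q (TensorProduct.curry
        (g.toLinearMap ∘ₗ (AlphaTensor.toTensor 𝕜 p q E F).symm.toLinearMap)) = g.toLinearMap := by
      refine LinearMap.ext fun u ↦ ?_
      exact (DFunLike.congr_fun (TensorProduct.lift.unique (g := g.toLinearMap ∘ₗ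
        (AlphaTensor.toTensor 𝕜 p q E F).symm.toLinearMap)
        (f' := TensorProduct.curry (g.toLinearMap ∘ₗ
          (AlphaTensor.toTensor 𝕜 p q E F).symm.toLinearMap)) fun _ _ ↦ rfl)
        (AlphaTensor.toTensor 𝕜 p q E F u)).symm
    refine ⟨⟨TensorProduct.curry
      (g.toLinearMap ∘ₗ (AlphaTensor.toTensor 𝕜 p q E F).symm.toLinearMap), ?_⟩, ?_⟩
    · change Continuous _
      rw [h]
      exact g.continuous
    · ext u
      exact DFunLike.congr_fun h u

theorem IntegralForm.form_dualEquiv_symm (g : StrongDual 𝕜 (AlphaTensor 𝕜 p q E F)) (x : E)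
    (y : F) : IntegralForm.form 𝕜 p q E F ((IntegralForm.dualEquiv 𝕜 p q E F).symm g) x y =
      g (AlphaTensor.tmul 𝕜 p q x y) := by
  conv_rhs => rw [← (IntegralForm.dualEquiv 𝕜 p q E F).apply_symm_apply g]
  rfl

end integralDual

/-! ### Weak* compact convex sets of functionals -/

section separation

variable {𝕜 : Type*} [RCLike 𝕜] {G : Type*} [NormedAddCommGroup G] [NormedSpace 𝕜 G]

instance WeakDual.isScalarTower_real : IsScalarTower ℝ 𝕜 (WeakDual 𝕜 G) :=
  ⟨fun r c f ↦ DFunLike.ext _ _ fun x ↦ smul_assoc r c (f x)⟩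

instance WeakDual.locallyConvexSpace_real : LocallyConvexSpace ℝ (WeakDual 𝕜 G) :=
  inferInstanceAs (LocallyConvexSpace ℝ (WeakBilin (topDualPairing 𝕜 G)))

/-- The weak* continuous functionals are the evaluations. -/
theorem WeakDual.exists_eq_eval (f : StrongDual 𝕜 (WeakDual 𝕜 G)) : ∃ x : G, ∀ v, f v = v x := by
  obtain ⟨x, hx⟩ := LinearMap.dualEmbedding_surjective (topDualPairing 𝕜 G) f
  exact ⟨x, fun v ↦ (DFunLike.congr_fun hx v).symm⟩

/-- Hahn–Banach separation for the weak* topology, whose continuous functionals are evaluations;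
hence membership in V can be tested at single vectors of G. -/
theorem WeakDual.exists_re_lt_of_notMem {V : Set (WeakDual 𝕜 G)} (hconv : Convex ℝ V)
    (hclosed : IsClosed V) {b : WeakDual 𝕜 G} (hb : b ∉ V) :
    ∃ (x : G) (u : ℝ), (∀ v ∈ V, RCLike.re (v x) < u) ∧ u < RCLike.re (b x) := by
  have h : ∃ (f : StrongDual 𝕜 (WeakDual 𝕜 G)) (u : ℝ),
      (∀ v ∈ V, RCLike.re (f v) < u) ∧ u < RCLike.re (f b) :=
    RCLike.geometric_hahn_banach_closed_point (E := WeakDual 𝕜 G) (𝕜 := 𝕜) hconv hclosed hb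
  obtain ⟨f, u, h⟩ := h
  obtain ⟨x, hx⟩ := WeakDual.exists_eq_eval f
  simp only [hx] at h
  exact ⟨x, u, h⟩

/-- A bipolar theorem: a functional that is dominated at every vector by a member of a weak* closed,
absolutely convex set belongs to this set. -/
theorem WeakDual.mem_of_forall_exists_norm_le {V : Set (WeakDual 𝕜 G)} (hconv : Convex ℝ V)
    (hclosed : IsClosed V) (hbal : ∀ v ∈ V, ∀ c : 𝕜, ‖c‖ ≤ 1 → c • v ∈ V) {b : WeakDual 𝕜 G}
    (h : ∀ x, ∃ v ∈ V, ‖b x‖ ≤ ‖v x‖) : b ∈ V := by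
  by_contra hb
  obtain ⟨x, u, hu, hub⟩ := WeakDual.exists_re_lt_of_notMem hconv hclosed hb
  obtain ⟨v, hv, hbv⟩ := h x
  -- Balancedness lets v be rotated so that its value at x is ‖v x‖, contradicting the separation of
  -- real parts.
  obtain ⟨c, hc, hcv⟩ := RCLike.exists_mul_eq_norm (v x)
  have h1 : RCLike.re (c * v x) < u := hu _ (hbal v hv c hc)
  rw [hcv, RCLike.ofReal_re] at h1
  linarith [RCLike.re_le_norm (b x)]

end separation

/-! ### Functionals factoring through finitely many fixed operators -/

section diagonal

variable {𝕜 : Type*} [RCLike 𝕜] {G E : Type*} [NormedAddCommGroup G] [NormedSpace 𝕜 G]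
  [NormedAddCommGroup E] [NormedSpace 𝕜 E] {ι : Type*} [Fintype ι] {P Q : ℝ}

/-- Hölder's inequality on a two-point space with masses a and b; each mass is distributed as a =
a^{1/Q} a^{1/P}. -/
theorem add_mul_le_Lp_mul_Lq (h : P.HolderConjugate Q) {a b c c' z z' : ℝ} (ha : 0 ≤ a)
    (hb : 0 ≤ b) (hc : 0 ≤ c) (hc' : 0 ≤ c') (hz : 0 ≤ z) (hz' : 0 ≤ z') :
    a * (c * z) + b * (c' * z') ≤
      (a * c ^ Q + b * c' ^ Q) ^ (1 / Q) * (a * z ^ P + b * z' ^ P) ^ (1 / P) := by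
  have hsplit : ∀ t : ℝ, 0 ≤ t → t ^ (1 / Q) * t ^ (1 / P) = t := by
    intro t ht
    have h1 : 1 / Q + 1 / P = 1 := by
      rw [one_div, one_div, add_comm]
      exact h.inv_add_inv_eq_one
    rw [← Real.rpow_add' ht (by rw [h1]; exact one_ne_zero), h1, Real.rpow_one]
  have hpow : ∀ t s r : ℝ, r ≠ 0 → 0 ≤ t → 0 ≤ s → (t ^ (1 / r) * s) ^ r = t * s ^ r := by
    intro t s r hr ht hs
    rw [Real.mul_rpow (by positivity) hs, ← Real.rpow_mul ht, one_div_mul_cancel hr, Real.rpow_one]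
  have := Real.inner_le_Lp_mul_Lq_of_nonneg (Finset.univ : Finset (Fin 2)) h.symm
    (f := ![a ^ (1 / Q) * c, b ^ (1 / Q) * c']) (g := ![a ^ (1 / P) * z, b ^ (1 / P) * z'])
    (by intro i _; fin_cases i <;> simp <;> positivity)
    (by intro i _; fin_cases i <;> simp <;> positivity)
  simp only [Fin.sum_univ_two, Matrix.cons_val_zero, Matrix.cons_val_one] at this
  rw [hpow a c Q h.symm.ne_zero ha hc, hpow b c' Q h.symm.ne_zero hb hc',
    hpow a z P h.ne_zero ha hz, hpow b z' P h.ne_zero hb hz'] at this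
  refine le_of_eq_of_le ?_ this
  calc a * (c * z) + b * (c' * z') = (a ^ (1 / Q) * a ^ (1 / P)) * (c * z) +
        (b ^ (1 / Q) * b ^ (1 / P)) * (c' * z') := by rw [hsplit a ha, hsplit b hb]
    _ = _ := by ring

/-- The functionals `∑ᵢ cᵢ φᵢ ∘ Tᵢ` with `φ` in the unit ball of `ℓ_p^w(E')` and `c` in the unit
ball of `ℓ_q`. -/
def diagonalFunctionals (P Q : ℝ) (T : ι → G →L[𝕜] E) : Set (WeakDual 𝕜 G) :=
  {v | ∃ (φ : ι → WeakDual 𝕜 E) (c : ι → ℝ), (∀ x, ∑ i, ‖φ i x‖ ^ P ≤ ‖x‖ ^ P) ∧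
    ((∀ i, 0 ≤ c i) ∧ ∑ i, c i ^ Q ≤ 1) ∧ ∀ x, v x = ∑ i, (c i : 𝕜) * φ i (T i x)}

/-- The scalar is absorbed by the φᵢ, so the cᵢ stay nonnegative. -/
theorem smul_mem_diagonalFunctionals (hP : 0 ≤ P) (T : ι → G →L[𝕜] E) {v : WeakDual 𝕜 G}
    (hv : v ∈ diagonalFunctionals P Q T) {a : 𝕜} (ha : ‖a‖ ≤ 1) :
    a • v ∈ diagonalFunctionals P Q T := by
  obtain ⟨φ, c, hφ, hc, hv⟩ := hv
  refine ⟨fun i ↦ a • φ i, c, fun x ↦ le_trans (Finset.sum_le_sum fun i _ ↦ ?_) (hφ x), hc,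
    fun x ↦ ?_⟩
  · refine Real.rpow_le_rpow (norm_nonneg _) ?_ hP
    change ‖a • φ i x‖ ≤ _
    rw [norm_smul]
    exact mul_le_of_le_one_left (norm_nonneg _) ha
  · change a • v x = ∑ i, (c i : 𝕜) * (a • φ i (T i x))
    rw [hv, Finset.smul_sum]
    refine Finset.sum_congr rfl fun i _ ↦ ?_
    simp only [smul_eq_mul]
    ring

/-- Combine index by index: dᵢ = (a cᵢ^Q + b c'ᵢ^Q)^{1/Q} is the new coefficient and (a cᵢφᵢ + b
c'ᵢφ'ᵢ)/dᵢ the new functional. Two-point Hölder bounds the latter at x by (a|φᵢ(x)|^P +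
b|φ'ᵢ(x)|^P)^{1/P}, so both constraints average. The index set does not grow because the Tᵢ are the
same for both members. -/
theorem convex_diagonalFunctionals (h : P.HolderConjugate Q) (T : ι → G →L[𝕜] E) :
    Convex ℝ (diagonalFunctionals P Q T) := by
  rintro v ⟨φ, c, hφ, ⟨hc0, hc⟩, hv⟩ w ⟨φ', c', hφ', ⟨hc0', hc'⟩, hw⟩ a b ha hb hab
  have hnn : ∀ i, 0 ≤ a * c i ^ Q + b * c' i ^ Q := fun i ↦
    add_nonneg (mul_nonneg ha (Real.rpow_nonneg (hc0 i) _))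
      (mul_nonneg hb (Real.rpow_nonneg (hc0' i) _))
  set d : ι → ℝ := fun i ↦ (a * c i ^ Q + b * c' i ^ Q) ^ (1 / Q) with hd
  have hd0 : ∀ i, 0 ≤ d i := fun i ↦ Real.rpow_nonneg (hnn i) _
  have hnz : ∀ i (x : E), 0 ≤ a * ‖φ i x‖ ^ P + b * ‖φ' i x‖ ^ P := fun i x ↦ by positivity
  have hbound : ∀ i (x : E), ‖((a * c i : ℝ) : 𝕜) * φ i x + ((b * c' i : ℝ) : 𝕜) * φ' i x‖ ≤
      d i * (a * ‖φ i x‖ ^ P + b * ‖φ' i x‖ ^ P) ^ (1 / P) := by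
    intro i x
    refine le_trans ?_ (add_mul_le_Lp_mul_Lq h ha hb (hc0 i) (hc0' i) (norm_nonneg _)
      (norm_nonneg _))
    refine (norm_add_le _ _).trans_eq ?_
    rw [norm_mul, norm_mul, RCLike.norm_ofReal, RCLike.norm_ofReal,
      abs_of_nonneg (mul_nonneg ha (hc0 i)), abs_of_nonneg (mul_nonneg hb (hc0' i)),
      mul_assoc, mul_assoc]
  refine ⟨fun i ↦ ((d i)⁻¹ : 𝕜) • (((a * c i : ℝ) : 𝕜) • φ i + ((b * c' i : ℝ) : 𝕜) • φ' i), d,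
    fun x ↦ ?_, ⟨hd0, ?_⟩, fun x ↦ ?_⟩
  · calc _ ≤ ∑ i, (a * ‖φ i x‖ ^ P + b * ‖φ' i x‖ ^ P) := by
          refine Finset.sum_le_sum fun i _ ↦ ?_
          change ‖(d i : 𝕜)⁻¹ • (((a * c i : ℝ) : 𝕜) • φ i x +
            ((b * c' i : ℝ) : 𝕜) • φ' i x)‖ ^ P ≤ _
          have h1 : ‖(d i : 𝕜)⁻¹ • (((a * c i : ℝ) : 𝕜) • φ i x +
              ((b * c' i : ℝ) : 𝕜) • φ' i x)‖ ≤
              (a * ‖φ i x‖ ^ P + b * ‖φ' i x‖ ^ P) ^ (1 / P) := by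
            rw [norm_smul, norm_inv, RCLike.norm_ofReal, abs_of_nonneg (hd0 i)]
            rcases (hd0 i).eq_or_lt with h0 | h0
            · rw [← h0, inv_zero, zero_mul]
              exact Real.rpow_nonneg (hnz i x) _
            · rw [inv_mul_le_iff₀ h0]
              exact hbound i x
          refine (Real.rpow_le_rpow (norm_nonneg _) h1 h.nonneg).trans_eq ?_
          rw [← Real.rpow_mul (hnz i x), one_div_mul_cancel h.ne_zero, Real.rpow_one]
      _ = a * ∑ i, ‖φ i x‖ ^ P + b * ∑ i, ‖φ' i x‖ ^ P := by
          rw [Finset.sum_add_distrib, Finset.mul_sum, Finset.mul_sum]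
      _ ≤ a * ‖x‖ ^ P + b * ‖x‖ ^ P := by
          gcongr
          exacts [hφ x, hφ' x]
      _ = ‖x‖ ^ P := by rw [← add_mul, hab, one_mul]
  · calc ∑ i, d i ^ Q = a * ∑ i, c i ^ Q + b * ∑ i, c' i ^ Q := by
          rw [Finset.mul_sum, Finset.mul_sum, ← Finset.sum_add_distrib]
          refine Finset.sum_congr rfl fun i _ ↦ ?_
          rw [hd, ← Real.rpow_mul (hnn i), one_div_mul_cancel h.symm.ne_zero, Real.rpow_one]
      _ ≤ a * 1 + b * 1 := by gcongr
      _ = 1 := by rw [← add_mul, hab, one_mul]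
  · change a • v x + b • w x = ∑ i, (d i : 𝕜) * ((d i : 𝕜)⁻¹ •
      (((a * c i : ℝ) : 𝕜) • φ i (T i x) + ((b * c' i : ℝ) : 𝕜) • φ' i (T i x)))
    rw [hv, hw, RCLike.real_smul_eq_coe_mul, RCLike.real_smul_eq_coe_mul, Finset.mul_sum,
      Finset.mul_sum, ← Finset.sum_add_distrib]
    refine Finset.sum_congr rfl fun i _ ↦ ?_
    have hi := hbound i (T i x)
    simp only [smul_eq_mul]
    -- If dᵢ = 0, its inverse has the default value 0; the identity survives because the bound then
    -- makes the combined value vanish too.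
    rcases eq_or_ne (d i) 0 with h0 | h0
    · rw [h0, zero_mul, norm_le_zero_iff] at hi
      rw [hi, mul_zero, mul_zero, ← hi]
      push_cast
      ring
    · have h0' : (d i : 𝕜) ≠ 0 := by exact_mod_cast h0
      rw [mul_inv_cancel_left₀ h0']
      push_cast
      ring

/-- The set is a continuous image of its parameters (φ, c), which are compact by Banach–Alaoglu and
boundedness. Finiteness of the index set matters: at each x the parametrisation is a finite sum of
products, hence continuous. -/
theorem isCompact_diagonalFunctionals (h : P.HolderConjugate Q) (T : ι → G →L[𝕜] E) :
    IsCompact (diagonalFunctionals P Q T) := by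
  let K₁ : Set (ι → WeakDual 𝕜 E) := {φ | ∀ x, ∑ i, ‖φ i x‖ ^ P ≤ ‖x‖ ^ P}
  let K₂ : Set (ι → ℝ) := {c | ∀ i, 0 ≤ c i} ∩ {c | ∑ i, c i ^ Q ≤ 1}
  have hK₁ : IsCompact K₁ := by
    refine (isCompact_univ_pi fun _ : ι ↦
      WeakDual.isCompact_closedBall (𝕜 := 𝕜) (E := E) 0 1).of_isClosed_subset ?_ ?_
    · simp only [K₁, Set.ofPred_forall]
      refine isClosed_iInter fun x ↦ isClosed_le (continuous_finsetSum _ fun i _ ↦ ?_)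
        continuous_const
      exact (((WeakDual.eval_continuous x).comp (continuous_apply i)).norm).rpow_const
        fun _ ↦ Or.inr h.nonneg
    · intro φ hφ i _
      simp only [Set.mem_preimage, mem_closedBall_zero_iff]
      refine ContinuousLinearMap.opNorm_le_bound _ zero_le_one fun x ↦ ?_
      rw [one_mul, ← Real.rpow_le_rpow_iff (norm_nonneg _) (norm_nonneg _) h.pos]
      exact (Finset.single_le_sum (f := fun i ↦ ‖φ i x‖ ^ P) (fun i _ ↦ by positivity)
        (Finset.mem_univ i)).trans (hφ x)
  have hK₂ : IsCompact K₂ := by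
    refine (isCompact_univ_pi fun _ : ι ↦ isCompact_Icc (a := (0 : ℝ)) (b := 1)).of_isClosed_subset
      ?_ ?_
    · refine IsClosed.inter ?_ (isClosed_le (continuous_finsetSum _ fun i _ ↦ ?_) continuous_const)
      · simp only [Set.ofPred_forall]
        exact isClosed_iInter fun i ↦ isClosed_le continuous_const (continuous_apply i)
      · exact (continuous_apply i).rpow_const fun _ ↦ Or.inr h.symm.nonneg
    · rintro c ⟨hc0, hc⟩ i _
      refine ⟨hc0 i, ?_⟩
      rw [← Real.rpow_le_rpow_iff (hc0 i) zero_le_one h.symm.pos, Real.one_rpow]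
      exact (Finset.single_le_sum (f := fun i ↦ c i ^ Q)
        (fun i _ ↦ Real.rpow_nonneg (hc0 i) _) (Finset.mem_univ i)).trans hc
  let Φ : (ι → WeakDual 𝕜 E) × (ι → ℝ) → WeakDual 𝕜 G := fun z ↦
    StrongDual.toWeakDual (∑ i, (z.2 i : 𝕜) • (WeakDual.toStrongDual (z.1 i) ∘L T i))
  have hΦ_apply : ∀ z x, Φ z x = ∑ i, (z.2 i : 𝕜) * z.1 i (T i x) := by
    intro z x
    change (∑ i, (z.2 i : 𝕜) • (WeakDual.toStrongDual (z.1 i) ∘L T i)) x = _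
    simp
  have hΦ : Continuous Φ := by
    refine WeakDual.continuous_of_continuous_eval fun x ↦ ?_
    simp_rw [hΦ_apply]
    refine continuous_finsetSum _ fun i _ ↦ Continuous.mul ?_ ?_
    · exact RCLike.continuous_ofReal.comp ((continuous_apply i).comp continuous_snd)
    · exact (WeakDual.eval_continuous (T i x)).comp ((continuous_apply i).comp continuous_fst)
  have himage : diagonalFunctionals P Q T = Φ '' (K₁ ×ˢ K₂) := by
    ext v
    constructor
    · rintro ⟨φ, c, hφ, hc, hv⟩
      exact ⟨(φ, c), ⟨hφ, hc⟩, DFunLike.ext _ _ fun x ↦ by rw [hΦ_apply, hv]⟩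
    · rintro ⟨⟨φ, c⟩, ⟨hφ, hc⟩, rfl⟩
      exact ⟨φ, c, hφ, hc, hΦ_apply _⟩
  rw [himage]
  exact (hK₁.prod hK₂).image hΦ

/-- A functional dominated by the `ℓ_p` norms of `(φᵢ(Tᵢ x))ᵢ`, `φ` in the unit ball of
`ℓ_p^w(E')`, is of the form `∑ᵢ cᵢ φᵢ ∘ Tᵢ`. -/
theorem mem_diagonalFunctionals (h : P.HolderConjugate Q) (T : ι → G →L[𝕜] E) (b : WeakDual 𝕜 G)
    (hb : ∀ x, ∃ φ : ι → WeakDual 𝕜 E, (∀ x, ∑ i, ‖φ i x‖ ^ P ≤ ‖x‖ ^ P) ∧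
      ‖b x‖ ^ P ≤ ∑ i, ‖φ i (T i x)‖ ^ P) :
    b ∈ diagonalFunctionals P Q T := by
  refine WeakDual.mem_of_forall_exists_norm_le (convex_diagonalFunctionals h T)
    (isCompact_diagonalFunctionals h T).isClosed
    (fun v hv c hc ↦ smul_mem_diagonalFunctionals h.nonneg T hv hc) fun x ↦ ?_
  obtain ⟨φ, hφ, hbφ⟩ := hb x
  -- With these c, and phases moved into φ, the member of the set takes at x the full ℓ_p norm of
  -- (φᵢ(Tᵢx))ᵢ, which dominates b x.
  obtain ⟨c, hc0, hc, hcφ⟩ := exists_nonneg_sum_mul_eq_Lp h Finset.univ (fun i ↦ ‖φ i (T i x)‖)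
    fun _ ↦ norm_nonneg _
  choose u hu huφ using fun i ↦ RCLike.exists_mul_eq_norm (φ i (T i x))
  have hsum : ∀ y, (∑ i, (c i : 𝕜) • ((u i • WeakDual.toStrongDual (φ i)) ∘L T i)) y =
      ∑ i, (c i : 𝕜) * (u i • φ i) (T i y) := by
    intro y
    simp
    rfl
  refine ⟨StrongDual.toWeakDual (∑ i, (c i : 𝕜) • ((u i • WeakDual.toStrongDual (φ i)) ∘L T i)),
    ⟨fun i ↦ u i • φ i, c, fun y ↦ ?_, ⟨hc0, hc⟩, hsum⟩, ?_⟩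
  · refine le_trans (Finset.sum_le_sum fun i _ ↦ ?_) (hφ y)
    refine Real.rpow_le_rpow (norm_nonneg _) ?_ h.nonneg
    change ‖u i • φ i y‖ ≤ _
    rw [norm_smul]
    exact mul_le_of_le_one_left (norm_nonneg _) (hu i)
  · have h1 : ∑ i, (c i : 𝕜) * (u i • φ i) (T i x) =
        (((∑ i, ‖φ i (T i x)‖ ^ P) ^ (1 / P) : ℝ) : 𝕜) := by
      rw [← hcφ]
      push_cast
      exact Finset.sum_congr rfl fun i _ ↦ congrArg _ (huφ i)
    have h0 : 0 ≤ ∑ i, ‖φ i (T i x)‖ ^ P := Finset.sum_nonneg fun i _ ↦ by positivity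
    refine le_of_le_of_eq ?_ (congrArg norm ((hsum x).trans h1)).symm
    rw [RCLike.norm_ofReal, abs_of_nonneg (by positivity), one_div,
      Real.le_rpow_inv_iff_of_pos (norm_nonneg _) h0 h.pos]
    exact hbφ

end diagonal

/-! ### Finitely supported functionals on `(ℓ_p^mid)^u(E)` -/

section net

variable {𝕜 : Type*} [RCLike 𝕜] {P Q : ℝ}

/-- The unit ball of `ℓ_q^N` has a finite subset that norms `ℓ_p^N` up to a factor `θ < 1`. -/
theorem exists_finite_norming (h : P.HolderConjugate Q) (N : ℕ) {θ : ℝ} (hθ0 : 0 ≤ θ)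
    (hθ : θ < 1) :
    ∃ (m : ℕ) (v : Fin m → Fin N → 𝕜), (∀ i, ∑ j, ‖v i j‖ ^ Q ≤ 1) ∧
      ∀ w : Fin N → 𝕜, ∃ i, θ ^ P * ∑ j, ‖w j‖ ^ P ≤ ‖∑ j, v i j * w j‖ ^ P := by
  let D : Set (Fin N → 𝕜) := {v | ∑ j, ‖v j‖ ^ Q ≤ 1}
  have hD : TotallyBounded D := by
    have hb : D ⊆ Metric.closedBall 0 1 := by
      intro v hv
      rw [mem_closedBall_zero_iff, pi_norm_le_iff_of_nonneg zero_le_one]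
      intro j
      rw [← Real.rpow_le_rpow_iff (norm_nonneg _) zero_le_one h.symm.pos, Real.one_rpow]
      exact (Finset.single_le_sum (f := fun j ↦ ‖v j‖ ^ Q) (fun i _ ↦ by positivity)
        (Finset.mem_univ j)).trans hv
    exact (isCompact_closedBall (0 : Fin N → 𝕜) 1).totallyBounded.subset hb
  -- A δ-net in the maximum norm: N coordinate errors of size δ add up to at most 1 - θ, and the + 1
  -- covers N = 0.
  set δ : ℝ := (1 - θ) / (N + 1) with hδ
  have hδ0 : 0 < δ := div_pos (by linarith) (by positivity)
  obtain ⟨t, htD, htf, hcov⟩ := Metric.finite_approx_of_totallyBounded hD δ hδ0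
  have : Fintype t := htf.fintype
  refine ⟨Fintype.card t, fun i ↦ ((Fintype.equivFin t).symm i : Fin N → 𝕜),
    fun i ↦ htD ((Fintype.equivFin t).symm i).2, fun w ↦ ?_⟩
  obtain ⟨c, hc, hcw⟩ := exists_sum_mul_eq_Lp h Finset.univ w
  obtain ⟨v, hv, hcv⟩ := Set.mem_iUnion₂.1 (hcov (show c ∈ D from hc))
  refine ⟨Fintype.equivFin t ⟨v, hv⟩, ?_⟩
  simp only [Equiv.symm_apply_apply]
  have h0 : 0 ≤ ∑ j, ‖w j‖ ^ P := Finset.sum_nonneg fun i _ ↦ by positivity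
  set L : ℝ := (∑ j, ‖w j‖ ^ P) ^ (1 / P) with hL
  have hL0 : 0 ≤ L := Real.rpow_nonneg h0 _
  have hLP : L ^ P = ∑ j, ‖w j‖ ^ P := by
    rw [hL, ← Real.rpow_mul h0, one_div_mul_cancel h.ne_zero, Real.rpow_one]
  have hwL : ∀ j, ‖w j‖ ≤ L := by
    intro j
    rw [← Real.rpow_le_rpow_iff (norm_nonneg _) hL0 h.pos, hLP]
    exact Finset.single_le_sum (f := fun j ↦ ‖w j‖ ^ P) (fun i _ ↦ by positivity)
      (Finset.mem_univ j)
  have hdiff : ‖∑ j, (c j - v j) * w j‖ ≤ (1 - θ) * L := by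
    calc ‖∑ j, (c j - v j) * w j‖ ≤ ∑ _j : Fin N, δ * L := by
          refine norm_sum_le_of_le _ fun j _ ↦ ?_
          rw [norm_mul]
          refine mul_le_mul ?_ (hwL j) (norm_nonneg _) hδ0.le
          have h1 := (dist_pi_lt_iff hδ0).1 (Metric.mem_ball.1 hcv) j
          rw [dist_eq_norm] at h1
          exact h1.le
      _ = N * δ * L := by
          rw [Finset.sum_const, Finset.card_univ, Fintype.card_fin, nsmul_eq_mul, mul_assoc]
      _ ≤ (1 - θ) * L := by
          refine mul_le_mul_of_nonneg_right ?_ hL0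
          rw [hδ, mul_div_assoc', div_le_iff₀ (by positivity)]
          nlinarith
  have hsplit : ∑ j, v j * w j = (L : 𝕜) - ∑ j, (c j - v j) * w j := by
    rw [← hcw, ← Finset.sum_sub_distrib]
    exact Finset.sum_congr rfl fun j _ ↦ by ring
  have hmain : θ * L ≤ ‖∑ j, v j * w j‖ := by
    rw [hsplit]
    have h1 := norm_sub_norm_le (L : 𝕜) (∑ j, (c j - v j) * w j)
    rw [RCLike.norm_ofReal, abs_of_nonneg hL0] at h1
    linarith
  rw [← hLP, ← Real.mul_rpow hθ0 hL0]
  exact Real.rpow_le_rpow (mul_nonneg hθ0 hL0) hmain h.nonneg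

/-- Functionals in the unit ball of `ℓ_p^w(E')` can be merged along a finite partition, without
losing their `ℓ_p` norms at one prescribed vector for each class. -/
theorem exists_merge {E : Type*} [NormedAddCommGroup E] [NormedSpace 𝕜 E] {ι : Type*} [Fintype ι]
    (h : P.HolderConjugate Q) (S : Finset ℕ) (φ : ℕ → StrongDual 𝕜 E)
    (hφ : ∀ x, ∑ n ∈ S, ‖φ n x‖ ^ P ≤ ‖x‖ ^ P) (f : ℕ → ι) (y : ι → E) :
    ∃ φ' : ι → WeakDual 𝕜 E, (∀ x, ∑ i, ‖φ' i x‖ ^ P ≤ ‖x‖ ^ P) ∧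
      ∑ i, ‖φ' i (y i)‖ ^ P = ∑ n ∈ S, ‖φ n (y (f n))‖ ^ P := by
  classical
  -- Within class i the coefficients are extremal at yᵢ, so the merged functional attains the ℓ_p
  -- norm of its class there; at any other vector Hölder keeps it below that norm.
  choose c hc hcy using fun i ↦
    exists_sum_mul_eq_Lp h (S.filter fun n ↦ f n = i) (fun n ↦ φ n (y i))
  have happ : ∀ i x, (∑ n ∈ S.filter fun n ↦ f n = i, c i n • φ n) x =
      ∑ n ∈ S.filter fun n ↦ f n = i, c i n * φ n x := by
    intro i x
    simp
  have hnn : ∀ i x, 0 ≤ ∑ n ∈ S.filter fun n ↦ f n = i, ‖φ n x‖ ^ P :=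
    fun i x ↦ Finset.sum_nonneg fun n _ ↦ by positivity
  have hpow : ∀ i x, ((∑ n ∈ S.filter fun n ↦ f n = i, ‖φ n x‖ ^ P) ^ (1 / P)) ^ P =
      ∑ n ∈ S.filter fun n ↦ f n = i, ‖φ n x‖ ^ P := by
    intro i x
    rw [← Real.rpow_mul (hnn i x), one_div_mul_cancel h.ne_zero, Real.rpow_one]
  refine ⟨fun i ↦ StrongDual.toWeakDual (∑ n ∈ S.filter fun n ↦ f n = i, c i n • φ n),
    fun x ↦ ?_, ?_⟩
  · refine le_trans ?_ (hφ x)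
    rw [← Finset.sum_fiberwise S f]
    refine Finset.sum_le_sum fun i _ ↦ ?_
    change ‖(∑ n ∈ S.filter fun n ↦ f n = i, c i n • φ n) x‖ ^ P ≤ _
    rw [happ, ← hpow]
    refine Real.rpow_le_rpow (norm_nonneg _) ?_ h.nonneg
    refine (norm_sum_le _ _).trans ?_
    simp_rw [norm_mul]
    exact sum_mul_le_of_sum_rpow_le_one h _ (fun _ ↦ norm_nonneg _) (fun _ ↦ norm_nonneg _) (hc i)
      (Real.rpow_nonneg (hnn i x) _) (hpow i x).ge
  · rw [← Finset.sum_fiberwise S f]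
    refine Finset.sum_congr rfl fun i _ ↦ ?_
    change ‖(∑ n ∈ S.filter fun n ↦ f n = i, c i n • φ n) (y i)‖ ^ P = _
    rw [happ, hcy, RCLike.norm_ofReal, abs_of_nonneg (Real.rpow_nonneg (hnn i _) _), hpow]
    refine Finset.sum_congr rfl fun n hn ↦ ?_
    rw [(Finset.mem_filter.1 hn).2]

end net

namespace MidU

variable {𝕜 : Type*} [RCLike 𝕜] {p q : ℝ≥0∞} [Fact (1 < p)] [hp2 : Fact (p < ∞)] [Fact (1 < q)]
  [p.HolderConjugate q] {E : Type*} [NormedAddCommGroup E] [NormedSpace 𝕜 E]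

variable (q) in
/-- The functionals on `(ℓ_p^mid)^u(E)` given by a pair of sequences in the unit balls of
`ℓ_p^w(E')` and `ℓ_q(ℓ_p')`. -/
def IsPairing (b : StrongDual 𝕜 (MidU 𝕜 p E)) : Prop :=
  ∃ φ : ℕ → StrongDual 𝕜 E, weakENorm 𝕜 p φ ≤ 1 ∧
    ∃ ψ : lp (fun _ : ℕ ↦ StrongDual 𝕜 (lp (fun _ : ℕ ↦ 𝕜) p)) q, ‖ψ‖ ≤ 1 ∧
      ∀ x a, b (smulSeq x a) = ∑' n, φ n x * ψ n a

/-- The functional `∑ⱼ vⱼ aⱼ` on `ℓ_p`. -/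
noncomputable def finFunctional {N : ℕ} (v : Fin N → 𝕜) :
    StrongDual 𝕜 (lp (fun _ : ℕ ↦ 𝕜) p) :=
  ∑ j, v j • lp.evalCLM 𝕜 (fun _ : ℕ ↦ 𝕜) p (j : ℕ)

omit hp2 in
theorem finFunctional_apply {N : ℕ} (v : Fin N → 𝕜) (a : lp (fun _ : ℕ ↦ 𝕜) p) :
    finFunctional v a = ∑ j, v j * a (j : ℕ) := by
  simp [finFunctional]
  rfl

omit hp2 in
variable (q) in
theorem norm_finFunctional_le {N : ℕ} {v : Fin N → 𝕜} (hv : ∑ j, ‖v j‖ ^ q.toReal ≤ 1) :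
    ‖(finFunctional v : StrongDual 𝕜 (lp (fun _ : ℕ ↦ 𝕜) p))‖ ≤ 1 := by
  have hpq := toReal_conj p q
  refine ContinuousLinearMap.opNorm_le_bound _ zero_le_one fun a ↦ ?_
  rw [finFunctional_apply, one_mul]
  refine (norm_sum_le _ _).trans ?_
  simp_rw [norm_mul]
  refine sum_mul_le_of_sum_rpow_le_one hpq Finset.univ (z := fun j : Fin N ↦ ‖a (j : ℕ)‖)
    (fun _ ↦ norm_nonneg _) (fun _ ↦ norm_nonneg _) hv (norm_nonneg _) ?_
  rw [Fin.sum_univ_eq_sum_range (fun j ↦ ‖a j‖ ^ p.toReal)]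
  exact lp.sum_rpow_le_norm_rpow hpq.pos a _

/-- A functional that depends on finitely many entries only and has norm less than one is given by
a pair of sequences in the unit balls of `ℓ_p^w(E')` and `ℓ_q(ℓ_p')`. -/
theorem isPairing_of_comp_proj_eq (b : StrongDual 𝕜 (MidU 𝕜 p E)) (N : ℕ)
    (hbN : ∀ x, b (proj (Set.Iio N) x) = b x) (hb : ‖b‖ < 1) : IsPairing q b := by
  classical
  have hpq := toReal_conj p q
  -- The room between ‖b‖ and 1 pays for the net: losing a factor θ is harmless as long as ‖b‖ < θ.
  obtain ⟨θ, hbθ, hθ⟩ := exists_between hb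
  have hθ0 : 0 < θ := (norm_nonneg b).trans_lt hbθ
  obtain ⟨m, v, hv, hnorming⟩ := exists_finite_norming (𝕜 := 𝕜) hpq N hθ0.le hθ
  let T : Fin m → MidU 𝕜 p E →L[𝕜] E := fun i ↦ ∑ j, v i j • coord (j : ℕ)
  have hT : ∀ i x, T i x = ∑ j, v i j • seq 𝕜 p E x (j : ℕ) := by
    intro i x
    simp [T]
  have hmem : StrongDual.toWeakDual b ∈ diagonalFunctionals p.toReal q.toReal T := by
    refine mem_diagonalFunctionals hpq T _ fun x ↦ ?_
    rcases eq_or_ne ‖proj (Set.Iio N) x‖ 0 with h0 | h0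
    · refine ⟨0, fun x ↦ ?_, ?_⟩
      · have : ∀ i : Fin m, (0 : Fin m → WeakDual 𝕜 E) i x = 0 := fun i ↦ rfl
        simp only [this, norm_zero, Real.zero_rpow hpq.ne_zero, Finset.sum_const_zero]
        positivity
      · have h1 : b x = 0 := by rw [← hbN, norm_eq_zero.1 h0, map_zero]
        change ‖b x‖ ^ p.toReal ≤ _
        rw [h1, norm_zero, Real.zero_rpow hpq.ne_zero]
        exact Finset.sum_nonneg fun i _ ↦ by positivity
    · have hpos : 0 < ‖proj (Set.Iio N) x‖ := lt_of_le_of_ne (norm_nonneg _) (Ne.symm h0)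
      -- Since ‖b‖/θ < 1, this smaller constant does not bound the mid norm, so some φ and some
      -- finite set of pairs exceed it.
      have hlt : ¬ ‖proj (Set.Iio N) x‖ ≤ ‖b‖ / θ * ‖proj (Set.Iio N) x‖ := by
        rw [not_le]
        exact mul_lt_of_lt_one_left hpos ((div_lt_one hθ0).2 hbθ)
      rw [norm_le_iff _ (by positivity)] at hlt
      push Not at hlt
      obtain ⟨φ, hφ, s, hs⟩ := hlt
      -- Each n is classified by a net vector that nearly norms (φₙ(xⱼ))ⱼ; merging over the classes
      -- leaves one functional for each Tᵢ.
      choose f hf using fun n ↦ hnorming fun j ↦ φ n (seq 𝕜 p E x (j : ℕ))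
      have hfT : ∀ n, θ ^ p.toReal * ∑ j ∈ Finset.range N, ‖φ n (seq 𝕜 p E x j)‖ ^ p.toReal ≤
          ‖φ n (T (f n) x)‖ ^ p.toReal := by
        intro n
        rw [← Fin.sum_univ_eq_sum_range (fun j ↦ ‖φ n (seq 𝕜 p E x j)‖ ^ p.toReal), hT, map_sum]
        simp_rw [map_smul, smul_eq_mul]
        exact hf n
      obtain ⟨φ', hφ', hφ'T⟩ := exists_merge hpq (s.image Prod.fst) φ
        (fun x ↦ sum_rpow_le_of_weakENorm_le_one hpq.pos hφ x _) f fun i ↦ T i x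
      refine ⟨φ', hφ', ?_⟩
      rw [hφ'T]
      have hle : ∑ i ∈ s, ‖φ i.1 (seq 𝕜 p E (proj (Set.Iio N) x) i.2)‖ ^ p.toReal ≤
          ∑ n ∈ s.image Prod.fst, ∑ j ∈ Finset.range N, ‖φ n (seq 𝕜 p E x j)‖ ^ p.toReal := by
        rw [← Finset.sum_product' (f := fun n j ↦ ‖φ n (seq 𝕜 p E x j)‖ ^ p.toReal)]
        rw [← Finset.sum_filter_add_sum_filter_not s fun i ↦ i.2 < N]
        have h2 : ∑ i ∈ s with ¬ i.2 < N,
            ‖φ i.1 (seq 𝕜 p E (proj (Set.Iio N) x) i.2)‖ ^ p.toReal = 0 := by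
          refine Finset.sum_eq_zero fun i hi ↦ ?_
          rw [seq_proj, Set.indicator_of_notMem (by simpa using (Finset.mem_filter.1 hi).2),
            map_zero, norm_zero, Real.zero_rpow hpq.ne_zero]
        rw [h2, add_zero]
        refine (Finset.sum_congr rfl fun i hi ↦ ?_).trans_le
          (Finset.sum_le_sum_of_subset_of_nonneg (s := s.filter fun i ↦ i.2 < N) ?_
            fun i _ _ ↦ by positivity)
        · rw [seq_proj, Set.indicator_of_mem (by simpa using (Finset.mem_filter.1 hi).2)]
        · intro i hi
          rw [Finset.mem_filter] at hi
          exact Finset.mem_product.2 ⟨Finset.mem_image_of_mem _ hi.1, Finset.mem_range.2 hi.2⟩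
      calc ‖b x‖ ^ p.toReal ≤ (‖b‖ * ‖proj (Set.Iio N) x‖) ^ p.toReal := by
            refine Real.rpow_le_rpow (norm_nonneg _) ?_ hpq.nonneg
            rw [← hbN]
            exact b.le_opNorm _
        _ = θ ^ p.toReal * (‖b‖ / θ * ‖proj (Set.Iio N) x‖) ^ p.toReal := by
            rw [← Real.mul_rpow hθ0.le (by positivity)]
            congr 1
            field_simp
        _ ≤ θ ^ p.toReal * ∑ n ∈ s.image Prod.fst,
              ∑ j ∈ Finset.range N, ‖φ n (seq 𝕜 p E x j)‖ ^ p.toReal := by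
            gcongr
            exact hs.le.trans hle
        _ ≤ _ := by
            rw [Finset.mul_sum]
            exact Finset.sum_le_sum fun n _ ↦ hfT n
  obtain ⟨φ, c, hφ, ⟨hc0, hc⟩, hbφ⟩ := hmem
  -- On (aₖx)ₖ the operator Tᵢ gives (∑ⱼ vᵢⱼaⱼ)x, so ψᵢ is cᵢ times the functional of vᵢ; both
  -- families continue by 0 beyond m.
  let φ' : ℕ → StrongDual 𝕜 E := fun n ↦
    if h : n < m then WeakDual.toStrongDual (φ ⟨n, h⟩) else 0
  let ψ' : ℕ → StrongDual 𝕜 (lp (fun _ : ℕ ↦ 𝕜) p) := fun n ↦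
    if h : n < m then (c ⟨n, h⟩ : 𝕜) • finFunctional (v ⟨n, h⟩) else 0
  have hsum : ∀ (g : ℕ → ℝ) (s : Finset ℕ), (∀ n, 0 ≤ g n) → (∀ n, ¬ n < m → g n = 0) →
      ∑ n ∈ s, g n ≤ ∑ i : Fin m, g i := by
    intro g s hg0 hg
    rw [Fin.sum_univ_eq_sum_range, ← Finset.sum_filter_add_sum_filter_not s fun n ↦ n < m,
      Finset.sum_eq_zero (s := s.filter fun n ↦ ¬ n < m)
        (fun n hn ↦ hg n (Finset.mem_filter.1 hn).2), add_zero]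
    exact Finset.sum_le_sum_of_subset_of_nonneg
      (fun n hn ↦ Finset.mem_range.2 (Finset.mem_filter.1 hn).2) fun n _ _ ↦ hg0 n
  have hφ'i : ∀ (i : Fin m) (x : E), φ' i x = φ i x := fun i x ↦ by simp [φ']
  have hψ'i : ∀ i : Fin m, ψ' i = (c i : 𝕜) • finFunctional (v i) := fun i ↦ by simp [ψ']
  have hψsum : ∀ s : Finset ℕ, ∑ n ∈ s, ‖ψ' n‖ ^ q.toReal ≤ 1 ^ q.toReal := by
    intro s
    refine (hsum (fun n ↦ ‖ψ' n‖ ^ q.toReal) s (fun n ↦ by positivity) fun n hn ↦ ?_).trans ?_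
    · simp [ψ', hn, hpq.symm.ne_zero]
    · rw [Real.one_rpow]
      refine le_trans (Finset.sum_le_sum fun i _ ↦ ?_) hc
      refine Real.rpow_le_rpow (norm_nonneg _) ?_ hpq.symm.nonneg
      rw [hψ'i, norm_smul, RCLike.norm_ofReal, abs_of_nonneg (hc0 i)]
      exact mul_le_of_le_one_right (hc0 i) (norm_finFunctional_le q (hv i))
  refine ⟨φ', weakENorm_le_one hpq fun x s ↦ ?_, ⟨ψ', memℓp_gen' hψsum⟩,
    lp.norm_le_of_forall_sum_le hpq.symm.pos zero_le_one hψsum, fun x a ↦ ?_⟩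
  · refine (hsum (fun n ↦ ‖φ' n x‖ ^ p.toReal) s (fun n ↦ by positivity) fun n hn ↦ ?_).trans ?_
    · simp [φ', hn, hpq.ne_zero]
    · simp_rw [hφ'i]
      exact hφ x
  · change _ = ∑' n, φ' n x * ψ' n a
    rw [tsum_eq_sum (s := Finset.range m),
      ← Fin.sum_univ_eq_sum_range (fun n ↦ φ' n x * ψ' n a)]
    · refine (hbφ _).trans (Finset.sum_congr rfl fun i _ ↦ ?_)
      have h1 : T i (smulSeq x a) = finFunctional (v i) a • x := by
        rw [hT, finFunctional_apply, Finset.sum_smul]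
        exact Finset.sum_congr rfl fun j _ ↦ by rw [seq_smulSeq, smul_smul]
      rw [h1, hφ'i, hψ'i, map_smul, _root_.smul_apply]
      simp only [smul_eq_mul]
      ring
    · intro n hn
      simp [φ', show ¬ n < m by simpa using hn]

end MidU

namespace MidU

variable {𝕜 : Type*} [RCLike 𝕜] {p q : ℝ≥0∞} [Fact (1 < p)] [hp2 : Fact (p < ∞)] [Fact (1 < q)]
  [p.HolderConjugate q] {E : Type*} [NormedAddCommGroup E] [NormedSpace 𝕜 E]

/-! ### `σ`-convexity of the set of pairings -/

/-- Finitely many codes decode into a finite rectangle, where the sum can be iterated. This keeps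
the weighted concatenation of sequences inside its unit ball. -/
theorem sum_unpair_le {g : ℕ → ℕ → ℝ} {c : ℕ → ℝ} (hg : ∀ k n, 0 ≤ g k n) (hc0 : ∀ k, 0 ≤ c k)
    {C : ℝ} (hC : 0 ≤ C) (hgC : ∀ k (s : Finset ℕ), ∑ n ∈ s, g k n ≤ C)
    (hc : ∀ s : Finset ℕ, ∑ k ∈ s, c k ≤ 1) (s : Finset ℕ) :
    ∑ m ∈ s, c m.unpair.1 * g m.unpair.1 m.unpair.2 ≤ C := by
  classical
  set t := s.map Nat.pairEquiv.symm.toEmbedding with ht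
  calc ∑ m ∈ s, c m.unpair.1 * g m.unpair.1 m.unpair.2 = ∑ i ∈ t, c i.1 * g i.1 i.2 := by
        rw [ht, Finset.sum_map]
        rfl
    _ ≤ ∑ i ∈ t.image Prod.fst ×ˢ t.image Prod.snd, c i.1 * g i.1 i.2 :=
        Finset.sum_le_sum_of_subset_of_nonneg Finset.subset_product
          fun i _ _ ↦ mul_nonneg (hc0 _) (hg _ _)
    _ = ∑ k ∈ t.image Prod.fst, c k * ∑ n ∈ t.image Prod.snd, g k n := by
        rw [Finset.sum_product]
        simp_rw [Finset.mul_sum]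
    _ ≤ ∑ k ∈ t.image Prod.fst, c k * C :=
        Finset.sum_le_sum fun k _ ↦ mul_le_mul_of_nonneg_left (hgC _ _) (hc0 k)
    _ ≤ C := by
        rw [← Finset.sum_mul]
        exact mul_le_of_le_one_left hC (hc _)

/-- A countable subconvex combination of pairings is a pairing. -/
theorem isPairing_of_hasSum {b : StrongDual 𝕜 (MidU 𝕜 p E)}
    {β : ℕ → StrongDual 𝕜 (MidU 𝕜 p E)} (hβ : ∀ k, IsPairing q (β k)) {c : ℕ → ℝ}
    (hc0 : ∀ k, 0 ≤ c k) (hc : ∀ s : Finset ℕ, ∑ k ∈ s, c k ≤ 1)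
    (hb : ∀ z, HasSum (fun k ↦ (c k : 𝕜) * β k z) (b z)) : IsPairing q b := by
  have hpq := toReal_conj p q
  choose φ hφ ψ hψ hφψ using hβ
  have hroot : ∀ (k : ℕ) {r : ℝ}, r ≠ 0 → (c k ^ (1 / r)) ^ r = c k := fun k r hr ↦ by
    rw [← Real.rpow_mul (hc0 k), one_div_mul_cancel hr, Real.rpow_one]
  have hroot0 : ∀ (k : ℕ) (r : ℝ), 0 ≤ c k ^ r := fun k r ↦ Real.rpow_nonneg (hc0 k) r
  have hnorm : ∀ {V : Type _} [NormedAddCommGroup V] [NormedSpace 𝕜 V] (k : ℕ) (r : ℝ) (v : V),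
      r ≠ 0 → ‖((c k ^ (1 / r) : ℝ) : 𝕜) • v‖ ^ r = c k * ‖v‖ ^ r := by
    intro V _ _ k r v hr
    rw [norm_smul, RCLike.norm_ofReal, abs_of_nonneg (hroot0 k _),
      Real.mul_rpow (hroot0 k _) (norm_nonneg _), hroot k hr]
  -- The weight cₖ is split as cₖ^{1/p} on the φ side and cₖ^{1/q} on the ψ side: the p-th and q-th
  -- powers each recover cₖ, and so does the product.
  let φ' : ℕ → StrongDual 𝕜 E := fun m ↦
    ((c m.unpair.1 ^ (1 / p.toReal) : ℝ) : 𝕜) • φ m.unpair.1 m.unpair.2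
  let ψ' : ℕ → StrongDual 𝕜 (lp (fun _ : ℕ ↦ 𝕜) p) := fun m ↦
    ((c m.unpair.1 ^ (1 / q.toReal) : ℝ) : 𝕜) • ψ m.unpair.1 m.unpair.2
  have hφ' : weakENorm 𝕜 p φ' ≤ 1 := by
    refine weakENorm_le_one hpq fun x s ↦ ?_
    have h1 : ∀ m, ‖φ' m x‖ ^ p.toReal =
        c m.unpair.1 * ‖φ m.unpair.1 m.unpair.2 x‖ ^ p.toReal := fun m ↦
      hnorm m.unpair.1 p.toReal (φ m.unpair.1 m.unpair.2 x) hpq.ne_zero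
    simp_rw [h1]
    exact sum_unpair_le (g := fun k n ↦ ‖φ k n x‖ ^ p.toReal) (fun k n ↦ by positivity) hc0
      (by positivity) (fun k s ↦ sum_rpow_le_of_weakENorm_le_one hpq.pos (hφ k) x s) hc s
  have hψ' : ∀ s : Finset ℕ, ∑ m ∈ s, ‖ψ' m‖ ^ q.toReal ≤ 1 ^ q.toReal := by
    intro s
    have h1 : ∀ m, ‖ψ' m‖ ^ q.toReal =
        c m.unpair.1 * ‖ψ m.unpair.1 m.unpair.2‖ ^ q.toReal := fun m ↦
      hnorm m.unpair.1 q.toReal (ψ m.unpair.1 m.unpair.2) hpq.symm.ne_zero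
    simp_rw [h1]
    refine sum_unpair_le (g := fun k n ↦ ‖ψ k n‖ ^ q.toReal) (fun k n ↦ by positivity) hc0
      (by positivity) (fun k s ↦ ?_) hc s
    exact (lp.sum_rpow_le_norm_rpow hpq.symm.pos (ψ k) s).trans
      (Real.rpow_le_rpow (norm_nonneg _) (hψ k) hpq.symm.nonneg)
  let Ψ : lp (fun _ : ℕ ↦ StrongDual 𝕜 (lp (fun _ : ℕ ↦ 𝕜) p)) q := ⟨ψ', memℓp_gen' hψ'⟩
  refine ⟨φ', hφ', Ψ, lp.norm_le_of_forall_sum_le hpq.symm.pos zero_le_one hψ', fun x a ↦ ?_⟩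
  have hsum : Summable fun m ↦ φ' m x * Ψ m a := by
    refine Summable.of_norm ?_
    simpa using (summable_and_tsum_le hφ' Ψ x a).1
  have hterm : ∀ k n, φ' (Nat.pair k n) x * Ψ (Nat.pair k n) a =
      (c k : 𝕜) * (φ k n x * ψ k n a) := by
    intro k n
    have h1 : c k ^ (1 / p.toReal) * c k ^ (1 / q.toReal) = c k := by
      have h2 : 1 / p.toReal + 1 / q.toReal = 1 := by
        rw [one_div, one_div]
        exact hpq.inv_add_inv_eq_one
      rw [← Real.rpow_add' (hc0 k) (by rw [h2]; exact one_ne_zero), h2, Real.rpow_one]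
    change (((c (Nat.pair k n).unpair.1 ^ (1 / p.toReal) : ℝ) : 𝕜) •
      φ (Nat.pair k n).unpair.1 (Nat.pair k n).unpair.2) x *
      (((c (Nat.pair k n).unpair.1 ^ (1 / q.toReal) : ℝ) : 𝕜) •
        ψ (Nat.pair k n).unpair.1 (Nat.pair k n).unpair.2) a = _
    rw [Nat.unpair_pair, _root_.smul_apply, _root_.smul_apply, smul_eq_mul, smul_eq_mul]
    conv_rhs => rw [← h1]
    push_cast
    ring
  -- Hölder for the concatenated pair gives summability over ℕ × ℕ, which permits iterating the sum.
  have hsum2 : Summable fun i : ℕ × ℕ ↦ (c i.1 : 𝕜) * (φ i.1 i.2 x * ψ i.1 i.2 a) := by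
    have := (Nat.pairEquiv.summable_iff (f := fun m ↦ φ' m x * Ψ m a)).2 hsum
    exact this.congr fun i ↦ hterm i.1 i.2
  rw [← (hb (smulSeq x a)).tsum_eq]
  calc ∑' k, (c k : 𝕜) * β k (smulSeq x a) = ∑' k, ∑' n, (c k : 𝕜) * (φ k n x * ψ k n a) := by
        refine tsum_congr fun k ↦ ?_
        rw [hφψ, tsum_mul_left]
    _ = ∑' i : ℕ × ℕ, (c i.1 : 𝕜) * (φ i.1 i.2 x * ψ i.1 i.2 a) := hsum2.tsum_prod.symm
    _ = ∑' i : ℕ × ℕ, φ' (Nat.pairEquiv i) x * Ψ (Nat.pairEquiv i) a :=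
        tsum_congr fun i ↦ (hterm i.1 i.2).symm
    _ = ∑' m, φ' m x * Ψ m a := Nat.pairEquiv.tsum_eq fun m ↦ φ' m x * Ψ m a

/-! ### Tails of functionals -/

-- Each entry comes from only one of the two summands, so for every φ the double sum splits, and a
-- supremum of sums is at most the sum of suprema.
omit [Fact (1 < p)] in
theorem norm_proj_add_proj_compl_rpow_le [Fact (1 ≤ p)] (A : Set ℕ) (x y : MidU 𝕜 p E) :
    ‖proj A x + proj Aᶜ y‖ ^ p.toReal ≤ ‖proj A x‖ ^ p.toReal + ‖proj Aᶜ y‖ ^ p.toReal := by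
  have hp := toReal_exponent_pos (p := p)
  set C : ℝ := ‖proj A x‖ ^ p.toReal + ‖proj Aᶜ y‖ ^ p.toReal with hC
  have hC0 : 0 ≤ C := by positivity
  have hCp : (C ^ (1 / p.toReal)) ^ p.toReal = C := by
    rw [← Real.rpow_mul hC0, one_div_mul_cancel hp.ne', Real.rpow_one]
  have h : ‖proj A x + proj Aᶜ y‖ ≤ C ^ (1 / p.toReal) := by
    rw [norm_le_iff _ (by positivity)]
    intro φ hφ s
    rw [hCp]
    refine le_trans ?_ (add_le_add (sum_rpow_le (proj A x) hφ s) (sum_rpow_le (proj Aᶜ y) hφ s))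
    rw [← Finset.sum_add_distrib]
    refine Finset.sum_le_sum fun i _ ↦ ?_
    rw [map_add, Pi.add_apply, seq_proj, seq_proj]
    by_cases hi : i.2 ∈ A
    · rw [Set.indicator_of_notMem (show i.2 ∉ Aᶜ from fun h ↦ h hi), add_zero]
      exact le_add_of_nonneg_right (by positivity)
    · rw [Set.indicator_of_notMem hi, zero_add]
      exact le_add_of_nonneg_left (by positivity)
  calc _ ≤ (C ^ (1 / p.toReal)) ^ p.toReal := Real.rpow_le_rpow (norm_nonneg _) h hp.le
    _ = C := hCp

/-- The tails of a functional on `(ℓ_p^mid)^u(E)` tend to zero in norm. -/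
theorem exists_norm_comp_proj_Ici_le (b : StrongDual 𝕜 (MidU 𝕜 p E)) {ε : ℝ} (hε : 0 < ε) :
    ∃ N, ‖b ∘L proj (Set.Ici N)‖ ≤ ε := by
  have hp1 : 1 < p.toReal := by
    rw [← ENNReal.toReal_one]
    exact (ENNReal.toReal_lt_toReal ENNReal.one_ne_top hp2.out.ne).2 Fact.out
  have hp0 : 0 < p.toReal := by linarith
  -- Here p > 1 is essential: the exponent p - 1 is positive, so the bound reached at the end is
  -- small with t.
  obtain ⟨t, ht0, ht⟩ : ∃ t : ℝ, 0 < t ∧ ‖b‖ * t ^ (p.toReal - 1) + t ≤ ε := by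
    have hlim : Tendsto (fun t : ℝ ↦ ‖b‖ * t ^ (p.toReal - 1) + t) (𝓝[>] 0)
        (𝓝 (‖b‖ * 0 ^ (p.toReal - 1) + 0)) := by
      refine Tendsto.mono_left (Continuous.tendsto ?_ 0) nhdsWithin_le_nhds
      exact (continuous_const.mul (continuous_id.rpow_const
        fun _ ↦ Or.inr (by linarith))).add continuous_id
    rw [Real.zero_rpow (by linarith), mul_zero, add_zero] at hlim
    obtain ⟨t, ht, ht'⟩ := ((hlim.eventually_le_const hε).and self_mem_nhdsWithin).exists
    exact ⟨t, ht', ht⟩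
  -- If an initial part of z nearly norms b, adding t times a tail raises the norm only to order t^p
  -- but the value by t times the value on the tail. The defect t² leaves t after division by t.
  obtain ⟨z, hz, hzb⟩ : ∃ z, ‖z‖ ≤ 1 ∧ ‖b‖ - t ^ 2 < ‖b z‖ := by
    rcases lt_or_ge (‖b‖ - t ^ 2) 0 with h | h
    · exact ⟨0, by simp, by simpa using h⟩
    · obtain ⟨z, hz, hz'⟩ := b.exists_lt_apply_of_lt_opNorm
        (show ‖b‖ - t ^ 2 < ‖b‖ from sub_lt_self _ (by positivity))
      exact ⟨z, hz.le, hz'⟩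
  have hlim : Tendsto (fun N ↦ ‖b (proj (Set.Iio N) z)‖) atTop (𝓝 ‖b z‖) :=
    ((b.continuous.tendsto z).comp (tendsto_proj_Iio z)).norm
  obtain ⟨N, hN⟩ := (hlim.eventually_const_lt hzb).exists
  have key : ∀ y : MidU 𝕜 p E, ‖y‖ ≤ 1 → ‖b (proj (Set.Ici N) y)‖ ≤ ε := by
    intro y hy
    obtain ⟨u, hu, hub⟩ := RCLike.exists_mul_eq_norm (b (proj (Set.Iio N) z))
    obtain ⟨u', hu', hub'⟩ := RCLike.exists_mul_eq_norm (b (proj (Set.Ici N) y))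
    have h1 : b (proj (Set.Iio N) (u • z) + proj (Set.Iio N)ᶜ (((t : 𝕜) * u') • y)) =
        ((‖b (proj (Set.Iio N) z)‖ + t * ‖b (proj (Set.Ici N) y)‖ : ℝ) : 𝕜) := by
      rw [Set.compl_Iio, map_smul, map_smul, map_add, map_smul, map_smul, smul_eq_mul, smul_eq_mul,
        hub, mul_assoc, hub']
      push_cast
      rfl
    have h2 := b.le_opNorm (proj (Set.Iio N) (u • z) + proj (Set.Iio N)ᶜ (((t : 𝕜) * u') • y))
    rw [h1, RCLike.norm_ofReal, abs_of_nonneg (by positivity)] at h2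
    have h3 : ‖proj (Set.Iio N) (u • z) + proj (Set.Iio N)ᶜ (((t : 𝕜) * u') • y)‖ ≤
        1 + t ^ p.toReal := by
      have h4 : ‖proj (Set.Iio N) (u • z)‖ ≤ 1 := by
        refine (norm_proj_le _ _).trans ?_
        rw [norm_smul]
        exact mul_le_one₀ hu (norm_nonneg _) hz
      have h5 : ‖proj (Set.Iio N)ᶜ (((t : 𝕜) * u') • y)‖ ≤ t := by
        refine (norm_proj_le _ _).trans ?_
        rw [norm_smul, norm_mul, RCLike.norm_ofReal, abs_of_pos ht0, mul_assoc]
        exact mul_le_of_le_one_right ht0.le (mul_le_one₀ hu' (norm_nonneg _) hy)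
      have h6 := norm_proj_add_proj_compl_rpow_le (Set.Iio N) (u • z) (((t : 𝕜) * u') • y)
      have h7 : ‖proj (Set.Iio N) (u • z) + proj (Set.Iio N)ᶜ (((t : 𝕜) * u') • y)‖ ^ p.toReal ≤
          1 + t ^ p.toReal :=
        h6.trans (add_le_add (Real.rpow_le_one (norm_nonneg _) h4 hp0.le)
          (Real.rpow_le_rpow (norm_nonneg _) h5 hp0.le))
      -- The p-th root is not needed: a number exceeding 1 is at most its own p-th power.
      by_contra! h8
      have h9 : (1 : ℝ) ≤ 1 + t ^ p.toReal := le_add_of_nonneg_right (by positivity)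
      have h10 := Real.self_le_rpow_of_one_le (h9.trans h8.le) hp1.le
      linarith
    have h4 : ‖b (proj (Set.Iio N) z)‖ + t * ‖b (proj (Set.Ici N) y)‖ ≤
        ‖b‖ * (1 + t ^ p.toReal) :=
      h2.trans (mul_le_mul_of_nonneg_left h3 (norm_nonneg _))
    have h5 : t ^ p.toReal = t * t ^ (p.toReal - 1) := by
      rw [← Real.rpow_one_add' ht0.le (by linarith)]
      congr 1
      ring
    rw [h5] at h4
    refine le_trans ?_ ht
    have h6 : t * ‖b (proj (Set.Ici N) y)‖ ≤ t * (‖b‖ * t ^ (p.toReal - 1) + t) := by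
      nlinarith
    exact le_of_mul_le_mul_left h6 ht0
  refine ⟨N, ?_⟩
  by_contra! h
  obtain ⟨y, hy, hy'⟩ := (b ∘L proj (Set.Ici N)).exists_lt_apply_of_lt_opNorm h
  exact (key y hy.le).not_gt hy'

/-- Every functional of norm less than one on `(ℓ_p^mid)^u(E)` is given by a pair of sequences in
the unit balls of `ℓ_p^w(E')` and `ℓ_q(ℓ_p')`. -/
theorem isPairing_of_norm_lt_one (b : StrongDual 𝕜 (MidU 𝕜 p E)) (hb : ‖b‖ < 1) :
    IsPairing q b := by
  set δ : ℝ := 1 - ‖b‖ with hδ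
  have hδ0 : 0 < δ := by linarith
  -- These bound the tails. The resulting weights are ‖b‖ + δ/4 followed by (δ/4)2^{-k}, of total
  -- ‖b‖ + 3δ/4 < 1.
  set e : ℕ → ℝ := fun k ↦ δ / 8 * (1 / 2) ^ k with he
  have he0 : ∀ k, 0 < e k := fun k ↦ by positivity
  have he2 : ∀ k, e k = 2 * e (k + 1) := fun k ↦ by
    simp only [he, pow_succ]
    ring
  choose N hN using fun k ↦ exists_norm_comp_proj_Ici_le b (he0 k)
  let R : ℕ → StrongDual 𝕜 (MidU 𝕜 p E)
    | 0 => b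
    | k + 1 => b ∘L proj (Set.Ici (N k))
  -- The factor 2 on the second tail bound makes each piece strictly smaller than its weight, as
  -- required by the finitely supported case.
  let c : ℕ → ℝ
    | 0 => ‖b‖ + 2 * e 0
    | k + 1 => e k + 2 * e (k + 1)
  have hc0 : ∀ k, 0 < c k := by
    rintro (_ | k)
    · exact add_pos_of_nonneg_of_pos (norm_nonneg b) (by linarith [he0 0])
    · change 0 < e k + 2 * e (k + 1)
      linarith [he0 k, he0 (k + 1)]
  have hclt : ∀ k, ‖R k - R (k + 1)‖ < c k := by
    rintro (_ | k)
    · refine (norm_sub_le _ _).trans_lt ?_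
      change ‖b‖ + ‖b ∘L proj (Set.Ici (N 0))‖ < ‖b‖ + 2 * e 0
      linarith [hN 0, he0 0]
    · refine (norm_sub_le _ _).trans_lt ?_
      change ‖b ∘L proj (Set.Ici (N k))‖ + ‖b ∘L proj (Set.Ici (N (k + 1)))‖ < e k + 2 * e (k + 1)
      linarith [hN k, hN (k + 1), he0 (k + 1)]
  have hcsum : HasSum c (δ / 4 * 2 + c 0) := by
    have h1 : HasSum (fun k : ℕ ↦ δ / 4 * (1 / 2 : ℝ) ^ k) (δ / 4 * 2) :=
      hasSum_geometric_two.mul_left _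
    have h2 : (fun k : ℕ ↦ δ / 4 * (1 / 2 : ℝ) ^ k) = fun k ↦ c (k + 1) := by
      funext k
      change _ = e k + 2 * e (k + 1)
      rw [← he2]
      simp only [he]
      ring
    rw [h2] at h1
    simpa using (hasSum_nat_add_iff (f := c) 1).1 h1
  have hcle : δ / 4 * 2 + c 0 ≤ 1 := by
    change δ / 4 * 2 + (‖b‖ + 2 * (δ / 8 * (1 / 2) ^ 0)) ≤ 1
    rw [pow_zero]
    linarith
  have hpairing : ∀ k, IsPairing q (((c k)⁻¹ : 𝕜) • (R k - R (k + 1))) := by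
    intro k
    obtain ⟨M, hM⟩ : ∃ M, ∀ x, (R k - R (k + 1)) (proj (Set.Iio M) x) = (R k - R (k + 1)) x := by
      rcases k with _ | k
      · refine ⟨N 0, fun x ↦ ?_⟩
        change b (proj (Set.Iio (N 0)) x) - b (proj (Set.Ici (N 0)) (proj (Set.Iio (N 0)) x)) =
          b x - b (proj (Set.Ici (N 0)) x)
        rw [← map_sub, ← map_sub]
        congr 1
        refine seq_injective (funext fun n ↦ ?_)
        simp only [map_sub, Pi.sub_apply, seq_proj, Set.indicator_apply, Set.mem_Iio, Set.mem_Ici]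
        by_cases h : n < N 0 <;> simp [h, not_le.2, not_lt.1]
      -- The cut-offs are not chosen increasing, hence the maximum; beyond it the two tails agree
      -- and the difference vanishes.
      · refine ⟨max (N k) (N (k + 1)), fun x ↦ ?_⟩
        set M := max (N k) (N (k + 1))
        change b (proj (Set.Ici (N k)) (proj (Set.Iio M) x)) -
          b (proj (Set.Ici (N (k + 1))) (proj (Set.Iio M) x)) =
            b (proj (Set.Ici (N k)) x) - b (proj (Set.Ici (N (k + 1))) x)
        rw [← map_sub, ← map_sub]
        congr 1
        refine seq_injective (funext fun n ↦ ?_)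
        simp only [map_sub, Pi.sub_apply, seq_proj, Set.indicator_apply, Set.mem_Iio, Set.mem_Ici]
        by_cases h : n < M
        · simp [h]
        · have h' := max_le_iff.1 (not_lt.1 h)
          simp [h, h'.1, h'.2]
    refine isPairing_of_comp_proj_eq _ M (fun x ↦ ?_) ?_
    · rw [_root_.smul_apply, _root_.smul_apply, hM]
    · rw [norm_smul, norm_inv, RCLike.norm_ofReal, abs_of_pos (hc0 k), inv_mul_lt_iff₀ (hc0 k),
        mul_one]
      exact hclt k
  refine isPairing_of_hasSum hpairing (fun k ↦ (hc0 k).le)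
    (fun s ↦ (sum_le_hasSum s (fun k _ ↦ (hc0 k).le) hcsum).trans hcle) fun z ↦ ?_
  have hz : ∀ k, (c k : 𝕜) * (((c k)⁻¹ : 𝕜) • (R k - R (k + 1))) z = R k z - R (k + 1) z := by
    intro k
    have : (c k : 𝕜) ≠ 0 := by exact_mod_cast (hc0 k).ne'
    rw [_root_.smul_apply, smul_eq_mul, mul_inv_cancel_left₀ this, _root_.sub_apply]
  simp_rw [hz]
  have hsummable : Summable fun k ↦ R k z - R (k + 1) z := by
    refine Summable.of_norm_bounded (g := fun k ↦ c k * ‖z‖) (hcsum.summable.mul_right _) fun k ↦ ?_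
    rw [← _root_.sub_apply]
    exact ((R k - R (k + 1)).le_opNorm z).trans
      (mul_le_mul_of_nonneg_right (hclt k).le (norm_nonneg _))
  rw [hsummable.hasSum_iff_tendsto_nat]
  -- The partial sums telescope to b z minus a tail of b at z.
  simp_rw [Finset.sum_range_sub' fun k ↦ R k z]
  have hR : Tendsto (fun k ↦ R k z) atTop (𝓝 0) := by
    rw [← tendsto_add_atTop_iff_nat 1]
    have he : Tendsto (fun k ↦ e k * ‖z‖) atTop (𝓝 0) := by
      simpa [he] using ((tendsto_pow_atTop_nhds_zero_of_lt_one (by norm_num : (0 : ℝ) ≤ 1 / 2)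
        (by norm_num)).const_mul (δ / 8)).mul_const ‖z‖
    exact squeeze_zero_norm (fun k ↦ ((b ∘L proj (Set.Ici (N k))).le_opNorm z).trans
      (mul_le_mul_of_nonneg_right (hN k) (norm_nonneg _))) he
  simpa using tendsto_const_nhds.sub hR

end MidU

/-! ### Representation by a single point of K -/

section representation

variable {𝕜 : Type*} [RCLike 𝕜] {p q : ℝ≥0∞} [Fact (1 < p)] [Fact (p < ∞)] [Fact (1 < q)]
  [p.HolderConjugate q] {E : Type*} [NormedAddCommGroup E] [NormedSpace 𝕜 E]

/-- An `ℓ_p`-integral form of norm less than `r` is `r` times the evaluation of the kernel at a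
point. -/
theorem IntegralForm.exists_eq_mul_kernel (B : IntegralForm 𝕜 p q E (lp (fun _ : ℕ ↦ 𝕜) p)) {r : ℝ}
    (hr : ‖B‖ < r) : ∃ ω : BallProd 𝕜 p q E (lp (fun _ : ℕ ↦ 𝕜) p), ∀ x a,
      IntegralForm.form 𝕜 p q E _ B x a = r * BallProd.kernel x a ω := by
  have hr0 : 0 < r := (norm_nonneg B).trans_lt hr
  have hr0' : (r : 𝕜) ≠ 0 := by exact_mod_cast hr0.ne'
  let e := (AlphaTensor.toMidU 𝕜 p q E).dualEquiv AlphaTensor.denseRange_toMidU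
  let b : StrongDual 𝕜 (MidU 𝕜 p E) := e.symm (IntegralForm.dualEquiv 𝕜 p q E _ B)
  have hb : ∀ x a, b (MidU.smulSeq x a) = IntegralForm.form 𝕜 p q E _ B x a := fun x a ↦ by
    rw [← AlphaTensor.toMidU_tmul (q := q), LinearIsometry.dualEquiv_symm_apply]
    conv_rhs => rw [← (IntegralForm.dualEquiv 𝕜 p q E _).symm_apply_apply B,
      IntegralForm.form_dualEquiv_symm]
  have hbr : ‖(r⁻¹ : 𝕜) • b‖ < 1 := by
    rw [norm_smul, norm_inv, RCLike.norm_ofReal, abs_of_pos hr0, inv_mul_lt_iff₀ hr0, mul_one,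
      LinearIsometryEquiv.norm_map, LinearIsometryEquiv.norm_map]
    exact hr
  obtain ⟨φ, hφ, ψ, hψ, h⟩ := MidU.isPairing_of_norm_lt_one (q := q) _ hbr
  obtain ⟨ω, hω⟩ := BallProd.exists_kernel_eq hφ hψ
  refine ⟨ω, fun x a ↦ ?_⟩
  rw [hω, ← h, _root_.smul_apply, hb, smul_eq_mul, mul_inv_cancel_left₀ hr0']

end representation

theorem mainTheorem4 {𝕜 : Type*} [RCLike 𝕜] (p q : ℝ≥0∞)
    [Fact (1 < p)] [Fact (p < ∞)] [Fact (1 < q)] [p.HolderConjugate q]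
    (E : Type*) [NormedAddCommGroup E] [NormedSpace 𝕜 E] [CompleteSpace E] :
    (∃ Θ : StrongDual 𝕜 (MidU 𝕜 p E) ≃ₗᵢ[𝕜]
        StrongDual 𝕜 (AlphaCompletion 𝕜 p q E (lp (fun _ : ℕ ↦ 𝕜) p)),
      ∀ (f : StrongDual 𝕜 (MidU 𝕜 p E)) (x : E) (a : lp (fun _ : ℕ ↦ 𝕜) p),
        ∃ s : MidU 𝕜 p E, (∀ k, MidU.seq 𝕜 p E s k = a k • x) ∧
          Θ f (AlphaCompletion.tmul 𝕜 p q x a) = f s) ∧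
    (∃ Ψ : StrongDual 𝕜 (AlphaCompletion 𝕜 p q E (lp (fun _ : ℕ ↦ 𝕜) p)) ≃ₗᵢ[𝕜]
        IntegralForm 𝕜 p q E (lp (fun _ : ℕ ↦ 𝕜) p),
      ∀ (g : StrongDual 𝕜 (AlphaCompletion 𝕜 p q E (lp (fun _ : ℕ ↦ 𝕜) p))) (x : E)
        (a : lp (fun _ : ℕ ↦ 𝕜) p),
        IntegralForm.form 𝕜 p q E _ (Ψ g) x a = g (AlphaCompletion.tmul 𝕜 p q x a)) ∧
    (∀ B : IntegralForm 𝕜 p q E (lp (fun _ : ℕ ↦ 𝕜) p),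
      IsGLB {r : ℝ | ∃ μ : VectorMeasure (BallProd 𝕜 p q E (lp (fun _ : ℕ ↦ 𝕜) p)) 𝕜,
        IsRepresentedBy (IntegralForm.form 𝕜 p q E _ B) μ ∧ r = totalVariationNorm μ} ‖B‖) := by
  refine ⟨⟨MidU.dualEquivCompletion 𝕜 p q E, fun f x a ↦ ⟨MidU.smulSeq x a,
    fun k ↦ MidU.seq_smulSeq .., MidU.dualEquivCompletion_tmul _ _ _ _ f x a⟩⟩,
    ⟨((UniformSpace.Completion.toComplₗᵢ (𝕜 := 𝕜)).dualEquiv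
      UniformSpace.Completion.denseRange_coe).trans (IntegralForm.dualEquiv 𝕜 p q E _).symm,
      fun g x a ↦ IntegralForm.form_dualEquiv_symm _ _ _ _ _ _ x a⟩, fun B ↦ ⟨?_, fun l hl ↦ ?_⟩⟩
  · rintro _ ⟨μ, hμ, rfl⟩
    exact norm_le_totalVariationNorm B hμ
  -- For every r > ‖B‖ there is a representing point mass of total variation r. This also shows that
  -- representing measures exist; attainment of the infimum is not claimed.
  · refine le_of_forall_gt_imp_ge_of_dense fun r hr ↦ hl ?_
    obtain ⟨ω, hω⟩ := IntegralForm.exists_eq_mul_kernel B hr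
    have h := isRepresentedBy_dirac _ ω ((norm_nonneg B).trans hr.le) hω
    exact ⟨_, h.1, h.2.symm⟩
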